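/- Let $K\ge 1$ be a real number, and let $S$ be a set of $n$ points in the three-dimensional real projective space $\mathrm{PG}_3(\mathbb{R})$, no three of them collinear and not all of them coplanar. Call a plane \emph{ordinary} if it is incident with exactly three points of $S$. If $S$ has fewer than $Kn^2$ ordinary planes, then $S$ is contained in the union of at most $4143K$ varieties, each of which is the intersection of two quadrics, that is, the set of common zeros in $\mathrm{PG}_3(\mathbb{R})$ of two linearly independent real quadratic forms in four variables. (No other restriction is imposed on $K$; in particular $K$ may depend on $n$.) -/

import Mathlib

namespace RealSpace

/-- The three-dimensional real projective space: its points are the one-dimensional subspaces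
of `ℝ⁴`. -/
abbrev PG3 : Type := Projectivization ℝ (Fin 4 → ℝ)

/-- A projective line, as a two-dimensional subspace of `ℝ⁴`. -/
def IsLine (L : Submodule ℝ (Fin 4 → ℝ)) : Prop := Module.finrank ℝ L = 2

/-- A projective plane of `PG3`, as a three-dimensional subspace of `ℝ⁴`. -/
def IsPlane (H : Submodule ℝ (Fin 4 → ℝ)) : Prop := Module.finrank ℝ H = 3

/-- Incidence of a point with a line or a plane. -/
def Incident (p : PG3) (W : Submodule ℝ (Fin 4 → ℝ)) : Prop := p.submodule ≤ W

/-- No three distinct points of `S` lie on a common line. -/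
def NoThreeCollinear (S : Finset PG3) : Prop :=
  ∀ p ∈ S, ∀ q ∈ S, ∀ r ∈ S, p ≠ q → p ≠ r → q ≠ r →
    ¬ ∃ L, IsLine L ∧ Incident p L ∧ Incident q L ∧ Incident r L

/-- All points of `S` lie in a common plane. -/
def Coplanar (S : Finset PG3) : Prop := ∃ H, IsPlane H ∧ ∀ p ∈ S, Incident p H

/-- The ordinary planes of `S`: the planes incident with exactly three points of `S`. -/
def ordinaryPlanes (S : Finset PG3) : Set (Submodule ℝ (Fin 4 → ℝ)) :=
  {H | IsPlane H ∧ {p : PG3 | p ∈ S ∧ Incident p H}.ncard = 3}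

/-- The set of points of `PG3` at which the quadratic form `Q` vanishes. -/
def zeroLocus (Q : QuadraticForm ℝ (Fin 4 → ℝ)) : Set PG3 :=
  {p | ∀ v ∈ p.submodule, Q v = 0}

/-- `X` is the intersection of two quadrics: the common zero set of two linearly independent
quadratic forms (so both forms are nonzero, and they are not proportional). -/
def IsIntersectionOfTwoQuadrics (X : Set PG3) : Prop :=
  ∃ Q₁ Q₂ : QuadraticForm ℝ (Fin 4 → ℝ),
    LinearIndependent ℝ ![Q₁, Q₂] ∧ X = zeroLocus Q₁ ∩ zeroLocus Q₂

/-- If no three points of `S` are collinear then `S` has finitely many ordinary planes, so that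
the natural-number cardinality of `ordinaryPlanes S` is the true number of ordinary planes. -/
theorem ordinaryPlanes_finite {S : Finset PG3} (hS : NoThreeCollinear S) :
    (ordinaryPlanes S).Finite := by
  classical
  refine Set.Finite.subset (Set.Finite.image
    (fun t : PG3 × PG3 × PG3 => t.1.submodule ⊔ t.2.1.submodule ⊔ t.2.2.submodule)
    (S ×ˢ S ×ˢ S).finite_toSet) ?_
  rintro H ⟨hH, h3⟩
  obtain ⟨a, b, c, hab, hac, hbc, habc⟩ := Set.ncard_eq_three.mp h3
  have ha : a ∈ S ∧ Incident a H := by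
    have : a ∈ ({a, b, c} : Set PG3) := by simp
    rwa [← habc] at this
  have hb : b ∈ S ∧ Incident b H := by
    have : b ∈ ({a, b, c} : Set PG3) := by simp
    rwa [← habc] at this
  have hc : c ∈ S ∧ Incident c H := by
    have : c ∈ ({a, b, c} : Set PG3) := by simp
    rwa [← habc] at this
  refine ⟨(a, b, c), by simp [ha.1, hb.1, hc.1], ?_⟩
  have hle2 : Module.finrank ℝ (a.submodule ⊔ b.submodule : Submodule ℝ (Fin 4 → ℝ)) = 2 := by
    have h1 := Submodule.finrank_sup_add_finrank_inf_eq a.submodule b.submodule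
    rw [a.finrank_submodule, b.finrank_submodule] at h1
    have h0 : (a.submodule ⊓ b.submodule : Submodule ℝ (Fin 4 → ℝ)) = ⊥ := by
      by_contra hne
      have hpos : 0 < Module.finrank ℝ
          (a.submodule ⊓ b.submodule : Submodule ℝ (Fin 4 → ℝ)) :=
        Nat.pos_of_ne_zero (fun h => hne (Submodule.finrank_eq_zero.mp h))
      have e1 := Submodule.eq_of_le_of_finrank_le
        (inf_le_left : a.submodule ⊓ b.submodule ≤ a.submodule)
        (by rw [a.finrank_submodule]; exact hpos)
      have e2 := Submodule.eq_of_le_of_finrank_le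
        (inf_le_right : a.submodule ⊓ b.submodule ≤ b.submodule)
        (by rw [b.finrank_submodule]; exact hpos)
      exact hab (Projectivization.submodule_injective (e1.symm.trans e2))
    rw [h0, finrank_bot] at h1
    omega
  refine Submodule.eq_of_le_of_finrank_le (sup_le (sup_le ha.2 hb.2) hc.2) ?_
  rw [show Module.finrank ℝ H = 3 from hH]
  by_contra hlt
  have e := Submodule.eq_of_le_of_finrank_le
    (le_sup_left : a.submodule ⊔ b.submodule ≤ a.submodule ⊔ b.submodule ⊔ c.submodule)
    (by rw [hle2]; exact Nat.lt_succ_iff.mp (not_le.mp hlt))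
  exact hS a ha.1 b hb.1 c hc.1 hab hac hbc ⟨_, hle2, le_sup_left, le_sup_right,
    (le_sup_right : c.submodule ≤ a.submodule ⊔ b.submodule ⊔ c.submodule).trans e.ge⟩

end RealSpace

/-! Dualise. A linear functional on `ℝ⁴` is a plane of the space, and each point of the set becomes
a wall: the functionals vanishing at it. This gives an arrangement of hyperplanes in the dual space,
any three of them independent. A nonzero functional with at least three zeros is a vertex, that is,
a plane spanned by the points; functionals with two zeros or one zero make up the edges and the
faces. Ordinary planes are the vertices on exactly three walls. A functional is not identified with
its negative, so every projective face is counted twice.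

Global part. Melchior's inequality in each wall (`General.melchior_point`), summed over the walls,
bounds the total excess of the faces over triangles by the sum of `k (8 - 2k)` over the vertices on
`k` walls (`General.excess_le`). Only `k = 3` contributes positively. Hence, up to a multiple of the
number of ordinary planes, all vertices lie on four walls and are surrounded by triangles, together
with their neighbours: they are excellent (`General.sum_badFlats_le`).

Local part. At a vertex on the walls `p, q, a, b`, scale the vectors so that `P + Q + A + B = 0`. A
cell around the vertex is given by the signs of these four values, which split as three against one
or as two against two. At an excellent vertex the edges are straight (`Edge.straight`). It follows
that all faces at the vertex of a cell of the first kind are closed by one wall, as in a tetrahedron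
(`Frame.rot`), and that a cell of the second kind closes up like an octahedron (`octahedron_tip`).
The eight walls of the latter are eight points placed like the vertices of a cube, with six coplanar
quadruples, so a quadric through seven of them contains the eighth (`Frame.quadric_closed`). Two
such cells suffice to pass from an excellent vertex to the next one on the line `p, q`: a quadric
through eight points attached to the first contains the eight attached to the second (`Edge.van`).

Conclusion. Eight points always lie on a pencil of quadrics, so the points met along a run of
consecutive excellent vertices of a line lie on an intersection of two quadrics. The points at a bad
vertex are coplanar, and a plane lies in a pencil of reducible quadrics. A line with `B` bad
vertices thus gives a cover by `2B + 1` intersections (`Chart.exists_coloring`), and averaging over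
all pairs `p, q` finds a line with small `B` (`General.exists_line`). -/

namespace DualArrangement

set_option linter.unusedSectionVars false

/-! ### The dual arrangement -/

/-- The space of linear functionals on `ℝ⁴`. -/
abbrev D4 : Type := Module.Dual ℝ (Fin 4 → ℝ)

variable {ι : Type*} [Fintype ι] [DecidableEq ι] {u : ι → Fin 4 → ℝ}

/-- A family of vectors spanning `ℝ⁴`, any three of which are linearly independent. -/
structure General (u : ι → Fin 4 → ℝ) : Prop where
  indep : ∀ i j k, i ≠ j → i ≠ k → j ≠ k → LinearIndependent ℝ ![u i, u j, u k]
  span : ∀ x : D4, (∀ i, x (u i) = 0) → x = 0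

/-- The indices at which a functional vanishes. -/
noncomputable def zeros (u : ι → Fin 4 → ℝ) (x : D4) : Finset ι :=
  open Classical in Finset.univ.filter fun i => x (u i) = 0

@[simp] theorem mem_zeros {x : D4} {i : ι} : i ∈ zeros u x ↔ x (u i) = 0 := by
  simp [zeros]

/-- `x` has the sign of `v` wherever `v` does not vanish. -/
def Conf (u : ι → Fin 4 → ℝ) (v x : D4) : Prop :=
  ∀ i, v (u i) ≠ 0 → 0 < v (u i) * x (u i)

/-- The wall `j` is a facet of the cell of `x`. -/
def Facet (u : ι → Fin 4 → ℝ) (x : D4) (j : ι) : Prop :=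
  x (u j) ≠ 0 ∧ ∃ y : D4, y (u j) = 0 ∧
    ∀ i, i ≠ j → (x (u i) = 0 ∧ y (u i) = 0) ∨ 0 < x (u i) * y (u i)

/-- The cell of `x` has exactly three facets. -/
def Tri (u : ι → Fin 4 → ℝ) (x : D4) : Prop := {j | Facet u x j}.ncard = 3

/-- A vertex on exactly four walls, all faces around which are triangles. -/
def GoodV (u : ι → Fin 4 → ℝ) (v : D4) : Prop :=
  (zeros u v).card = 4 ∧ ∀ x, (zeros u x).card = 1 → Conf u v x → Tri u x

/-- A good vertex all of whose neighbours are good. -/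
def Exc (u : ι → Fin 4 → ℝ) (v : D4) : Prop :=
  GoodV u v ∧ ∀ e w, (zeros u e).card = 2 → 3 ≤ (zeros u w).card → w ≠ 0 →
    Conf u v e → Conf u w e → GoodV u w

theorem tri_of_four {x : D4} (h : Tri u x) {j₁ j₂ j₃ j₄ : ι} (h₁ : Facet u x j₁)
    (h₂ : Facet u x j₂) (h₃ : Facet u x j₃) (h₄ : Facet u x j₄) (n12 : j₁ ≠ j₂) (n13 : j₁ ≠ j₃)
    (n14 : j₁ ≠ j₄) (n23 : j₂ ≠ j₃) (n24 : j₂ ≠ j₄) (n34 : j₃ ≠ j₄) : False := by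
  have hs : ({j₁, j₂, j₃, j₄} : Set ι) ⊆ {j | Facet u x j} := by
    rintro j (rfl | rfl | rfl | rfl) <;> assumption
  have := Set.ncard_le_ncard hs (Set.toFinite _)
  rw [Set.ncard_insert_of_notMem (by simp [*]), Set.ncard_insert_of_notMem (by simp [*]),
    Set.ncard_pair n34] at this
  unfold Tri at h
  omega

theorem tri_facet_iff {x : D4} (h : Tri u x) {j₁ j₂ j₃ : ι} (h₁ : Facet u x j₁)
    (h₂ : Facet u x j₂) (h₃ : Facet u x j₃) (n12 : j₁ ≠ j₂) (n13 : j₁ ≠ j₃) (n23 : j₂ ≠ j₃)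
    {j : ι} (hj : Facet u x j) : j = j₁ ∨ j = j₂ ∨ j = j₃ := by
  by_contra! hc
  exact tri_of_four h h₁ h₂ h₃ hj n12 n13 hc.1.symm n23 hc.2.1.symm hc.2.2.symm

theorem General.prescribe (hG : General u) {i j k : ι} (hij : i ≠ j) (hik : i ≠ k) (hjk : j ≠ k)
    (α β γ : ℝ) : ∃ x : D4, x (u i) = α ∧ x (u j) = β ∧ x (u k) = γ := by
  have hli := hG.indep i j k hij hik hjk
  have hinj := hli.fintypeLinearCombination_injective
  obtain ⟨g, hg⟩ := LinearMap.exists_leftInverse_of_injective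
    (Fintype.linearCombination ℝ ![u i, u j, u k]) (LinearMap.ker_eq_bot.mpr hinj)
  have key : ∀ m : Fin 3, g (![u i, u j, u k] m) = Pi.single m 1 := by
    intro m
    have := LinearMap.congr_fun hg (Pi.single m 1)
    simpa using this
  refine ⟨(Fintype.linearCombination ℝ ![α, β, γ]).comp g, ?_, ?_, ?_⟩
  · have := key 0; simp at this; simp [this]
  · have := key 1; simp at this; simp [this]
  · have := key 2; simp at this; simp [this]

theorem General.proportional (hG : General u) {i j k : ι} (hij : i ≠ j) (hik : i ≠ k) (hjk : j ≠ k)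
    {x y : D4} (hx : x ≠ 0) (xi : x (u i) = 0) (xj : x (u j) = 0) (xk : x (u k) = 0)
    (yi : y (u i) = 0) (yj : y (u j) = 0) (yk : y (u k) = 0) : ∃ c : ℝ, y = c • x := by
  have hli := hG.indep i j k hij hik hjk
  set W := Submodule.span ℝ (Set.range ![u i, u j, u k]) with hW
  have h3 : Module.finrank ℝ W = 3 := by
    rw [hW, finrank_span_eq_card hli]; simp
  have h1 := Subspace.finrank_add_finrank_dualAnnihilator_eq W
  rw [h3] at h1
  simp at h1
  have h1' : Module.finrank ℝ W.dualAnnihilator = 1 := by omega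
  have hmem : ∀ z : D4, z (u i) = 0 → z (u j) = 0 → z (u k) = 0 → z ∈ W.dualAnnihilator := by
    intro z zi zj zk
    rw [Submodule.mem_dualAnnihilator]
    intro w hw
    induction hw using Submodule.span_induction with
    | mem w hw =>
      obtain ⟨m, rfl⟩ := hw
      fin_cases m <;> simpa
    | zero => simp
    | add a b _ _ ha hb => simp [ha, hb]
    | smul c a _ ha => simp [ha]
  obtain ⟨c, hc⟩ := (finrank_eq_one_iff_of_nonzero' (⟨x, hmem x xi xj xk⟩ : W.dualAnnihilator)
    (by simpa [Subtype.ext_iff] using hx)).mp h1' ⟨y, hmem y yi yj yk⟩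
  exact ⟨c, by simpa using (congrArg Subtype.val hc).symm⟩

/-- A plane through three points of one plane is that plane. -/
theorem General.zeros_of_three (hG : General u) {i j k l : ι} (hij : i ≠ j) (hik : i ≠ k)
    (hjk : j ≠ k) {x y : D4} (hx : x ≠ 0) (xi : x (u i) = 0) (xj : x (u j) = 0)
    (xk : x (u k) = 0) (yi : y (u i) = 0) (yj : y (u j) = 0) (yk : y (u k) = 0)
    (xl : x (u l) = 0) : y (u l) = 0 := by
  obtain ⟨c, rfl⟩ := hG.proportional hij hik hjk hx xi xj xk yi yj yk
  simp [xl]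

/-- A small perturbation in the direction `h` of the functional `v`. -/
theorem exists_conf (v h : D4) : ∃ t : ℝ, 0 < t ∧ ∀ i, v (u i) ≠ 0 →
    0 < v (u i) * (t • v + h) (u i) := by
  have : ∀ i, ∃ t : ℝ, 0 < t ∧ ∀ s, t ≤ s → v (u i) ≠ 0 → 0 < v (u i) * (s • v + h) (u i) := by
    intro i
    by_cases hv : v (u i) = 0
    · exact ⟨1, one_pos, by simp [hv]⟩
    · have h2 : 0 < v (u i) ^ 2 := by positivity
      refine ⟨|v (u i) * h (u i)| / v (u i) ^ 2 + 1, by positivity, fun s hs _ => ?_⟩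
      have h3 : |v (u i) * h (u i)| < s * v (u i) ^ 2 := by
        rw [← div_lt_iff₀ h2]; linarith
      have h4 := neg_abs_le (v (u i) * h (u i))
      simp only [LinearMap.add_apply, LinearMap.smul_apply, smul_eq_mul]
      nlinarith
  choose t ht hs using this
  refine ⟨1 + ∑ i, t i, by have := Finset.sum_nonneg (fun i (_ : i ∈ Finset.univ) => (ht i).le); linarith, fun i hv => hs i _ ?_ hv⟩
  have := Finset.single_le_sum (fun i _ => (ht i).le) (Finset.mem_univ i)
  linarith

/-! ### Normalised coordinates at a vertex on four walls -/

/-- `P` is a nonzero multiple of `u p`. -/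
def Para (u : ι → Fin 4 → ℝ) (p : ι) (P : Fin 4 → ℝ) : Prop := ∃ k : ℝ, k ≠ 0 ∧ P = k • u p

theorem Para.neg {p : ι} {P : Fin 4 → ℝ} (h : Para u p P) : Para u p (-P) := by
  obtain ⟨k, hk, rfl⟩ := h
  exact ⟨-k, by simpa, by simp⟩

theorem Para.zero_iff {p : ι} {P : Fin 4 → ℝ} (h : Para u p P) (x : D4) :
    x P = 0 ↔ x (u p) = 0 := by
  obtain ⟨k, hk, rfl⟩ := h
  simp [hk]

theorem Para.mul_pos_iff {p : ι} {P : Fin 4 → ℝ} (h : Para u p P) (x y : D4) :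
    0 < x (u p) * y (u p) ↔ 0 < x P * y P := by
  obtain ⟨k, hk, rfl⟩ := h
  have : (k * x (u p)) * (k * y (u p)) = k ^ 2 * (x (u p) * y (u p)) := by ring
  simp only [map_smul, smul_eq_mul, this]
  have hk2 : 0 < k ^ 2 := by positivity
  constructor
  · intro h; positivity
  · intro h; exact pos_of_mul_pos_right h hk2.le

/-- A vertex `v` on exactly four walls `p, q, a, b`, with multiples of the four vectors adding up
to zero. -/
structure Frame (u : ι → Fin 4 → ℝ) (v : D4) (p q a b : ι) (P Q A B : Fin 4 → ℝ) : Prop where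
  nz : v ≠ 0
  hp : Para u p P
  hq : Para u q Q
  ha : Para u a A
  hb : Para u b B
  sum : P + Q + A + B = 0
  zero : ∀ i, v (u i) = 0 ↔ i = p ∨ i = q ∨ i = a ∨ i = b
  pq : p ≠ q
  pa : p ≠ a
  pb : p ≠ b
  qa : q ≠ a
  qb : q ≠ b
  ab : a ≠ b

section
variable {v : D4} {p q a b : ι} {P Q A B : Fin 4 → ℝ}

theorem Frame.swap12 (h : Frame u v p q a b P Q A B) : Frame u v q p a b Q P A B :=
  ⟨h.nz, h.hq, h.hp, h.ha, h.hb, by rw [← h.sum]; abel, fun i => by rw [h.zero]; tauto,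
    h.pq.symm, h.qa, h.qb, h.pa, h.pb, h.ab⟩

theorem Frame.swap23 (h : Frame u v p q a b P Q A B) : Frame u v p a q b P A Q B :=
  ⟨h.nz, h.hp, h.ha, h.hq, h.hb, by rw [← h.sum]; abel, fun i => by rw [h.zero]; tauto,
    h.pa, h.pq, h.pb, h.qa.symm, h.ab, h.qb⟩

theorem Frame.swap34 (h : Frame u v p q a b P Q A B) : Frame u v p q b a P Q B A :=
  ⟨h.nz, h.hp, h.hq, h.hb, h.ha, by rw [← h.sum]; abel, fun i => by rw [h.zero]; tauto,
    h.pq, h.pb, h.pa, h.qb, h.qa, h.ab.symm⟩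

theorem Frame.neg (h : Frame u v p q a b P Q A B) : Frame u v p q a b (-P) (-Q) (-A) (-B) :=
  ⟨h.nz, h.hp.neg, h.hq.neg, h.ha.neg, h.hb.neg, by rw [← neg_zero, ← h.sum]; abel, h.zero,
    h.pq, h.pa, h.pb, h.qa, h.qb, h.ab⟩

theorem Frame.map_sum (h : Frame u v p q a b P Q A B) (x : D4) : x P + x Q + x A + x B = 0 := by
  rw [← map_add, ← map_add, ← map_add, h.sum, map_zero]

theorem Frame.zp (h : Frame u v p q a b P Q A B) : v (u p) = 0 := (h.zero p).2 (by simp)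
theorem Frame.zq (h : Frame u v p q a b P Q A B) : v (u q) = 0 := (h.zero q).2 (by simp)
theorem Frame.za (h : Frame u v p q a b P Q A B) : v (u a) = 0 := (h.zero a).2 (by simp)
theorem Frame.zb (h : Frame u v p q a b P Q A B) : v (u b) = 0 := (h.zero b).2 (by simp)

end

/-- Every vertex on exactly four walls has a frame. -/
theorem General.exists_frame (hG : General u) {v : D4} (hv : v ≠ 0) {p q a b : ι} (pq : p ≠ q)
    (pa : p ≠ a) (pb : p ≠ b) (qa : q ≠ a) (qb : q ≠ b) (ab : a ≠ b)
    (hz : ∀ i, v (u i) = 0 ↔ i = p ∨ i = q ∨ i = a ∨ i = b) :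
    ∃ P Q A B, Frame u v p q a b P Q A B := by
  -- Four vectors killed by a nonzero functional are dependent. Any three are independent, so no
  -- coefficient of the relation is zero.
  have hdep : ¬ LinearIndependent ℝ ![u p, u q, u a, u b] := by
    intro hli
    have htop := hli.span_eq_top_of_card_eq_finrank (by simp)
    apply hv
    refine LinearMap.ext_on_range (v := ![u p, u q, u a, u b]) htop fun m => ?_
    fin_cases m
    · simpa using (hz p).2 (by simp)
    · simpa using (hz q).2 (by simp)
    · simpa using (hz a).2 (by simp)
    · simpa using (hz b).2 (by simp)
  obtain ⟨g, hg, m, hm⟩ := Fintype.not_linearIndependent_iff.mp hdep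
  simp only [Fin.sum_univ_four, Matrix.cons_val_zero, Matrix.cons_val_one, Matrix.cons_val] at hg
  have three : ∀ i j k : ι, i ≠ j → i ≠ k → j ≠ k → ∀ α β γ : ℝ,
      α • u i + β • u j + γ • u k = 0 → α = 0 ∧ β = 0 ∧ γ = 0 := by
    intro i j k hij hik hjk α β γ h
    have := Fintype.linearIndependent_iff.mp (hG.indep i j k hij hik hjk) ![α, β, γ]
      (by simpa [Fin.sum_univ_three] using h)
    exact ⟨by simpa using this 0, by simpa using this 1, by simpa using this 2⟩
  have g0 : g 0 ≠ 0 := by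
    intro h0
    obtain ⟨h1, h2, h3⟩ := three q a b qa qb ab (g 1) (g 2) (g 3) (by simpa [h0] using hg)
    fin_cases m <;> simp_all
  have g1 : g 1 ≠ 0 := by
    intro h0
    obtain ⟨h1, h2, h3⟩ := three p a b pa pb ab (g 0) (g 2) (g 3) (by simpa [h0] using hg)
    exact g0 h1
  have g2 : g 2 ≠ 0 := by
    intro h0
    obtain ⟨h1, h2, h3⟩ := three p q b pq pb qb (g 0) (g 1) (g 3) (by simpa [h0] using hg)
    exact g0 h1
  have g3 : g 3 ≠ 0 := by
    intro h0
    obtain ⟨h1, h2, h3⟩ := three p q a pq pa qa (g 0) (g 1) (g 2) (by simpa [h0] using hg)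
    exact g0 h1
  exact ⟨_, _, _, _, hv, ⟨g 0, g0, rfl⟩, ⟨g 1, g1, rfl⟩, ⟨g 2, g2, rfl⟩, ⟨g 3, g3, rfl⟩, hg, hz,
    pq, pa, pb, qa, qb, ab⟩

/-- Cells around a four-wall vertex with prescribed values. -/
theorem Frame.exists_cell (hG : General u) {v : D4} {p q a b : ι} {P Q A B : Fin 4 → ℝ}
    (h : Frame u v p q a b P Q A B) (α β γ : ℝ) :
    ∃ x : D4, Conf u v x ∧ x P = α ∧ x Q = β ∧ x A = γ := by
  obtain ⟨kp, hkp, eP⟩ := h.hp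
  obtain ⟨kq, hkq, eQ⟩ := h.hq
  obtain ⟨ka, hka, eA⟩ := h.ha
  obtain ⟨y, yp, yq, ya⟩ := hG.prescribe h.pq h.pa h.qa (kp⁻¹ * α) (kq⁻¹ * β) (ka⁻¹ * γ)
  obtain ⟨t, _, ht⟩ := exists_conf (u := u) v y
  refine ⟨t • v + y, ht, ?_, ?_, ?_⟩
  · rw [eP]; simp [h.zp, yp, hkp]
  · rw [eQ]; simp [h.zq, yq, hkq]
  · rw [eA]; simp [h.za, ya, hka]

theorem mul_pos_trans {a b c : ℝ} (h₁ : 0 < a * b) (h₂ : 0 < b * c) : 0 < a * c := by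
  rcases pos_and_pos_or_neg_and_neg_of_mul_pos h₁ with ⟨ha, hb⟩ | ⟨ha, hb⟩
  · exact mul_pos ha (pos_of_mul_pos_right h₂ hb.le)
  · exact mul_pos_of_neg_of_neg ha (by
      by_contra! hc
      nlinarith [mul_nonneg (neg_nonneg.2 hb.le) hc])

theorem mul_pos_symm {a b : ℝ} (h : 0 < a * b) : 0 < b * a := by rwa [mul_comm]

theorem Conf.mul_pos {v x : D4} (h : Conf u v x) {i : ι} {I : Fin 4 → ℝ} (hI : Para u i I)
    (hv : v (u i) ≠ 0) : 0 < v I * x I := (hI.mul_pos_iff v x).1 (h i hv)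

theorem Conf.pos_of_pos {v x : D4} (h : Conf u v x) {i : ι} {I : Fin 4 → ℝ} (hI : Para u i I)
    (hv : v (u i) ≠ 0) (hx : 0 < x I) : 0 < v I :=
  pos_of_mul_pos_left (h.mul_pos hI hv) hx.le

theorem Conf.pos {v x : D4} (h : Conf u v x) {i : ι} {I : Fin 4 → ℝ} (hI : Para u i I)
    (hv : v (u i) ≠ 0) (hx : 0 < v I) : 0 < x I :=
  pos_of_mul_pos_right (h.mul_pos hI hv) hx.le

theorem Conf.ne {v x : D4} (h : Conf u v x) {i : ι} (hv : v (u i) ≠ 0) : x (u i) ≠ 0 := by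
  intro hx
  have := h i hv
  simp [hx] at this

/-! ### Faces at a vertex and their closing walls -/

/-- The wall `c` closes the sector `P = 0`, `Q, A > 0` at the vertex `v`. -/
def Closes (u : ι → Fin 4 → ℝ) (v : D4) (P Q A : Fin 4 → ℝ) (c : ι) : Prop :=
  v (u c) ≠ 0 ∧ ∃ y : D4, y P = 0 ∧ 0 < y Q ∧ 0 < y A ∧ y (u c) = 0 ∧
    ∀ i, v (u i) ≠ 0 → i ≠ c → 0 < v (u i) * y (u i)

theorem Closes.symm {v : D4} {P Q A : Fin 4 → ℝ} {c : ι} (h : Closes u v P Q A c) :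
    Closes u v P A Q c := by
  obtain ⟨h0, y, h1, h2, h3, h4, h5⟩ := h
  exact ⟨h0, y, h1, h3, h2, h4, h5⟩

theorem Closes.smul {v : D4} {P Q A : Fin 4 → ℝ} {c : ι} (α : ℝ) {β γ : ℝ}
    (hβ : 0 < β) (hγ : 0 < γ) (h : Closes u v P Q A c) :
    Closes u v (α • P) (β • Q) (γ • A) c := by
  obtain ⟨h0, y, h1, h2, h3, h4, h5⟩ := h
  exact ⟨h0, y, by simp [h1], by simpa using mul_pos hβ h2, by simpa using mul_pos hγ h3, h4, h5⟩

theorem Closes.neg {v : D4} {P Q A : Fin 4 → ℝ} {c : ι} (h : Closes u v P Q A c) :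
    Closes u v (-P) Q A c := by
  simpa using h.smul (-1) one_pos one_pos

theorem Closes.of_neg {v : D4} {P Q A : Fin 4 → ℝ} {c : ι} (h : Closes u v (-P) Q A c) :
    Closes u v P Q A c := by
  simpa using h.neg

section face
variable {v x : D4} {p q a b : ι} {P Q A B : Fin 4 → ℝ}

theorem Frame.zeros_face (h : Frame u v p q a b P Q A B) (hx : Conf u v x) (hP : x P = 0)
    (hQ : 0 < x Q) (hA : 0 < x A) : zeros u x = {p} := by
  have hs := h.map_sum x
  ext i
  simp only [mem_zeros, Finset.mem_singleton]
  constructor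
  · intro hi
    by_cases hv : v (u i) = 0
    · rcases (h.zero i).1 hv with rfl | rfl | rfl | rfl
      · rfl
      · rw [← h.hq.zero_iff] at hi; linarith
      · rw [← h.ha.zero_iff] at hi; linarith
      · rw [← h.hb.zero_iff] at hi; linarith
    · exact absurd hi (hx.ne hv)
  · rintro rfl
    exact (h.hp.zero_iff x).1 hP

/-- The relation forces `B < 0` on the face, so its boundary on the wall `q` is the edge at `v` with
`P = Q = 0` and `A > 0 > B`; a functional on that edge is the witness. -/
theorem Frame.facet (hG : General u) (h : Frame u v p q a b P Q A B) (hx : Conf u v x)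
    (hP : x P = 0) (hQ : 0 < x Q) (hA : 0 < x A) : Facet u x q := by
  have hs := h.map_sum x
  obtain ⟨y, hy, yP, yQ, yA⟩ := h.exists_cell hG 0 0 1
  have ys := h.map_sum y
  refine ⟨fun h0 => by rw [← h.hq.zero_iff] at h0; linarith, y, (h.hq.zero_iff y).1 yQ, ?_⟩
  intro i hi
  by_cases hv : v (u i) = 0
  · rcases (h.zero i).1 hv with rfl | rfl | rfl | rfl
    · exact Or.inl ⟨(h.hp.zero_iff x).1 hP, (h.hp.zero_iff y).1 yP⟩
    · exact absurd rfl hi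
    · exact Or.inr ((h.ha.mul_pos_iff x y).2 (mul_pos hA (by linarith)))
    · exact Or.inr ((h.hb.mul_pos_iff x y).2
        (mul_pos_of_neg_of_neg (by linarith) (by linarith)))
  · exact Or.inr (mul_pos_trans (mul_pos_symm (hx i hv)) (hy i hv))

theorem Frame.facet' (hG : General u) (h : Frame u v p q a b P Q A B) (hx : Conf u v x)
    (hP : x P = 0) (hQ : 0 < x Q) (hA : 0 < x A) : Facet u x a :=
  h.swap23.facet hG hx hP hA hQ

theorem Frame.facet_closes (h : Frame u v p q a b P Q A B) (hx : Conf u v x)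
    (hP : x P = 0) (hQ : 0 < x Q) (hA : 0 < x A) {c : ι} (hc : Closes u v P Q A c) :
    Facet u x c := by
  obtain ⟨h0, y, yP, yQ, yA, yc, hy⟩ := hc
  have hs := h.map_sum x
  have ys := h.map_sum y
  refine ⟨hx.ne h0, y, yc, fun i hi => ?_⟩
  by_cases hv : v (u i) = 0
  · rcases (h.zero i).1 hv with rfl | rfl | rfl | rfl
    · exact Or.inl ⟨(h.hp.zero_iff x).1 hP, (h.hp.zero_iff y).1 yP⟩
    · exact Or.inr ((h.hq.mul_pos_iff x y).2 (mul_pos hQ yQ))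
    · exact Or.inr ((h.ha.mul_pos_iff x y).2 (mul_pos hA yA))
    · exact Or.inr ((h.hb.mul_pos_iff x y).2
        (mul_pos_of_neg_of_neg (by linarith) (by linarith)))
  · exact Or.inr (mul_pos_trans (mul_pos_symm (hx i hv)) (hy i hv hi))

theorem Frame.tri (h : Frame u v p q a b P Q A B) (hv : GoodV u v) (hx : Conf u v x)
    (hP : x P = 0) (hQ : 0 < x Q) (hA : 0 < x A) : Tri u x :=
  hv.2 x (by rw [h.zeros_face hx hP hQ hA]; simp) hx

theorem Frame.ne_of_closes (h : Frame u v p q a b P Q A B) {R₁ R₂ R₃ : Fin 4 → ℝ} {c : ι}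
    (hc : Closes u v R₁ R₂ R₃ c) : c ≠ p ∧ c ≠ q ∧ c ≠ a ∧ c ≠ b := by
  have := hc.1
  rw [ne_eq, h.zero] at this
  push Not at this
  exact this

/-- The face is a triangle and already has the facets `q` and `a` at `v`; two closing walls would
make four facets. -/
theorem Frame.closes_unique (hG : General u) (h : Frame u v p q a b P Q A B) (hv : GoodV u v)
    {c c' : ι} (hc : Closes u v P Q A c) (hc' : Closes u v P Q A c') : c = c' := by
  obtain ⟨x, hx, xP, xQ, xA⟩ := h.exists_cell hG 0 1 1
  have xQ' : 0 < x Q := by rw [xQ]; exact one_pos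
  have xA' : 0 < x A := by rw [xA]; exact one_pos
  by_contra hne
  have h1 := h.ne_of_closes hc
  have h2 := h.ne_of_closes hc'
  exact tri_of_four (h.tri hv hx xP xQ' xA') (h.facet hG hx xP xQ' xA')
    (h.facet' hG hx xP xQ' xA') (h.facet_closes hx xP xQ' xA' hc)
    (h.facet_closes hx xP xQ' xA' hc') h.qa h1.2.1.symm h2.2.1.symm h1.2.2.1.symm
    h2.2.2.1.symm hne

end face

/-! ### Edges between vertices on four walls -/

/-- `w = {p, q, x, y}` is the end of the edge `e` of the line `p, q` that starts at the vertex
`v = {p, q, a, b}` in the direction `A > 0 > B`. -/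
structure Edge (u : ι → Fin 4 → ℝ) (v e w : D4) (p q a b : ι) (P Q A B : Fin 4 → ℝ) (x y : ι)
    (X Y : Fin 4 → ℝ) (α β : ℝ) : Prop where
  fv : Frame u v p q a b P Q A B
  fw : Frame u w p q x y (α • P) (β • Q) X Y
  α0 : α ≠ 0
  β0 : β ≠ 0
  cv : Conf u v e
  cw : Conf u w e
  eP : e P = 0
  eQ : e Q = 0
  eA : 0 < e A
  eX : 0 < e X
  vx : v (u x) ≠ 0
  vy : v (u y) ≠ 0

section edge
variable {v e w : D4} {p q a b : ι} {P Q A B : Fin 4 → ℝ} {x y : ι} {X Y : Fin 4 → ℝ} {α β : ℝ}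

theorem Edge.swap (h : Edge u v e w p q a b P Q A B x y X Y α β) :
    Edge u v e w q p a b Q P A B x y X Y β α :=
  ⟨h.fv.swap12, h.fw.swap12, h.β0, h.α0, h.cv, h.cw, h.eQ, h.eP, h.eA, h.eX, h.vx, h.vy⟩

theorem Edge.eB (h : Edge u v e w p q a b P Q A B x y X Y α β) : e B < 0 := by
  have := h.fv.map_sum e
  rw [h.eP, h.eQ] at this
  linarith [h.eA]

theorem Edge.eY (h : Edge u v e w p q a b P Q A B x y X Y α β) : e Y < 0 := by
  have := h.fw.map_sum e
  simp only [map_smul, h.eP, h.eQ] at this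
  simp at this
  linarith [h.eX]

/-- The same edge with its end described by the opposite frame. -/
theorem Edge.flip (h : Edge u v e w p q a b P Q A B x y X Y α β) :
    Edge u v e w p q a b P Q A B y x (-Y) (-X) (-α) (-β) :=
  ⟨h.fv, by simpa using h.fw.neg.swap34, by simpa using h.α0, by simpa using h.β0, h.cv, h.cw,
    h.eP, h.eQ, h.eA, by simpa using h.eY, h.vy, h.vx⟩

theorem Edge.ne (h : Edge u v e w p q a b P Q A B x y X Y α β) :
    a ≠ x ∧ a ≠ y ∧ b ≠ x ∧ b ≠ y :=
  ⟨fun h' => h.vx (h' ▸ h.fv.za), fun h' => h.vy (h' ▸ h.fv.za),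
    fun h' => h.vx (h' ▸ h.fv.zb), fun h' => h.vy (h' ▸ h.fv.zb)⟩

theorem Edge.wa (h : Edge u v e w p q a b P Q A B x y X Y α β) : w (u a) ≠ 0 := by
  rw [ne_eq, h.fw.zero]
  push Not
  exact ⟨h.fv.pa.symm, h.fv.qa.symm, h.ne.1, h.ne.2.1⟩

theorem Edge.wb (h : Edge u v e w p q a b P Q A B x y X Y α β) : w (u b) ≠ 0 := by
  rw [ne_eq, h.fw.zero]
  push Not
  exact ⟨h.fv.pb.symm, h.fv.qb.symm, h.ne.2.2.1, h.ne.2.2.2⟩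

theorem Edge.wA (h : Edge u v e w p q a b P Q A B x y X Y α β) : 0 < w A :=
  h.cw.pos_of_pos h.fv.ha h.wa h.eA

theorem Edge.wB (h : Edge u v e w p q a b P Q A B x y X Y α β) : w B < 0 := by
  have := h.cw.pos_of_pos h.fv.hb.neg h.wb (by simpa using h.eB)
  simpa using this

theorem Edge.vX (h : Edge u v e w p q a b P Q A B x y X Y α β) : 0 < v X :=
  h.cv.pos_of_pos h.fw.ha h.vx h.eX

theorem Edge.vY (h : Edge u v e w p q a b P Q A B x y X Y α β) : v Y < 0 := by
  have := h.cv.pos_of_pos h.fw.hb.neg h.vy (by simpa using h.eY)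
  simpa using this

/-- Away from the walls through the two ends, the ends agree in sign. -/
theorem Edge.mul_pos (h : Edge u v e w p q a b P Q A B x y X Y α β) {i : ι}
    (hv : v (u i) ≠ 0) (hw : w (u i) ≠ 0) : 0 < v (u i) * w (u i) :=
  mul_pos_trans (h.cv i hv) (mul_pos_symm (h.cw i hw))

/-- The witness lies on the edge that leaves `w` along the walls `p, x` towards `β Q > 0`. So the
sign of `β` decides on which side of the edge `v w` the wall `x` closes the face in the wall `p`. -/
theorem Edge.closes_aux (hG : General u) (h : Edge u v e w p q a b P Q A B x y X Y α β) :
    v (u x) ≠ 0 ∧ ∃ z : D4, z P = 0 ∧ 0 < β * z Q ∧ 0 < z A ∧ z B < 0 ∧ z (u x) = 0 ∧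
      ∀ i, v (u i) ≠ 0 → i ≠ x → 0 < v (u i) * z (u i) := by
  obtain ⟨z, hz, zP, zQ, zX⟩ := h.fw.exists_cell hG 0 1 0
  have zs := h.fw.map_sum z
  refine ⟨h.vx, z, by simpa [h.α0] using zP, by simp at zQ; linarith,
    hz.pos h.fv.ha h.wa h.wA, ?_, (h.fw.ha.zero_iff z).1 zX, fun i hv hi => ?_⟩
  · have := hz.pos h.fv.hb.neg h.wb (by simpa using h.wB)
    simpa using this
  · by_cases hw : w (u i) = 0
    · rcases (h.fw.zero i).1 hw with rfl | rfl | rfl | rfl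
      · exact absurd h.fv.zp hv
      · exact absurd h.fv.zq hv
      · exact absurd rfl hi
      · exact (h.fw.hb.mul_pos_iff v z).2 (mul_pos_of_neg_of_neg h.vY (by linarith))
    · exact mul_pos_trans (h.mul_pos hv hw) (hz i hw)

theorem Edge.closes_x (hG : General u) (h : Edge u v e w p q a b P Q A B x y X Y α β)
    (hβ : 0 < β) : Closes u v P Q A x := by
  obtain ⟨h0, z, z1, z2, z3, _, z4, z5⟩ := h.closes_aux hG
  exact ⟨h0, z, z1, pos_of_mul_pos_right z2 hβ.le, z3, z4, z5⟩

theorem Edge.closes_x' (hG : General u) (h : Edge u v e w p q a b P Q A B x y X Y α β)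
    (hβ : β < 0) : Closes u v P (-Q) (-B) x := by
  obtain ⟨h0, z, z1, z2, _, z3, z4, z5⟩ := h.closes_aux hG
  exact ⟨h0, z, z1, by simp; nlinarith, by simpa using z3, z4, z5⟩

theorem Edge.closes_y (hG : General u) (h : Edge u v e w p q a b P Q A B x y X Y α β)
    (hβ : β < 0) : Closes u v P Q A y := h.flip.closes_x hG (by linarith)

theorem Edge.closes_y' (hG : General u) (h : Edge u v e w p q a b P Q A B x y X Y α β)
    (hβ : 0 < β) : Closes u v P (-Q) (-B) y := h.flip.closes_x' hG (by linarith)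

/-- The edge from a vertex with a frame to the next vertex on the line `p, q`. -/
theorem Frame.edge_to (hG : General u) (h : Frame u v p q a b P Q A B) (he : Conf u v e)
    (eP : e P = 0) (eQ : e Q = 0) (eA : 0 < e A) (cw : Conf u w e) (w0 : w ≠ 0)
    (wp : w (u p) = 0) (wq : w (u q) = 0) (wa : w (u a) ≠ 0) (wb : w (u b) ≠ 0)
    (hw : (zeros u w).card = 4) :
    ∃ x y X Y α β, Edge u v e w p q a b P Q A B x y X Y α β ∧ 0 < α := by
  have es := h.map_sum e
  have hc2 : (((zeros u w).erase p).erase q).card = 2 := by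
    rw [Finset.card_erase_of_mem (by simp [h.pq.symm, wq]), Finset.card_erase_of_mem (by simpa),
      hw]
  obtain ⟨x, y, hxy, hset⟩ := Finset.card_eq_two.1 hc2
  have hmem : ∀ i, (i ≠ q ∧ i ≠ p ∧ w (u i) = 0) ↔ i = x ∨ i = y := by
    intro i
    have := Finset.ext_iff.1 hset i
    simpa using this
  have hx := (hmem x).2 (by simp)
  have hy := (hmem y).2 (by simp)
  have hz : ∀ i, w (u i) = 0 ↔ i = p ∨ i = q ∨ i = x ∨ i = y := by
    intro i
    rw [← hmem]
    constructor
    · intro hi; tauto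
    · rintro (rfl | rfl | hi)
      · exact wp
      · exact wq
      · exact hi.2.2
  obtain ⟨P', Q', X, Y, fw⟩ := hG.exists_frame w0 h.pq hx.2.1.symm hy.2.1.symm hx.1.symm
    hy.1.symm hxy hz
  obtain ⟨α, hα, rfl⟩ : ∃ α : ℝ, α ≠ 0 ∧ P' = α • P := by
    obtain ⟨k, hk, rfl⟩ := h.hp
    obtain ⟨k', hk', rfl⟩ := fw.hp
    exact ⟨k' / k, div_ne_zero hk' hk, by rw [smul_smul]; field_simp⟩
  obtain ⟨β, hβ, rfl⟩ : ∃ β : ℝ, β ≠ 0 ∧ Q' = β • Q := by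
    obtain ⟨k, hk, rfl⟩ := h.hq
    obtain ⟨k', hk', rfl⟩ := fw.hq
    exact ⟨k' / k, div_ne_zero hk' hk, by rw [smul_smul]; field_simp⟩
  have hvx : ∀ i, i ≠ q → i ≠ p → w (u i) = 0 → v (u i) ≠ 0 := by
    intro i i1 i2 i3 i4
    rcases (h.zero i).1 i4 with rfl | rfl | rfl | rfl
    · exact i2 rfl
    · exact i1 rfl
    · exact wa i3
    · exact wb i3
  have vx := hvx x hx.1 hx.2.1 hx.2.2
  have vy := hvx y hy.1 hy.2.1 hy.2.2
  have ws := fw.map_sum e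
  simp only [map_smul, eP, eQ] at ws
  simp at ws
  have eX : e X ≠ 0 := by rw [ne_eq, fw.ha.zero_iff]; exact he.ne vx
  -- The order of the two new walls makes `e X` positive, and reversing the end frame makes `α`
  -- positive. No freedom is left for the sign of `β`.
  have main : ∃ x y X Y α β, Edge u v e w p q a b P Q A B x y X Y α β := by
    rcases lt_or_gt_of_ne eX with h1 | h1
    · exact ⟨y, x, Y, X, α, β, h, fw.swap34, hα, hβ, he, cw, eP, eQ, by linarith, by linarith,
        vy, vx⟩
    · exact ⟨x, y, X, Y, α, β, h, fw, hα, hβ, he, cw, eP, eQ, by linarith, by linarith,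
        vx, vy⟩
  obtain ⟨x, y, X, Y, α, β, hE⟩ := main
  rcases lt_or_gt_of_ne hE.α0 with h1 | h1
  · exact ⟨_, _, _, _, _, _, hE.flip, by linarith⟩
  · exact ⟨_, _, _, _, _, _, hE, h1⟩

/-- Every edge at an excellent vertex ends in a good vertex. -/
theorem Frame.exists_edge (hG : General u) (h : Frame u v p q a b P Q A B) (hv : Exc u v) :
    ∃ e w x y X Y α β, Edge u v e w p q a b P Q A B x y X Y α β ∧ 0 < α ∧ GoodV u w := by
  obtain ⟨e, he, eP, eQ, eA⟩ := h.exists_cell hG 0 0 1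
  have es := h.map_sum e
  have hne : (Finset.univ.filter fun i => v (u i) ≠ 0).Nonempty := by
    by_contra hc
    rw [Finset.not_nonempty_iff_eq_empty, Finset.filter_eq_empty_iff] at hc
    exact h.nz (hG.span v fun i => by simpa using hc (Finset.mem_univ i))
  -- Moving along `e - t v` away from `v`, the smallest ratio is the time of the first wall met. The
  -- functional reached there is the other end of the edge.
  obtain ⟨m, hm, hmin⟩ := Finset.exists_min_image _ (fun i => e (u i) / v (u i)) hne
  simp only [Finset.mem_filter, Finset.mem_univ, true_and] at hm hmin
  set t := e (u m) / v (u m) with ht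
  set w : D4 := e - t • v with hw
  have hwi : ∀ i, w (u i) = e (u i) - t * v (u i) := fun i => by simp [hw]
  have ez : zeros u e = {p, q} := by
    ext i
    simp only [mem_zeros, Finset.mem_insert, Finset.mem_singleton]
    constructor
    · intro hi
      by_cases hvi : v (u i) = 0
      · rcases (h.zero i).1 hvi with rfl | rfl | rfl | rfl
        · exact Or.inl rfl
        · exact Or.inr rfl
        · rw [← h.ha.zero_iff] at hi; linarith
        · rw [← h.hb.zero_iff] at hi; linarith
      · exact absurd hi (he.ne hvi)
    · rintro (rfl | rfl)
      · exact (h.hp.zero_iff e).1 eP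
      · exact (h.hq.zero_iff e).1 eQ
  have cw : Conf u w e := by
    intro i hi
    by_cases hvi : v (u i) = 0
    · rw [hwi, hvi, mul_zero, sub_zero] at hi ⊢
      exact mul_self_pos.2 hi
    · have h1 := hmin i hvi
      have h2 := he i hvi
      have h3 : w (u i) = v (u i) * (e (u i) / v (u i) - t) := by rw [hwi]; field_simp
      have h4 : e (u i) / v (u i) - t ≠ 0 := by
        intro h0; rw [h3, h0, mul_zero] at hi; exact hi rfl
      have h5 : 0 < e (u i) / v (u i) - t := lt_of_le_of_ne (by linarith) h4.symm
      rw [h3]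
      have : v (u i) * (e (u i) / v (u i) - t) * e (u i)
        = (e (u i) / v (u i) - t) * (v (u i) * e (u i)) := by ring
      rw [this]
      exact _root_.mul_pos h5 h2
  have wm : w (u m) = 0 := by rw [hwi, ht]; field_simp; ring
  have wp : w (u p) = 0 := by rw [hwi, h.zp, (h.hp.zero_iff e).1 eP]; simp
  have wq : w (u q) = 0 := by rw [hwi, h.zq, (h.hq.zero_iff e).1 eQ]; simp
  have w0 : w ≠ 0 := by
    intro h0
    have : w (u a) = 0 := by rw [h0]; rfl
    rw [hwi, h.za, mul_zero, sub_zero, ← h.ha.zero_iff] at this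
    linarith
  have mp : m ≠ p := fun h' => hm (h' ▸ h.zp)
  have mq : m ≠ q := fun h' => hm (h' ▸ h.zq)
  have hsub : ({p, q, m} : Finset ι) ⊆ zeros u w := by
    intro i hi
    simp only [Finset.mem_insert, Finset.mem_singleton] at hi
    rcases hi with rfl | rfl | rfl <;> simpa
  have hgood : GoodV u w := by
    refine hv.2 e w (by rw [ez, Finset.card_pair h.pq]) ?_ w0 he cw
    have := Finset.card_le_card hsub
    rwa [Finset.card_insert_of_notMem (by simp [h.pq, mp.symm]), Finset.card_pair mq.symm] at this
  have wa : w (u a) ≠ 0 := by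
    rw [hwi, h.za, mul_zero, sub_zero, ne_eq, ← h.ha.zero_iff]; linarith
  have wb : w (u b) ≠ 0 := by
    rw [hwi, h.zb, mul_zero, sub_zero, ne_eq, ← h.hb.zero_iff]; linarith
  obtain ⟨x, y, X, Y, α, β, hE, hα⟩ := h.edge_to hG he eP eQ (by linarith) cw w0 wp wq wa wb
    hgood.1
  exact ⟨e, w, x, y, X, Y, α, β, hE, hα, hgood⟩

end edge

/-! ### Leaving a face through a facet -/

/-- There is a plane through any three points. -/
theorem exists_plane (i j k : ι) : ∃ w : D4, w ≠ 0 ∧ w (u i) = 0 ∧ w (u j) = 0 ∧ w (u k) = 0 := by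
  set W := Submodule.span ℝ (Set.range ![u i, u j, u k]) with hW
  have h3 : Module.finrank ℝ W ≤ 3 := by
    have := finrank_range_le_card (R := ℝ) ![u i, u j, u k]
    simpa [Set.finrank] using this
  have h1 := Subspace.finrank_add_finrank_dualAnnihilator_eq W
  simp at h1
  have h2 : 0 < Module.finrank ℝ W.dualAnnihilator := by omega
  have := Module.nontrivial_of_finrank_pos h2
  obtain ⟨⟨w, hw⟩, hw0⟩ := exists_ne (0 : W.dualAnnihilator)
  rw [Submodule.mem_dualAnnihilator] at hw
  have hm : ∀ m, w (![u i, u j, u k] m) = 0 := fun m => hw _ (Submodule.subset_span ⟨m, rfl⟩)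
  exact ⟨w, by simpa using hw0, hm 0, hm 1, hm 2⟩

theorem General.exists_off_plane (hG : General u) (i j k : ι) :
    ∃ w : D4, ∃ l, w (u i) = 0 ∧ w (u j) = 0 ∧ w (u k) = 0 ∧ w (u l) ≠ 0 := by
  obtain ⟨w, hw, h1, h2, h3⟩ := exists_plane (u := u) i j k
  by_contra! hc
  exact hw (hG.span w fun l => hc w l h1 h2 h3)

/-- Leaving a face in a direction `g` that crosses some wall, one can arrange to cross a facet. -/
theorem General.exists_facet_aux (hG : General u) {x g : D4} {r : ι}
    (hx : ∀ i, x (u i) = 0 ↔ i = r) (hg : g (u r) = 0) (hgx : ∀ c : ℝ, g ≠ c • x)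
    (hneg : ∃ i, x (u i) * g (u i) < 0) : ∃ j, Facet u x j ∧ x (u j) * g (u j) < 0 := by
  have xr : x (u r) = 0 := (hx r).2 rfl
  have x0 : ∀ i, i ≠ r → x (u i) ≠ 0 := fun i hi h => hi ((hx i).1 h)
  obtain ⟨i₀, hi₀⟩ := hneg
  have hi₀r : i₀ ≠ r := by rintro rfl; simp [xr] at hi₀
  -- The smallest ratio `c` is negative, so `g - c x` is a positive multiple of a point between `x`
  -- and `g`: the first point of the segment from `x` at which a wall other than `r` is met.
  obtain ⟨m, hm, hmin⟩ := Finset.exists_min_image (Finset.univ.erase r)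
    (fun i => g (u i) / x (u i)) ⟨i₀, by simp [hi₀r]⟩
  simp only [Finset.mem_erase, Finset.mem_univ, and_true] at hm hmin
  set c := g (u m) / x (u m) with hc
  have hcneg : c < 0 := by
    refine (hmin i₀ hi₀r).trans_lt ?_
    have h2 := x0 i₀ hi₀r
    have : g (u i₀) / x (u i₀) = (x (u i₀) * g (u i₀)) / x (u i₀) ^ 2 := by field_simp
    rw [this]
    exact div_neg_of_neg_of_pos hi₀ (by positivity)
  set z : D4 := g - c • x with hz
  have zi : ∀ i, z (u i) = g (u i) - c * x (u i) := fun i => by simp [hz]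
  have zr : z (u r) = 0 := by rw [zi, hg, xr]; simp
  have z0 : z ≠ 0 := fun h => hgx c (sub_eq_zero.1 h)
  have zx : ∀ i, z (u i) ≠ 0 → 0 < z (u i) * x (u i) := by
    intro i hi
    have hir : i ≠ r := by rintro rfl; exact hi zr
    have h1 := hmin i hir
    have h2 := x0 i hir
    have h3 : z (u i) = (g (u i) / x (u i) - c) * x (u i) := by rw [zi]; field_simp
    have h4 : g (u i) / x (u i) - c ≠ 0 := by intro h; rw [h3, h] at hi; simp at hi
    have h5 : 0 < g (u i) / x (u i) - c := lt_of_le_of_ne (by linarith) h4.symm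
    rw [h3, mul_assoc]
    exact mul_pos h5 (mul_self_pos.2 h2)
  have zg : ∀ i, i ≠ r → z (u i) = 0 → x (u i) * g (u i) < 0 := by
    intro i hir hi
    have h2 := x0 i hir
    have : g (u i) = c * x (u i) := by rw [zi] at hi; linarith
    rw [this]
    have : 0 < x (u i) * x (u i) := mul_self_pos.2 h2
    nlinarith
  have zm : z (u m) = 0 := by rw [zi, hc]; field_simp [x0 m hm]; ring
  -- Several walls may pass through `z`. A functional `h` not proportional to `z` breaks the tie:
  -- the wall where `h / x` is largest bounds the face at `z`. A second maximum would make `h - d x`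
  -- proportional to `z`, contradicting the values at `m` and `k₁`.
  have key : ∃ k, ∃ s : D4, k ≠ r ∧ z (u k) = 0 ∧ s (u r) = 0 ∧ s (u k) = 0 ∧
      ∀ i, i ≠ r → i ≠ k → z (u i) = 0 → 0 < x (u i) * s (u i) := by
    by_cases hK : ∃ k₁, k₁ ≠ r ∧ k₁ ≠ m ∧ z (u k₁) = 0
    · obtain ⟨k₁, hk₁r, hk₁m, zk₁⟩ := hK
      obtain ⟨h, hr, hhm, hk₁⟩ := hG.prescribe hm.symm hk₁r.symm hk₁m.symm 0 0 1
      obtain ⟨k, hk, hmax⟩ := Finset.exists_max_image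
        (Finset.univ.filter fun i => i ≠ r ∧ z (u i) = 0)
        (fun i => h (u i) / x (u i)) ⟨m, by simp [hm, zm]⟩
      simp only [Finset.mem_filter, Finset.mem_univ, true_and] at hk hmax
      set d := h (u k) / x (u k) with hd
      have hxk := x0 k hk.1
      refine ⟨k, d • x - h, hk.1, hk.2, by simp [xr, hr], by simp [hd, hxk], ?_⟩
      intro i hir hik zi0
      have h1 := hmax i ⟨hir, zi0⟩
      have h2 := x0 i hir
      have h4 : h (u i) / x (u i) ≠ d := by
        intro h4
        have e1 : (h - d • x) (u i) = 0 := by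
          rw [← h4]; simp [h2]
        have e2 : (h - d • x) (u k) = 0 := by simp [hd, hxk]
        have e3 : (h - d • x) (u r) = 0 := by simp [hr, xr]
        obtain ⟨lam, hl⟩ := hG.proportional hir.symm hk.1.symm hik z0 zr zi0 hk.2 e3 e1 e2
        have em := LinearMap.congr_fun hl (u m)
        have ek := LinearMap.congr_fun hl (u k₁)
        simp [zm, hhm, zk₁, hk₁, x0 m hm] at em ek
        rw [em] at ek
        simp at ek
      have h5 : 0 < d - h (u i) / x (u i) := sub_pos.2 (lt_of_le_of_ne h1 h4)
      have h6 : x (u i) * (d • x - h) (u i)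
          = (d - h (u i) / x (u i)) * (x (u i) * x (u i)) := by
        simp only [LinearMap.sub_apply, LinearMap.smul_apply, smul_eq_mul]; field_simp
      rw [h6]
      exact mul_pos h5 (mul_self_pos.2 h2)
    · push Not at hK
      exact ⟨m, 0, hm, zm, rfl, rfl, fun i h1 h2 h3 => absurd h3 (hK i h1 h2)⟩
  obtain ⟨k, s, hkr, zk, sr, sk, hs⟩ := key
  obtain ⟨t, _, ht⟩ := exists_conf (u := u) z s
  refine ⟨k, ⟨x0 k hkr, t • z + s, by simp [zk, sk], fun i hi => ?_⟩, zg k hkr zk⟩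
  by_cases hir : i = r
  · subst hir; exact Or.inl ⟨xr, by simp [zr, sr]⟩
  · right
    by_cases h0 : z (u i) = 0
    · simpa [h0] using hs i hir hi h0
    · exact mul_pos_trans (mul_pos_symm (zx i h0)) (ht i h0)

theorem General.exists_facet (hG : General u) {x g : D4} {r : ι}
    (hx : ∀ i, x (u i) = 0 ↔ i = r) (hg : g (u r) = 0)
    (hneg : ∃ i, x (u i) * g (u i) < 0) : ∃ j, Facet u x j ∧ x (u j) * g (u j) < 0 := by
  by_cases hgx : ∀ c : ℝ, g ≠ c • x
  · exact hG.exists_facet_aux hx hg hgx hneg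
  · push Not at hgx
    obtain ⟨c, rfl⟩ := hgx
    obtain ⟨i, hi⟩ := hneg
    have hir : i ≠ r := by rintro rfl; simp at hg hi; simp [(hx i).2 rfl] at hi
    have hxi : x (u i) ≠ 0 := fun h => hir ((hx i).1 h)
    have hc : c < 0 := by
      simp only [LinearMap.smul_apply, smul_eq_mul] at hi
      have : 0 < x (u i) * x (u i) := mul_self_pos.2 hxi
      nlinarith
    -- A negative multiple of `x` crosses every wall other than `r`, so any facet will do. One is
    -- obtained from an auxiliary direction that is not proportional to `x`.
    obtain ⟨w, l, h1, h2, _, h3⟩ := hG.exists_off_plane r i i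
    have hlr : l ≠ r := by rintro rfl; exact h3 h1
    have hli : l ≠ i := by rintro rfl; exact h3 h2
    have hxl : x (u l) ≠ 0 := fun h => hlr ((hx l).1 h)
    obtain ⟨g, gr, gi, gl⟩ := hG.prescribe hir.symm hlr.symm hli.symm 0 (-x (u i)) (x (u l))
    obtain ⟨j, hj, _⟩ := hG.exists_facet_aux hx (g := g) gr (by
      rintro c rfl
      simp only [LinearMap.smul_apply, smul_eq_mul] at gi gl
      have e1 : c = -1 := by
        have : (c + 1) * x (u i) = 0 := by linarith
        rcases mul_eq_zero.1 this with h | h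
        · linarith
        · exact absurd h hxi
      have e2 : c = 1 := by
        have : (c - 1) * x (u l) = 0 := by linarith
        rcases mul_eq_zero.1 this with h | h
        · linarith
        · exact absurd h hxl
      linarith) ⟨i, by rw [gi]; nlinarith [mul_self_pos.2 hxi]⟩
    refine ⟨j, hj, ?_⟩
    simp only [LinearMap.smul_apply, smul_eq_mul]
    nlinarith [mul_self_pos.2 hj.1]

/-- A functional that has the signs of a triangular face on its facets has them everywhere. -/
theorem General.conf_of_tri (hG : General u) {x g : D4} {r : ι}
    (hx : ∀ i, x (u i) = 0 ↔ i = r) (hg : g (u r) = 0) (ht : Tri u x) {j₁ j₂ j₃ : ι}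
    (h₁ : Facet u x j₁) (h₂ : Facet u x j₂) (h₃ : Facet u x j₃) (n12 : j₁ ≠ j₂) (n13 : j₁ ≠ j₃)
    (n23 : j₂ ≠ j₃) (g₁ : 0 ≤ x (u j₁) * g (u j₁)) (g₂ : 0 ≤ x (u j₂) * g (u j₂))
    (g₃ : 0 ≤ x (u j₃) * g (u j₃)) (i : ι) : 0 ≤ x (u i) * g (u i) := by
  by_contra! hc
  obtain ⟨j, hj, hjg⟩ := hG.exists_facet hx hg ⟨i, hc⟩
  rcases tri_facet_iff ht h₁ h₂ h₃ n12 n13 n23 hj with rfl | rfl | rfl <;> linarith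

/-! ### Straight edges and tetrahedral cells at excellent vertices -/

section straight
variable {v e w : D4} {p q a b : ι} {P Q A B : Fin 4 → ℝ} {x y : ι} {X Y : Fin 4 → ℝ} {α β : ℝ}

theorem Frame.closes_unique_neg (hG : General u) (h : Frame u v p q a b P Q A B) (hv : GoodV u v)
    {c c' : ι} (hc : Closes u v P (-Q) (-A) c) (hc' : Closes u v P (-Q) (-A) c') : c = c' :=
  h.neg.closes_unique hG hv hc.neg hc'.neg

/-- Follow the edge from `v` along `p, b` with `A > 0 > Q`. By uniqueness of closing walls its end
contains `x`, and the sign of `β1` leaves two cases: the claim, or `x` closes the face `B = 0 > P,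
Q`. In the second case the edge along `q, b` either forces `x = y` or ends in a plane through `q, b,
x, y`, which puts `b` on the plane `w`. -/
theorem Frame.crossing_aux (hG : General u) (h : Frame u v p q a b P Q A B) (hv : Exc u v)
    (c₁ : Closes u v P (-Q) (-B) x) (c₄ : Closes u v Q (-P) (-B) y)
    (wq : w (u q) = 0) (wx : w (u x) = 0) (wy : w (u y) = 0)
    (wb : w (u b) ≠ 0) (hxy : x ≠ y) : Closes u v B P A x := by
  have F1 : Frame u v p b a q P B A Q := h.swap34.swap23.swap34
  obtain ⟨e1, w1, x1, y1, X1, Y1, α1, β1, E1, hα1, -⟩ := F1.exists_edge hG hv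
  have k1 := E1.swap.closes_x hG hα1
  have k2 := E1.swap.closes_y' hG hα1
  rcases lt_or_gt_of_ne E1.β0 with hβ | hβ
  · have := h.swap34.swap23.closes_unique_neg hG hv.1 (E1.closes_x' hG hβ) c₁.symm
    rwa [this] at k1
  · have hx := h.swap34.swap23.closes_unique_neg hG hv.1 (E1.closes_y' hG hβ) c₁.symm
    rw [hx] at k2
    exfalso
    have F2 : Frame u v q b a p Q B A P := h.swap12.swap34.swap23.swap34
    obtain ⟨e2, w2, x2, y2, X2, Y2, α2, β2, E2, hα2, -⟩ := F2.exists_edge hG hv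
    have k3 := E2.swap.closes_y' hG hα2
    have F3 : Frame u v b p q a B P Q A := h.swap34.swap23.swap12
    have hy2 := F3.closes_unique_neg hG hv.1 k3.symm k2
    rcases lt_or_gt_of_ne E2.β0 with hβ | hβ
    · have hx2 := h.swap12.swap34.swap23.closes_unique_neg hG hv.1 (E2.closes_x' hG hβ) c₄.symm
      have e1 := h.ne_of_closes c₁
      have e2 := h.ne_of_closes c₄
      have f := E2.fw
      rw [hx2, hy2] at f
      exact wb (hG.zeros_of_three e1.2.1.symm e2.2.1.symm hxy f.nz f.zp f.zb f.za wq wx wy f.zq)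
    · have := h.swap12.swap34.swap23.closes_unique_neg hG hv.1 (E2.closes_y' hG hβ) c₄.symm
      exact hxy (by rw [← hy2, ← this])

/-- The intersection point of the lines `ab` and `pq` stays on one side of `p, q` from an
excellent vertex to the next vertex. -/
theorem Edge.straight (hG : General u) (h : Edge u v e w p q a b P Q A B x y X Y α β)
    (hv : Exc u v) (hw : GoodV u w) (hα : 0 < α) : 0 < β := by
  by_contra hc
  have hβ : β < 0 := lt_of_le_of_ne (not_lt.1 hc) h.β0
  have c1 := h.closes_x' hG hβ
  have c2 := h.closes_y hG hβ
  have c3 := h.swap.closes_x hG hα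
  have c4 := h.swap.closes_y' hG hα
  have c5 := h.fv.crossing_aux hG hv c1 c4 h.fw.zq h.fw.za h.fw.zb h.wb h.fw.ab
  have c6 : Closes u v (-A) (-Q) (-B) x := by
    refine Frame.crossing_aux hG (P := -Q) (Q := -P) (A := -B) (B := -A) h.fv.neg.swap12.swap34 hv
      ?_ ?_ h.fw.zp h.fw.za h.fw.zb h.wa h.fw.ab
    · simpa using c3.neg
    · simpa using c2.neg
  obtain ⟨vx, y1, y1P, y1Q, y1B, y1x, hy1⟩ := c1
  obtain ⟨_, y2, y2Q, y2P, y2A, y2x, hy2⟩ := c3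
  obtain ⟨_, y3, y3B, y3P, y3A, y3x, hy3⟩ := c5
  obtain ⟨_, y4, y4A, y4Q, y4B, y4x, hy4⟩ := c6
  have s1 := h.fv.map_sum y1
  have s2 := h.fv.map_sum y2
  have s3 := h.fv.map_sum y3
  have s4 := h.fv.map_sum y4
  simp only [map_neg] at y1Q y1B y4Q y4B y4A
  -- The sum of two points on different sides of the face in `x` is interior to that face.
  have φx : (y1 + y2) (u x) = 0 := by simp [y1x, y2x]
  have φP : 0 < (y1 + y2) P := by simp; linarith
  have φQ : (y1 + y2) Q < 0 := by simp; linarith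
  have φA : 0 < (y1 + y2) A := by simp; linarith
  have φB : (y1 + y2) B < 0 := by simp; linarith
  have φi : ∀ i, v (u i) ≠ 0 → i ≠ x → 0 < v (u i) * (y1 + y2) (u i) := by
    intro i h1 h2
    have := hy1 i h1 h2
    have := hy2 i h1 h2
    simp only [LinearMap.add_apply, mul_add]; linarith
  set φ := y1 + y2
  have φ0 : ∀ i, i ≠ x → φ (u i) ≠ 0 := by
    intro i hi h0
    by_cases hvi : v (u i) = 0
    · rcases (h.fv.zero i).1 hvi with rfl | rfl | rfl | rfl
      · rw [← h.fv.hp.zero_iff] at h0; linarith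
      · rw [← h.fv.hq.zero_iff] at h0; linarith
      · rw [← h.fv.ha.zero_iff] at h0; linarith
      · rw [← h.fv.hb.zero_iff] at h0; linarith
    · have := φi i hvi hi
      simp [h0] at this
  have φz : zeros u φ = {x} := by
    ext i
    simp only [mem_zeros, Finset.mem_singleton]
    exact ⟨fun h => by_contra fun hn => φ0 i hn h, fun h => h ▸ φx⟩
  have tri : Tri u φ := by
    refine hw.2 φ (by rw [φz]; simp) fun i hi => ?_
    by_cases hvi : v (u i) = 0
    · rcases (h.fv.zero i).1 hvi with rfl | rfl | rfl | rfl
      · exact absurd h.fw.zp hi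
      · exact absurd h.fw.zq hi
      · exact (h.fv.ha.mul_pos_iff _ _).2 (_root_.mul_pos h.wA φA)
      · exact (h.fv.hb.mul_pos_iff _ _).2 (mul_pos_of_neg_of_neg h.wB φB)
    · have hix : i ≠ x := by rintro rfl; exact hi h.fw.za
      exact mul_pos_trans (mul_pos_symm (h.mul_pos hvi hi)) (φi i hvi hix)
  have fac : ∀ (j : ι) (y : D4), j ≠ x → y (u j) = 0 → y (u x) = 0 →
      (∀ i, v (u i) ≠ 0 → i ≠ x → 0 < v (u i) * y (u i)) → (j ≠ p → 0 < y P) →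
      (j ≠ q → y Q < 0) → (j ≠ a → 0 < y A) → (j ≠ b → y B < 0) → Facet u φ j := by
    intro j y hj yj yx hy hP hQ hA hB
    refine ⟨φ0 j hj, y, yj, fun i hi => ?_⟩
    by_cases hix : i = x
    · subst hix; exact Or.inl ⟨φx, yx⟩
    right
    by_cases hvi : v (u i) = 0
    · rcases (h.fv.zero i).1 hvi with rfl | rfl | rfl | rfl
      · exact (h.fv.hp.mul_pos_iff _ _).2 (_root_.mul_pos φP (hP hi.symm))
      · exact (h.fv.hq.mul_pos_iff _ _).2 (mul_pos_of_neg_of_neg φQ (hQ hi.symm))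
      · exact (h.fv.ha.mul_pos_iff _ _).2 (_root_.mul_pos φA (hA hi.symm))
      · exact (h.fv.hb.mul_pos_iff _ _).2 (mul_pos_of_neg_of_neg φB (hB hi.symm))
    · exact mul_pos_trans (mul_pos_symm (φi i hvi hix)) (hy i hvi hix)
  have fp := fac p y1 h.fw.pa ((h.fv.hp.zero_iff _).1 y1P) y1x hy1 (fun h => absurd rfl h)
    (fun _ => by linarith) (fun _ => by linarith) (fun _ => by linarith)
  have fq := fac q y2 h.fw.qa ((h.fv.hq.zero_iff _).1 y2Q) y2x hy2 (fun _ => by linarith)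
    (fun h => absurd rfl h) (fun _ => by linarith) (fun _ => by linarith)
  have fb := fac b y3 h.ne.2.2.1 ((h.fv.hb.zero_iff _).1 y3B) y3x hy3 (fun _ => by linarith)
    (fun _ => by linarith) (fun _ => by linarith) (fun h => absurd rfl h)
  have fa := fac a y4 h.ne.1 ((h.fv.ha.zero_iff _).1 (by linarith)) y4x hy4
    (fun _ => by linarith) (fun _ => by linarith) (fun h => absurd rfl h) (fun _ => by linarith)
  exact tri_of_four tri fp fq fa fb h.fv.pq h.fv.pa h.fv.pb h.fv.qa h.fv.qb h.fv.ab

theorem Frame.exists_straight_edge (hG : General u) (h : Frame u v p q a b P Q A B)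
    (hv : Exc u v) : ∃ e w x y X Y α β, Edge u v e w p q a b P Q A B x y X Y α β ∧ 0 < α ∧
      0 < β ∧ GoodV u w := by
  obtain ⟨e, w, x, y, X, Y, α, β, hE, hα, hw⟩ := h.exists_edge hG hv
  exact ⟨e, w, x, y, X, Y, α, β, hE, hα, hE.straight hG hv hw hα, hw⟩

theorem Frame.exists_closes (hG : General u) (h : Frame u v p q a b P Q A B) (hv : Exc u v) :
    ∃ c, Closes u v P Q A c := by
  obtain ⟨e, w, x, y, X, Y, α, β, hE, hα, hβ, hw⟩ := h.exists_straight_edge hG hv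
  exact ⟨x, hE.closes_x hG hβ⟩

/-- The cell `P, Q, A > 0` at an excellent vertex is a tetrahedron. -/
theorem Frame.rot (hG : General u) (h : Frame u v p q a b P Q A B) (hv : Exc u v) {c : ι}
    (hc : Closes u v P Q A c) : Closes u v Q P A c := by
  -- Since `α` and `β` are both positive, the wall `x` at the end of the edge closes both faces of
  -- the cell that meet along it.
  obtain ⟨e, w, x, y, X, Y, α, β, hE, hα, hβ, hw⟩ := h.exists_straight_edge hG hv
  rw [h.closes_unique hG hv.1 hc (hE.closes_x hG hβ)]
  exact hE.swap.closes_x hG hα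

/-- Uniqueness of closing walls identifies the two new walls at the end of an edge with walls
already known to close the adjacent faces. -/
theorem Frame.edge_of_closes (hG : General u) (h : Frame u v p q a b P Q A B) (hv : Exc u v)
    (hx : Closes u v P Q A x) (hy : Closes u v P (-Q) (-B) y) :
    ∃ e w X Y α β, Edge u v e w p q a b P Q A B x y X Y α β ∧ 0 < α ∧ 0 < β ∧ GoodV u w := by
  obtain ⟨e, w, x', y', X, Y, α, β, hE, hα, hβ, hw⟩ := h.exists_straight_edge hG hv
  obtain rfl := h.closes_unique hG hv.1 hx (hE.closes_x hG hβ)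
  obtain rfl := h.swap34.closes_unique_neg hG hv.1 hy (hE.closes_y' hG hβ)
  exact ⟨e, w, X, Y, α, β, hE, hα, hβ, hw⟩

end straight

/-! ### Octahedral cells and eight associated points -/

/-- The fourth plane through an octahedron's far vertex: the octahedral cell `P, Q > 0 > A, B` at
an excellent vertex `v` closes up. -/
theorem octahedron_tip (hG : General u) {v e₁ w₁ e₂ w₂ e₃ w₃ : D4} {p q a b : ι}
    {P Q A B : Fin 4 → ℝ} {r s a' b' : ι} {X₁ Y₁ X₂ Y₂ X₃ Y₃ : Fin 4 → ℝ}
    {α₁ β₁ α₂ β₂ α₃ β₃ : ℝ}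
    (E₁ : Edge u v e₁ w₁ p b q a P B Q A a' r X₁ Y₁ α₁ β₁)
    (E₂ : Edge u v e₂ w₂ p a q b P A Q B b' r X₂ Y₂ α₂ β₂)
    (E₃ : Edge u v e₃ w₃ q b p a Q B P A a' s X₃ Y₃ α₃ β₃)
    (hα₁ : 0 < α₁) (hβ₁ : 0 < β₁) (hα₂ : 0 < α₂) (hβ₃ : 0 < β₃)
    (hw₁ : GoodV u w₁) (hab : a' ≠ b') (hrs : r ≠ s) :
    ∃ g : D4, g ≠ 0 ∧ g (u r) = 0 ∧ g (u s) = 0 ∧ g (u a') = 0 ∧ g (u b') = 0 := by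
  have ra' : r ≠ a' := E₁.fw.ab.symm
  have rb' : r ≠ b' := E₂.fw.ab.symm
  have sa' : s ≠ a' := E₃.fw.ab.symm
  have pa' : p ≠ a' := E₁.fw.pa
  have pb' : p ≠ b' := E₂.fw.pa
  have pr : p ≠ r := E₁.fw.pb
  have br : b ≠ r := E₁.fw.qb
  have bs : b ≠ s := E₃.fw.qb
  have wb' : w₁ (u b') ≠ 0 := by
    rw [ne_eq, E₁.fw.zero]; push Not
    exact ⟨pb'.symm, E₂.ne.2.2.1.symm, hab.symm, rb'.symm⟩
  have ws : w₁ (u s) ≠ 0 := by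
    rw [ne_eq, E₁.fw.zero]; push Not
    exact ⟨E₃.ne.2.1.symm, bs.symm, sa', hrs.symm⟩
  -- the face in `r`
  obtain ⟨φ, hφ, φP, φB, φX⟩ := E₁.fw.exists_cell hG 1 (-2) 1
  have φs := E₁.fw.map_sum φ
  have φY : φ Y₁ = 0 := by linarith
  have φr : φ (u r) = 0 := (E₁.fw.hb.zero_iff φ).1 φY
  have FW₁ : Frame u w₁ r p a' b Y₁ (α₁ • P) X₁ (β₁ • B) :=
    E₁.fw.swap34.swap23.swap12.swap34
  have φP' : 0 < φ (α₁ • P) := by rw [φP]; exact one_pos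
  have φX' : 0 < φ X₁ := by rw [φX]; exact one_pos
  have f1 := FW₁.facet hG hφ φY φP' φX'
  have f2 := FW₁.facet' hG hφ φY φP' φX'
  have t1 := FW₁.tri hw₁ hφ φY φP' φX'
  have z1 := FW₁.zeros_face hφ φY φP' φX'
  have φPpos : 0 < φ P := by simp at φP'; exact pos_of_mul_pos_right φP' hα₁.le
  have φBneg : φ B < 0 := by
    rw [map_smul, smul_eq_mul] at φB; nlinarith
  -- Along each edge the two ends agree in sign off their own walls, so the face found at `w₁` also
  -- has `w₂` as a vertex. This yields its third facet `b'`.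
  have cφ : Conf u w₂ φ := by
    intro i hi
    by_cases hv : v (u i) = 0
    · rcases (E₂.fv.zero i).1 hv with rfl | rfl | rfl | rfl
      · exact absurd E₂.fw.zp hi
      · exact absurd E₂.fw.zq hi
      · exact (E₂.fv.ha.mul_pos_iff _ _).2
          (mul_pos E₂.wA (hφ.pos E₂.fv.ha E₁.wa E₁.wA))
      · exact (E₂.fv.hb.mul_pos_iff _ _).2 (mul_pos_of_neg_of_neg E₂.wB φBneg)
    · by_cases hw : w₁ (u i) = 0
      · rcases (E₁.fw.zero i).1 hw with rfl | rfl | rfl | rfl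
        · exact absurd E₁.fv.zp hv
        · exact absurd E₁.fv.zq hv
        · exact mul_pos_trans (mul_pos_symm (E₂.mul_pos hv hi))
            ((E₁.fw.ha.mul_pos_iff _ _).2 (mul_pos E₁.vX φX'))
        · exact absurd E₂.fw.zb hi
      · exact mul_pos_trans (mul_pos_symm (E₂.mul_pos hv hi))
          (mul_pos_trans (E₁.mul_pos hv hw) (hφ i hw))
  have f3 : Facet u φ b' := by
    have FW₂ : Frame u w₂ r b' p a Y₂ X₂ (α₂ • P) (β₂ • A) :=
      E₂.fw.swap34.swap23.swap12.swap34.swap23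
    refine FW₂.facet hG cφ ((FW₂.hp.zero_iff φ).2 φr) ?_ (by simp; positivity)
    exact hφ.pos E₂.fw.ha wb'
      ((pos_of_mul_pos_right ((E₂.fw.ha.mul_pos_iff _ _).1 (E₁.mul_pos E₂.vx wb')) E₂.vX.le))
  -- the face in `a'`
  obtain ⟨ψ, hψ, ψP, ψB, ψX⟩ := E₁.fw.exists_cell hG 2 (-1) 0
  have ψs := E₁.fw.map_sum ψ
  have ψY : ψ Y₁ = -1 := by linarith
  have ψr : ψ (u a') = 0 := (E₁.fw.ha.zero_iff ψ).1 ψX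
  have GW₁ : Frame u w₁ a' b r p (-X₁) (-(β₁ • B)) (-Y₁) (-(α₁ • P)) :=
    FW₁.swap23.swap12.swap34.swap23.neg
  have ψB' : 0 < ψ (-(β₁ • B)) := by rw [map_neg, ψB]; norm_num
  have ψY' : 0 < ψ (-Y₁) := by rw [map_neg, ψY]; norm_num
  have ψX' : ψ (-X₁) = 0 := by rw [map_neg, ψX]; norm_num
  have f4 := GW₁.facet hG hψ ψX' ψB' ψY'
  have f5 := GW₁.facet' hG hψ ψX' ψB' ψY'
  have t2 := GW₁.tri hw₁ hψ ψX' ψB' ψY'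
  have z2 := GW₁.zeros_face hψ ψX' ψB' ψY'
  have ψPpos : 0 < ψ P := by rw [map_smul, smul_eq_mul] at ψP; nlinarith
  have ψBneg : ψ B < 0 := by
    rw [map_smul, smul_eq_mul] at ψB; nlinarith
  have cψ : Conf u w₃ ψ := by
    intro i hi
    by_cases hv : v (u i) = 0
    · rcases (E₃.fv.zero i).1 hv with rfl | rfl | rfl | rfl
      · exact absurd E₃.fw.zp hi
      · exact absurd E₃.fw.zq hi
      · exact (E₃.fv.ha.mul_pos_iff _ _).2 (mul_pos E₃.wA ψPpos)
      · refine (E₃.fv.hb.mul_pos_iff _ _).2 (mul_pos_of_neg_of_neg E₃.wB ?_)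
        have := hψ.pos E₁.fv.hb.neg E₁.wb (by simpa using E₁.wB)
        simpa using this
    · by_cases hw : w₁ (u i) = 0
      · rcases (E₁.fw.zero i).1 hw with rfl | rfl | rfl | rfl
        · exact absurd E₁.fv.zp hv
        · exact absurd E₁.fv.zq hv
        · exact absurd E₃.fw.za hi
        · exact mul_pos_trans (mul_pos_symm (E₃.mul_pos hv hi))
            ((E₁.fw.hb.mul_pos_iff _ _).2 (mul_pos_of_neg_of_neg E₁.vY (by linarith)))
      · exact mul_pos_trans (mul_pos_symm (E₃.mul_pos hv hi))
          (mul_pos_trans (E₁.mul_pos hv hw) (hψ i hw))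
  have f6 : Facet u ψ s := by
    have FW₃ : Frame u w₃ a' s b q (-X₃) (-Y₃) (-(β₃ • B)) (-(α₃ • Q)) :=
      E₃.fw.swap23.swap12.swap34.swap23.swap34.neg
    refine FW₃.facet hG cψ ((FW₃.hp.zero_iff ψ).2 ψr) ?_ (by simp; nlinarith)
    refine hψ.pos FW₃.hq ws ?_
    refine pos_of_mul_pos_right ((FW₃.hq.mul_pos_iff _ _).1 (E₁.mul_pos E₃.vy ws)) ?_
    simpa using E₃.vY.le
  -- the two ends agree
  have hφz : ∀ i, φ (u i) = 0 ↔ i = r := fun i => by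
    rw [← mem_zeros, z1, Finset.mem_singleton]
  have hψz : ∀ i, ψ (u i) = 0 ↔ i = a' := fun i => by
    rw [← mem_zeros, z2, Finset.mem_singleton]
  have sgn : ∀ (x : D4) (i j k l : ι), ∃ g : D4, g ≠ 0 ∧ g (u i) = 0 ∧ g (u j) = 0 ∧
      g (u k) = 0 ∧ 0 ≤ x (u l) * g (u l) := by
    intro x i j k l
    obtain ⟨g, g0, g1, g2, g3⟩ := exists_plane (u := u) i j k
    rcases le_total 0 (x (u l) * g (u l)) with h | h
    · exact ⟨g, g0, g1, g2, g3, h⟩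
    · exact ⟨-g, by simpa, by simp [g1], by simp [g2], by simp [g3], by simpa using h⟩
  -- The triangle in `r` has the sides `p, a', b'` and the triangle in `a'` has the sides `b, r, s`.
  -- They share the edge on the line `r, a'` starting at `w₁`; `g` and `k` are its far end as
  -- computed in either triangle.
  obtain ⟨g, g0, gr, ga, gb, gp⟩ := sgn φ r a' b' p
  obtain ⟨k, k0, kr, ka, ks, kb⟩ := sgn ψ r a' s b
  have cg := hG.conf_of_tri hφz gr t1 f1 f2 f3 pa' pb' hab gp (by simp [ga]) (by simp [gb])
  have ck := hG.conf_of_tri hψz ka t2 f4 f5 f6 br bs hrs kb (by simp [kr]) (by simp [ks])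
  refine ⟨g, g0, gr, ?_, ga, gb⟩
  have gp0 : g (u p) ≠ 0 := fun h => wb' (hG.zeros_of_three pr pa' ra' g0 h gr ga E₁.fw.zp
    E₁.fw.zb E₁.fw.za gb)
  -- All three planes pass through `r` and `a'`, so `k = c w₁ + d g`. The signs at `b'` and at `p`
  -- give `c, d ≥ 0`. At `s` both terms have the sign of `φ` or vanish, their sum is zero and `w₁`
  -- does not vanish there; hence `c = 0` and `k` is a multiple of `g`.
  obtain ⟨c, hc⟩ := hG.proportional (y := k - (k (u p) / g (u p)) • g) pr pa' ra' E₁.fw.nz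
    E₁.fw.zp E₁.fw.zb E₁.fw.za (by simp [gp0]) (by simp [kr, gr]) (by simp [ka, ga])
  have hk : ∀ i, k (u i) = c * w₁ (u i) + (k (u p) / g (u p)) * g (u i) := fun i => by
    have := LinearMap.congr_fun hc (u i)
    simp at this
    linarith
  set d := k (u p) / g (u p) with hd
  have hc0 : 0 ≤ c := by
    have h1 := ck b'
    rw [hk, gb, mul_zero, add_zero] at h1
    have h2 := hψ b' wb'
    by_contra! h3
    nlinarith
  have hd0 : 0 ≤ d := by
    have h1 := cg p
    have h2 := ck p
    have h3 : 0 < φ (u p) * ψ (u p) := (E₁.fv.hp.mul_pos_iff _ _).2 (mul_pos φPpos ψPpos)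
    have h4 : 0 < φ (u p) * g (u p) := lt_of_le_of_ne h1
      (mul_ne_zero (fun h => by simp [h] at h3) gp0).symm
    have h5 : 0 < g (u p) * ψ (u p) := mul_pos_trans (mul_pos_symm h4) h3
    have h6 : d * (g (u p) * ψ (u p)) = ψ (u p) * k (u p) := by rw [hd]; field_simp
    by_contra! h7
    nlinarith
  have h1 := hk s
  rw [ks] at h1
  have h2 := cg s
  have h3 := hφ s ws
  have hcz : c = 0 := by
    by_contra hne
    have : 0 < c := lt_of_le_of_ne hc0 (Ne.symm hne)
    have h4 : 0 < c * (w₁ (u s) * φ (u s)) := mul_pos this h3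
    have h5 : 0 ≤ d * (φ (u s) * g (u s)) := mul_nonneg hd0 h2
    have h6 : c * (w₁ (u s) * φ (u s)) + d * (φ (u s) * g (u s))
      = φ (u s) * (c * w₁ (u s) + d * g (u s)) := by ring
    rw [← h1, mul_zero] at h6
    linarith
  have hdne : d ≠ 0 := by
    intro hdz
    apply k0
    refine hG.span k fun i => ?_
    rw [hk, hcz, hdz]; ring
  rw [hcz, zero_mul, zero_add] at h1
  exact (mul_eq_zero.1 h1.symm).resolve_left hdne

/-- The eight associated points theorem for the vertices of a cube. -/
theorem quadratic_cube (f : QuadraticForm ℝ (Fin 4 → ℝ)) {e₀ e₁ e₂ e₃ : Fin 4 → ℝ}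
    {a₀ a₁ a₂ r₀ r₁ r₃ s₀ s₂ s₃ y₀ y₁ y₂ y₃ : ℝ} {α β γ : D4}
    (ha₁ : a₁ ≠ 0) (ha₂ : a₂ ≠ 0) (hr₁ : r₁ ≠ 0) (hr₃ : r₃ ≠ 0) (hs₂ : s₂ ≠ 0) (hs₃ : s₃ ≠ 0)
    (hα : α e₀ ≠ 0) (hβ : β e₀ ≠ 0) (hγ : γ e₀ ≠ 0)
    (f₀ : f e₀ = 0) (f₁ : f e₁ = 0) (f₂ : f e₂ = 0) (f₃ : f e₃ = 0)
    (fa : f (a₀ • e₀ + a₁ • e₁ + a₂ • e₂) = 0) (fr : f (r₀ • e₀ + r₁ • e₁ + r₃ • e₃) = 0)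
    (fs : f (s₀ • e₀ + s₂ • e₂ + s₃ • e₃) = 0)
    (α₃ : α e₃ = 0) (αr : α (r₀ • e₀ + r₁ • e₁ + r₃ • e₃) = 0)
    (αs : α (s₀ • e₀ + s₂ • e₂ + s₃ • e₃) = 0)
    (αy : α (y₀ • e₀ + y₁ • e₁ + y₂ • e₂ + y₃ • e₃) = 0)
    (β₂ : β e₂ = 0) (βs : β (s₀ • e₀ + s₂ • e₂ + s₃ • e₃) = 0)
    (βa : β (a₀ • e₀ + a₁ • e₁ + a₂ • e₂) = 0)
    (βy : β (y₀ • e₀ + y₁ • e₁ + y₂ • e₂ + y₃ • e₃) = 0)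
    (γ₁ : γ e₁ = 0) (γa : γ (a₀ • e₀ + a₁ • e₁ + a₂ • e₂) = 0)
    (γr : γ (r₀ • e₀ + r₁ • e₁ + r₃ • e₃) = 0)
    (γy : γ (y₀ • e₀ + y₁ • e₁ + y₂ • e₂ + y₃ • e₃) = 0) :
    f (y₀ • e₀ + y₁ • e₁ + y₂ • e₂ + y₃ • e₃) = 0 := by
  simp only [map_add, map_smul, smul_eq_mul, α₃, β₂, γ₁, mul_zero, add_zero] at αr αs αy βs βa βy γa γr γy
  have ex : ∀ x y, f (x + y) = f x + f y + QuadraticMap.polar f x y := fun x y => by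
    simp [QuadraticMap.polar]
  simp only [ex, QuadraticMap.polar_add_left, QuadraticMap.polar_smul_left,
    QuadraticMap.polar_smul_right, QuadraticMap.map_smul, smul_eq_mul, f₀, f₁, f₂, f₃] at fa fr fs ⊢
  generalize QuadraticMap.polar f e₀ e₁ = p01 at *
  generalize QuadraticMap.polar f e₀ e₂ = p02 at *
  generalize QuadraticMap.polar f e₀ e₃ = p03 at *
  generalize QuadraticMap.polar f e₁ e₂ = p12 at *
  generalize QuadraticMap.polar f e₁ e₃ = p13 at *
  generalize QuadraticMap.polar f e₂ e₃ = p23 at *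
  generalize α e₀ = A0 at *
  generalize α e₁ = A1 at *
  generalize α e₂ = A2 at *
  generalize β e₀ = B0 at *
  generalize β e₁ = B1 at *
  generalize β e₃ = B3 at *
  generalize γ e₀ = C0 at *
  generalize γ e₂ = C2 at *
  generalize γ e₃ = C3 at *
  -- As `f` vanishes at the four basis vectors, only the six mixed coefficients remain. Each of the
  -- three points next to the basis expresses one of `p12, p13, p23` by `p01, p02, p03`; what is
  -- left is a combination of the equations of the three planes through the eighth point.
  have h12 : p12 = C2 / C0 * p01 + B1 / B0 * p02 := by
    have e1 : a₀ = -(a₁ * (B1 / B0)) := by field_simp; linarith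
    have e2 : a₀ = -(a₂ * (C2 / C0)) := by field_simp; linarith
    have : a₁ * a₂ * (p12 - (C2 / C0 * p01 + B1 / B0 * p02)) = 0 := by
      linear_combination fa - a₁ * p01 * e2 - a₂ * p02 * e1
    have := (mul_eq_zero.1 this).resolve_left (mul_ne_zero ha₁ ha₂)
    linarith
  have h13 : p13 = C3 / C0 * p01 + A1 / A0 * p03 := by
    have e1 : r₀ = -(r₁ * (A1 / A0)) := by field_simp; linarith
    have e2 : r₀ = -(r₃ * (C3 / C0)) := by field_simp; linarith
    have : r₁ * r₃ * (p13 - (C3 / C0 * p01 + A1 / A0 * p03)) = 0 := by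
      linear_combination fr - r₁ * p01 * e2 - r₃ * p03 * e1
    have := (mul_eq_zero.1 this).resolve_left (mul_ne_zero hr₁ hr₃)
    linarith
  have h23 : p23 = B3 / B0 * p02 + A2 / A0 * p03 := by
    have e1 : s₀ = -(s₂ * (A2 / A0)) := by field_simp; linarith
    have e2 : s₀ = -(s₃ * (B3 / B0)) := by field_simp; linarith
    have : s₂ * s₃ * (p23 - (B3 / B0 * p02 + A2 / A0 * p03)) = 0 := by
      linear_combination fs - s₂ * p02 * e2 - s₃ * p03 * e1
    have := (mul_eq_zero.1 this).resolve_left (mul_ne_zero hs₂ hs₃)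
    linarith
  have ya : y₀ + y₁ * (A1 / A0) + y₂ * (A2 / A0) = 0 := by field_simp; linarith
  have yb : y₀ + y₁ * (B1 / B0) + y₃ * (B3 / B0) = 0 := by field_simp; linarith
  have yc : y₀ + y₂ * (C2 / C0) + y₃ * (C3 / C0) = 0 := by field_simp; linarith
  rw [h12, h13, h23]
  linear_combination p01 * y₁ * yc + p02 * y₂ * yb + p03 * y₃ * ya

theorem Para.quadratic_zero {i : ι} {I : Fin 4 → ℝ} (h : Para u i I)
    {f : QuadraticForm ℝ (Fin 4 → ℝ)} (hf : f (u i) = 0) : f I = 0 := by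
  obtain ⟨k, _, rfl⟩ := h
  simp [QuadraticMap.map_smul, hf]

theorem Para.of_quadratic_zero {i : ι} {I : Fin 4 → ℝ} (h : Para u i I)
    {f : QuadraticForm ℝ (Fin 4 → ℝ)} (hf : f I = 0) : f (u i) = 0 := by
  obtain ⟨k, hk, rfl⟩ := h
  simpa [QuadraticMap.map_smul, hk] using hf

theorem Para.eq_smul {i : ι} {I J : Fin 4 → ℝ} (h : Para u i I) (h' : Para u i J) :
    ∃ κ : ℝ, κ ≠ 0 ∧ J = κ • I := by
  obtain ⟨k, hk, rfl⟩ := h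
  obtain ⟨k', hk', rfl⟩ := h'
  exact ⟨k' / k, div_ne_zero hk' hk, by rw [smul_smul]; field_simp⟩

/-- A quadric through seven of the eight points given by an octahedral cell at an excellent vertex
contains the eighth. -/
theorem Frame.quadric_closed (hG : General u) {v : D4} {p q a b : ι} {P Q A B : Fin 4 → ℝ}
    (h : Frame u v p q a b P Q A B) (hv : Exc u v) {r s a' b' : ι}
    (hr : Closes u v P (-A) (-B) r) (hs : Closes u v Q (-A) (-B) s) (ha' : Closes u v B P Q a')
    (hb' : Closes u v A P Q b') {f : QuadraticForm ℝ (Fin 4 → ℝ)} (fp : f (u p) = 0)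
    (fq : f (u q) = 0) (fa : f (u a) = 0) (fb : f (u b) = 0) (fr : f (u r) = 0)
    (fs : f (u s) = 0) (fa' : f (u a') = 0) : f (u b') = 0 := by
  have Fb : Frame u v b p q a B P Q A := h.swap34.swap23.swap12
  have Fb' : Frame u v b q p a B Q P A := Fb.swap23
  have Fa : Frame u v a p q b A P Q B := h.swap23.swap12
  have Fa' : Frame u v a q p b A Q P B := Fa.swap23
  obtain ⟨e₁, w₁, X₁, Y₁, α₁, β₁, E₁, hα₁, hβ₁, hw₁⟩ :=
    Fb.swap12.edge_of_closes hG hv (Fb.rot hG hv ha') hr.symm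
  obtain ⟨e₂, w₂, X₂, Y₂, α₂, β₂, E₂, hα₂, hβ₂, hw₂⟩ :=
    Fa.swap12.edge_of_closes hG hv (Fa.rot hG hv hb') hr
  obtain ⟨e₃, w₃, X₃, Y₃, α₃, β₃, E₃, hα₃, hβ₃, hw₃⟩ :=
    Fb'.swap12.edge_of_closes hG hv (Fb'.rot hG hv ha'.symm) hs.symm
  obtain ⟨e₄, w₄, X₄, Y₄, α₄, β₄, E₄, hα₄, hβ₄, hw₄⟩ :=
    Fa'.swap12.edge_of_closes hG hv (Fa'.rot hG hv hb'.symm) hs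
  have hab : a' ≠ b' := by
    rintro rfl
    exact E₂.wb (hG.zeros_of_three E₁.fw.pa E₁.fw.pb E₁.fw.ab E₁.fw.nz E₁.fw.zp E₁.fw.za
      E₁.fw.zb E₂.fw.zp E₂.fw.za E₂.fw.zb E₁.fw.zq)
  have hrs : r ≠ s := by
    rintro rfl
    exact E₃.wa (hG.zeros_of_three E₁.fw.qa E₁.fw.qb E₁.fw.ab E₁.fw.nz E₁.fw.zq E₁.fw.za
      E₁.fw.zb E₃.fw.zq E₃.fw.za E₃.fw.zb E₁.fw.zp)
  obtain ⟨g, g0, gr, gs, ga, gb⟩ := octahedron_tip hG E₁ E₂ E₃ hα₁ hβ₁ hα₂ hβ₃ hw₁ hab hrs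
  have gb0 : g (u b) ≠ 0 := by
    intro h0
    have := hG.zeros_of_three E₁.fw.qa E₁.fw.qb E₁.fw.ab g0 h0 ga gr E₁.fw.zq E₁.fw.za
      E₁.fw.zb gb
    rcases (E₁.fw.zero b').1 this with h1 | h1 | h1 | h1
    · exact E₂.fw.pa h1.symm
    · exact E₂.ne.2.2.1 h1.symm
    · exact hab h1.symm
    · exact E₂.fw.ab h1
  obtain ⟨κ, hκ, hX₃⟩ := E₁.fw.ha.eq_smul E₃.fw.ha
  obtain ⟨ρ, hρ, hY₂⟩ := E₁.fw.hb.eq_smul E₂.fw.hb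
  have s0 := h.sum
  have s1 := E₁.fw.sum
  have s2 := E₂.fw.sum
  have s3 := E₃.fw.sum
  -- The cube in the basis `B, P, Q, X₁`: the planes through its corner `b` are `v, w₁, w₃`, and
  -- those through the opposite corner `b'` are `g, w₄, w₂`. The frame relations give the
  -- coordinates of the other points.
  have vA : (-1 : ℝ) • B + (-1 : ℝ) • P + (-1 : ℝ) • Q = A := by
    linear_combination (norm := module) (-1 : ℝ) • s0
  have vr : (-β₁) • B + (-α₁) • P + (-1 : ℝ) • X₁ = Y₁ := by
    linear_combination (norm := module) (-1 : ℝ) • s1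
  have vs : (-β₃) • B + (-α₃) • Q + (-κ) • X₁ = Y₃ := by
    rw [hX₃] at s3
    linear_combination (norm := module) (-1 : ℝ) • s3
  have vy : (β₂ + ρ * β₁) • B + (-α₂ + β₂ + ρ * α₁) • P + β₂ • Q + ρ • X₁ = X₂ := by
    rw [hY₂] at s2
    linear_combination (norm := module) (-1 : ℝ) • s2 + ρ • s1 + β₂ • s0
  refine E₂.fw.ha.of_quadratic_zero ?_
  rw [← vy]
  have n1 : (-1 : ℝ) ≠ 0 := by norm_num
  refine quadratic_cube f (α := g) (β := w₄) (γ := w₂) n1 n1 (neg_ne_zero.2 hα₁.ne') n1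
    (neg_ne_zero.2 hα₃.ne') (neg_ne_zero.2 hκ) ?_ ?_ ?_ (h.hb.quadratic_zero fb)
    (h.hp.quadratic_zero fp) (h.hq.quadratic_zero fq) (E₁.fw.ha.quadratic_zero fa')
    (by rw [vA]; exact h.ha.quadratic_zero fa) (by rw [vr]; exact E₁.fw.hb.quadratic_zero fr)
    (by rw [vs]; exact E₃.fw.hb.quadratic_zero fs) ((E₁.fw.ha.zero_iff g).2 ga)
    (by rw [vr]; exact (E₁.fw.hb.zero_iff g).2 gr) (by rw [vs]; exact (E₃.fw.hb.zero_iff g).2 gs)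
    (by rw [vy]; exact (E₂.fw.ha.zero_iff g).2 gb) ((h.hq.zero_iff w₄).2 E₄.fw.zp)
    (by rw [vs]; exact (E₃.fw.hb.zero_iff w₄).2 E₄.fw.zb)
    (by rw [vA]; exact (h.ha.zero_iff w₄).2 E₄.fw.zq)
    (by rw [vy]; exact (E₂.fw.ha.zero_iff w₄).2 E₄.fw.za) ((h.hp.zero_iff w₂).2 E₂.fw.zp)
    (by rw [vA]; exact (h.ha.zero_iff w₂).2 E₂.fw.zq)
    (by rw [vr]; exact (E₁.fw.hb.zero_iff w₂).2 E₂.fw.zb)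
    (by rw [vy]; exact (E₂.fw.ha.zero_iff w₂).2 E₂.fw.za)
  · rwa [ne_eq, h.hb.zero_iff]
  · rw [ne_eq, h.hb.zero_iff]; exact E₄.wb
  · rw [ne_eq, h.hb.zero_iff]; exact E₂.wb

/-! ### Carrying a quadric from an excellent vertex to the next -/

/-- The quadratic form `f` vanishes at eight points that are determined by the vertex `v` and that
determine a pencil of quadrics. -/
def Van (u : ι → Fin 4 → ℝ) (f : QuadraticForm ℝ (Fin 4 → ℝ)) (v : D4) (p q a b : ι)
    (P Q A B : Fin 4 → ℝ) : Prop :=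
  f (u p) = 0 ∧ f (u q) = 0 ∧ f (u a) = 0 ∧ f (u b) = 0 ∧
    (∀ c, Closes u v Q A B c → f (u c) = 0) ∧ (∀ c, Closes u v Q (-A) (-B) c → f (u c) = 0) ∧
    (∀ c, Closes u v P (-A) (-B) c → f (u c) = 0) ∧ ∀ c, Closes u v P Q B c → f (u c) = 0

section
variable {v e w : D4} {p q a b : ι} {P Q A B : Fin 4 → ℝ} {x y : ι} {X Y : Fin 4 → ℝ} {α β : ℝ}

theorem Frame.fourth_eq (hG : General u) (h : Frame u v p q a b P Q A B) {w : D4} {c : ι}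
    (wp : w (u p) = 0) (wq : w (u q) = 0) (wb : w (u b) = 0) (wc : w (u c) = 0) (w0 : w ≠ 0)
    (cp : c ≠ p) (cq : c ≠ q) (cb : c ≠ b) : c = a := by
  have := hG.zeros_of_three h.pq h.pb h.qb w0 wp wq wb h.zp h.zq h.zb wc
  rcases (h.zero c).1 this with h | h | h | h
  · exact absurd h cp
  · exact absurd h cq
  · exact h
  · exact absurd h cb

/-- The edge read in the opposite direction. -/
theorem Edge.reverse (h : Edge u v e w p q a b P Q A B x y X Y α β) :
    Edge u w e v p q x y (α • P) (β • Q) X Y a b A B α⁻¹ β⁻¹ :=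
  ⟨h.fw, by simpa [smul_smul, h.α0, h.β0] using h.fv, inv_ne_zero h.α0, inv_ne_zero h.β0, h.cw,
    h.cv, by simp [h.eP], by simp [h.eQ], h.eX, h.eA, h.wa, h.wb⟩

theorem Frame.rot_neg (hG : General u) (h : Frame u v p q a b P Q A B) (hv : Exc u v) {c : ι}
    (hc : Closes u v P (-Q) (-A) c) : Closes u v Q (-P) (-A) c :=
  (h.neg.rot hG hv hc.neg).of_neg

/-- From an excellent vertex to the next one on the line `p, q`. -/
theorem Edge.van (hG : General u) (h : Edge u v e w p q a b P Q A B x y X Y α β)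
    (hβ : 0 < β) (hv : Exc u v) (hw : Exc u w) {f : QuadraticForm ℝ (Fin 4 → ℝ)}
    (hf : Van u f v p q a b P Q A B) : Van u f w p q y x (α • P) (β • Q) Y X := by
  obtain ⟨fp, fq, fa, fb, f1, f2, f3, f4⟩ := hf
  have F := h.fv
  have cx : Closes u v P Q A x := h.closes_x hG hβ
  have cy : Closes u v P (-Q) (-B) y := h.closes_y' hG hβ
  -- Besides `p, q, a, b`, the eight points are closing walls of tetrahedral cells: `pp` and `pm`
  -- where `P` alone is negative or positive, `qm` where `Q` alone is positive, `ap` where `A` alone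
  -- is negative.
  obtain ⟨pp, hpp⟩ := (F.swap12.swap23.swap34.swap23 : Frame u v q b a p Q B A P).exists_closes hG hv
  obtain ⟨pm, hpm⟩ :=
    (F.swap12.swap23.swap34 : Frame u v q a b p Q A B P).neg.exists_closes hG hv
  replace hpm := hpm.of_neg
  obtain ⟨qm, hqm⟩ := (F.swap23.swap34 : Frame u v p a b q P A B Q).neg.exists_closes hG hv
  replace hqm := hqm.of_neg
  obtain ⟨ap, hap⟩ := (F.swap34 : Frame u v p q b a P Q B A).exists_closes hG hv
  have Fpb : Frame u v p b q a P B Q A := F.swap34.swap23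
  -- The octahedral cell `P, Q > 0 > A, B` has the walls `p, q, a, b, qm, pm, ap, x`.
  have fx : f (u x) = 0 := F.quadric_closed hG hv hqm hpm (Fpb.rot hG hv hap.symm)
    (F.swap23.rot hG hv cx.symm) fp fq fa fb (f3 _ hqm) (f2 _ hpm) (f4 _ hap)
  -- The octahedral cell `Q, A > 0 > P, B` has the walls `p, q, a, b, x, pp, qm, y`.
  have fy : f (u y) = 0 := by
    refine Fpb.neg.quadric_closed hG hv (r := x) (s := pp) (a' := qm) (b' := y) ?_ ?_ ?_ ?_
      fp fb fq fa fx (f1 _ hpp.symm) (f3 _ hqm)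
    · simpa using cx.neg
    · have := (F.swap12.swap23.swap34.swap23 : Frame u v q b a p Q B A P).rot hG hv hpp
      simpa using this.neg
    · have := (F.swap23.swap34 : Frame u v p a b q P A B Q).rot_neg hG hv hqm
      simpa using this.neg
    · have := F.swap34.rot_neg hG hv cy
      simpa using this.neg
  have G := h.fw
  have R := h.reverse
  have hβ' : 0 < β⁻¹ := inv_pos.2 hβ
  have ca : Closes u w (α • P) (β • Q) X a := R.closes_x hG hβ'
  have cb : Closes u w (α • P) (-(β • Q)) (-Y) b := R.closes_y' hG hβ'
  -- At `w` the points `b` and `ap` are replaced by `x` and `y`, and `a` takes the role of `ap`. The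
  -- other three are unchanged: in each case an edge from `v` and an edge from `w` end in planes
  -- sharing three points, so their fourth points agree.
  refine ⟨fp, fq, fy, fx, fun c hc => ?_, fun c hc => ?_, fun c hc => ?_, fun c hc => ?_⟩
  · obtain ⟨_, W, _, _, _, _, EW, _⟩ :=
      (F.swap12.swap23.swap34.swap23 : Frame u v q b a p Q B A P).edge_of_closes hG hv hpp
      (F.swap34.rot_neg hG hv cy).symm
    obtain ⟨_, W', _, _, _, _, EW', _⟩ := (G.swap12.swap23.swap34.swap23 :
      Frame u w q y x p (β • Q) Y X (α • P)).edge_of_closes hG hw hc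
      (G.swap34.rot_neg hG hw cb).symm
    rw [EW.fw.fourth_eq hG EW'.fw.zp EW'.fw.zb EW'.fw.zq EW'.fw.za EW'.fw.nz EW'.fw.pa.symm
      EW'.fw.ab EW'.fw.qa.symm]
    exact f1 _ hpp.symm
  · obtain ⟨_, W, _, _, _, _, EW, _⟩ :=
      (F.swap12.swap23 : Frame u v q a p b Q A P B).edge_of_closes hG hv
      (F.rot hG hv cx).symm hpm
    obtain ⟨_, W', _, _, _, _, EW', _⟩ := (G.swap12.swap23 :
      Frame u w q x p y (β • Q) X (α • P) Y).edge_of_closes hG hw (G.rot hG hw ca).symm hc.symm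
    rw [EW.fw.swap34.fourth_eq hG EW'.fw.zp EW'.fw.za EW'.fw.zq EW'.fw.zb EW'.fw.nz
      EW'.fw.pb.symm EW'.fw.ab.symm EW'.fw.qb.symm]
    exact f2 _ hpm
  · obtain ⟨_, W, _, _, _, _, EW, _⟩ :=
      (F.swap23 : Frame u v p a q b P A Q B).edge_of_closes hG hv cx.symm hqm
    obtain ⟨_, W', _, _, _, _, EW', _⟩ := (G.swap23 :
      Frame u w p x q y (α • P) X (β • Q) Y).edge_of_closes hG hw ca.symm hc.symm
    rw [EW.fw.swap34.fourth_eq hG EW'.fw.zp EW'.fw.za EW'.fw.zq EW'.fw.zb EW'.fw.nz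
      EW'.fw.pb.symm EW'.fw.ab.symm EW'.fw.qb.symm]
    exact f3 _ hqm
  · rw [G.closes_unique hG hw.1 hc ca]
    exact fa

end

/-! ### Pencils of quadrics -/

/-- Ten linearly independent quadratic forms. -/
noncomputable def monomials : Fin 10 → QuadraticForm ℝ (Fin 4 → ℝ) :=
  let X : Fin 4 → D4 := LinearMap.proj
  ![QuadraticMap.linMulLin (X 0) (X 0), QuadraticMap.linMulLin (X 1) (X 1),
    QuadraticMap.linMulLin (X 2) (X 2), QuadraticMap.linMulLin (X 3) (X 3),
    QuadraticMap.linMulLin (X 0) (X 1), QuadraticMap.linMulLin (X 0) (X 2),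
    QuadraticMap.linMulLin (X 0) (X 3), QuadraticMap.linMulLin (X 1) (X 2),
    QuadraticMap.linMulLin (X 1) (X 3), QuadraticMap.linMulLin (X 2) (X 3)]

theorem linearIndependent_monomials : LinearIndependent ℝ monomials := by
  rw [Fintype.linearIndependent_iff]
  intro g hg
  have key : ∀ x : Fin 4 → ℝ, g 0 * (x 0 * x 0) + g 1 * (x 1 * x 1) + g 2 * (x 2 * x 2)
      + g 3 * (x 3 * x 3) + g 4 * (x 0 * x 1) + g 5 * (x 0 * x 2) + g 6 * (x 0 * x 3)
      + g 7 * (x 1 * x 2) + g 8 * (x 1 * x 3) + g 9 * (x 2 * x 3) = 0 := by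
    intro x
    have := congrArg (fun Q : QuadraticForm ℝ (Fin 4 → ℝ) => Q x) hg
    simp only [Fin.sum_univ_succ, monomials] at this
    simp at this
    linarith
  have h0 := key ![1, 0, 0, 0]
  have h1 := key ![0, 1, 0, 0]
  have h2 := key ![0, 0, 1, 0]
  have h3 := key ![0, 0, 0, 1]
  have h4 := key ![1, 1, 0, 0]
  have h5 := key ![1, 0, 1, 0]
  have h6 := key ![1, 0, 0, 1]
  have h7 := key ![0, 1, 1, 0]
  have h8 := key ![0, 1, 0, 1]
  have h9 := key ![0, 0, 1, 1]
  simp at h0 h1 h2 h3 h4 h5 h6 h7 h8 h9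
  simp only [h0, h1, h2, h3] at h4 h5 h6 h7 h8 h9
  intro i
  fin_cases i <;> simp <;> linarith

/-- There is a pencil of quadrics through any eight points. -/
theorem exists_pencil (z : Fin 8 → Fin 4 → ℝ) : ∃ Q₁ Q₂ : QuadraticForm ℝ (Fin 4 → ℝ),
    LinearIndependent ℝ ![Q₁, Q₂] ∧ ∀ k, Q₁ (z k) = 0 ∧ Q₂ (z k) = 0 := by
  let L : (Fin 10 → ℝ) →ₗ[ℝ] QuadraticForm ℝ (Fin 4 → ℝ) :=
    Fintype.linearCombination ℝ monomials
  have hL : Function.Injective L := linearIndependent_monomials.fintypeLinearCombination_injective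
  let ev : (Fin 10 → ℝ) →ₗ[ℝ] (Fin 8 → ℝ) :=
    { toFun := fun c k => L c (z k)
      map_add' := fun c d => by ext k; simp
      map_smul' := fun r c => by ext k; simp }
  have h1 := LinearMap.finrank_range_add_finrank_ker ev
  have h2 := Submodule.finrank_le (LinearMap.range ev)
  simp at h1 h2
  -- Ten coefficients are subject to eight linear conditions.
  have h3 : 1 < Module.finrank ℝ (LinearMap.ker ev) := by omega
  have := Module.nontrivial_of_finrank_pos (R := ℝ) (zero_lt_one.trans h3)
  obtain ⟨x, hx⟩ := exists_ne (0 : LinearMap.ker ev)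
  obtain ⟨y, hxy⟩ := exists_linearIndependent_pair_of_one_lt_finrank h3 hx
  refine ⟨L x, L y, ?_, fun k => ?_⟩
  · have h4 := hxy.map' (L ∘ₗ (LinearMap.ker ev).subtype)
      (LinearMap.ker_eq_bot.2 (hL.comp Subtype.val_injective))
    have e : ![L x, L y] = ⇑(L ∘ₗ (LinearMap.ker ev).subtype) ∘ ![x, y] := by
      funext i
      fin_cases i <;> rfl
    rw [e]
    exact h4
  · exact ⟨congrFun (LinearMap.mem_ker.1 x.2) k, congrFun (LinearMap.mem_ker.1 y.2) k⟩

/-- A plane lies in a pencil of quadrics. -/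
theorem exists_pencil_plane {w : D4} (hw : w ≠ 0) : ∃ Q₁ Q₂ : QuadraticForm ℝ (Fin 4 → ℝ),
    LinearIndependent ℝ ![Q₁, Q₂] ∧ ∀ x, w x = 0 → Q₁ x = 0 ∧ Q₂ x = 0 := by
  let X : Fin 4 → D4 := LinearMap.proj
  -- Products of `w` with two different coordinates are independent forms containing the plane.
  refine ⟨QuadraticMap.linMulLin w (X 0), QuadraticMap.linMulLin w (X 1), ?_,
    fun x hx => by simp [hx]⟩
  rw [LinearIndependent.pair_iff]
  intro s t h
  have key : ∀ x : Fin 4 → ℝ, w x * (s * x 0 + t * x 1) = 0 := by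
    intro x
    have := congrArg (fun Q : QuadraticForm ℝ (Fin 4 → ℝ) => Q x) h
    simp [X] at this
    linarith
  obtain ⟨x₀, hx₀⟩ : ∃ x₀, w x₀ ≠ 0 := by
    by_contra! hc
    exact hw (LinearMap.ext hc)
  have z0 := (mul_eq_zero.1 (key x₀)).resolve_left hx₀
  have z : ∀ x : Fin 4 → ℝ, s * x 0 + t * x 1 = 0 := by
    intro x
    by_cases hx : w x = 0
    · have := (mul_eq_zero.1 (key (x + x₀))).resolve_left (by rw [map_add, hx, zero_add]; exact hx₀)
      simp at this
      linarith
    · exact (mul_eq_zero.1 (key x)).resolve_left hx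
  exact ⟨by simpa using z ![1, 0, 0, 0], by simpa using z ![0, 1, 0, 0]⟩

/-- The points of `I` lie on an intersection of two quadrics. -/
def OnPencil (u : ι → Fin 4 → ℝ) (I : Set ι) : Prop :=
  ∃ Q₁ Q₂ : QuadraticForm ℝ (Fin 4 → ℝ), LinearIndependent ℝ ![Q₁, Q₂] ∧
    ∀ i ∈ I, Q₁ (u i) = 0 ∧ Q₂ (u i) = 0

theorem OnPencil.of_plane {I : Set ι} {w : D4} (hw : w ≠ 0) (h : ∀ i ∈ I, w (u i) = 0) :
    OnPencil u I := by
  obtain ⟨Q₁, Q₂, hli, hQ⟩ := exists_pencil_plane hw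
  exact ⟨Q₁, Q₂, hli, fun i hi => hQ _ (h i hi)⟩

/-! ### Runs of excellent vertices on a line -/

/-- A chart on the pencil of planes through the line `p, q`: the planes other than `f = 0` are
`g - t f = 0` with `t` real, and `f = 0` contains no further points. -/
structure Chart (u : ι → Fin 4 → ℝ) (p q : ι) (f g : D4) : Prop where
  pq : p ≠ q
  fp : f (u p) = 0
  fq : f (u q) = 0
  gp : g (u p) = 0
  gq : g (u q) = 0
  f0 : ∀ i, i ≠ p → i ≠ q → f (u i) ≠ 0
  ind : ∀ t : ℝ, g - t • f ≠ 0

theorem General.exists_chart (hG : General u) {p q : ι} (hpq : p ≠ q) :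
    ∃ f g, Chart u p q f g := by
  obtain ⟨w, l, hl⟩ := hG.exists_off_plane p q q
  have hlp : l ≠ p := by rintro rfl; exact hl.2.2.2 hl.1
  have hlq : l ≠ q := by rintro rfl; exact hl.2.2.2 hl.2.1
  obtain ⟨f₀, fp, fq, fl⟩ := hG.prescribe hpq hlp.symm hlq.symm 0 0 1
  obtain ⟨g, g0, gp, gq, gl⟩ := exists_plane (u := u) p q l
  -- Each further point excludes at most one plane of the pencil, so one plane avoids them all.
  obtain ⟨t, ht⟩ := Infinite.exists_notMem_finset
    (Finset.univ.image fun i => -(f₀ (u i)) / g (u i))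
  refine ⟨f₀ + t • g, g, hpq, by simp [fp, gp], by simp [fq, gq], gp, gq, fun i hip hiq h => ?_,
    fun s h => ?_⟩
  · simp at h
    by_cases hgi : g (u i) = 0
    · rw [hgi, mul_zero, add_zero] at h
      obtain ⟨c, rfl⟩ := hG.proportional hpq hip.symm hiq.symm g0 gp gq hgi fp fq h
      simp [gl] at fl
    · apply ht
      simp only [Finset.mem_image, Finset.mem_univ, true_and]
      exact ⟨i, by field_simp; linarith⟩
  · have := LinearMap.congr_fun h (u l)
    simp [fl, gl] at this
    rw [this] at h
    simp at h
    exact g0 h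

/-- The parameter of the plane through the line and the point `i`. -/
noncomputable def param (u : ι → Fin 4 → ℝ) (f g : D4) (i : ι) : ℝ := g (u i) / f (u i)

section chart
variable {p q : ι} {f g : D4}

theorem Chart.apply (h : Chart u p q f g) {i : ι} (hp : i ≠ p) (hq : i ≠ q) (t : ℝ) :
    (g - t • f) (u i) = f (u i) * (param u f g i - t) := by
  have := h.f0 i hp hq
  simp [param]
  field_simp

theorem Chart.zero_iff (h : Chart u p q f g) (t : ℝ) (i : ι) :
    (g - t • f) (u i) = 0 ↔ i = p ∨ i = q ∨ (i ≠ p ∧ i ≠ q ∧ param u f g i = t) := by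
  by_cases hp : i = p
  · subst hp; simp [h.fp, h.gp]
  by_cases hq : i = q
  · subst hq; simp [h.fq, h.gq]
  rw [h.apply hp hq]
  simp [hp, hq, h.f0 i hp hq, sub_eq_zero]

/-- The planes through the line and another point, by their parameters. -/
noncomputable def params (u : ι → Fin 4 → ℝ) (p q : ι) (f g : D4) : Finset ℝ :=
  ((Finset.univ.erase p).erase q).image (param u f g)

theorem mem_params {t : ℝ} :
    t ∈ params u p q f g ↔ ∃ i, i ≠ p ∧ i ≠ q ∧ param u f g i = t := by
  simp [params, and_assoc, and_left_comm]

/-- One step along a run of excellent vertices. -/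
theorem Chart.step (hG : General u) (h : Chart u p q f g) {t t' : ℝ} (htt : t < t')
    (hno : ∀ s ∈ params u p q f g, s ≤ t ∨ t' ≤ s) (hv : Exc u (g - t • f))
    (hw : Exc u (g - t' • f)) {a b : ι} {P Q A B : Fin 4 → ℝ}
    (F : Frame u (g - t • f) p q a b P Q A B) (fA : f A < 0) :
    ∃ a' b' P' Q' A' B', Frame u (g - t' • f) p q a' b' P' Q' A' B' ∧ f A' < 0 ∧
      ∀ φ : QuadraticForm ℝ (Fin 4 → ℝ), Van u φ (g - t • f) p q a b P Q A B →
        Van u φ (g - t' • f) p q a' b' P' Q' A' B' := by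
  -- No vertex lies strictly between the two parameters, so the midpoint is on the edge joining
  -- them.
  set m := (t + t') / 2 with hm
  have tm : t < m := by rw [hm]; linarith
  have mt : m < t' := by rw [hm]; linarith
  have hne : ∀ i, i ≠ p → i ≠ q → ∀ s, (s = t ∨ s = t') → (g - s • f) (u i) ≠ 0 →
      0 < (g - s • f) (u i) * (g - m • f) (u i) := by
    intro i hip hiq s hs h0
    rw [h.apply hip hiq] at h0 ⊢
    rw [h.apply hip hiq]
    have hf : 0 < f (u i) * f (u i) := mul_self_pos.2 (h.f0 i hip hiq)
    have key : 0 < (param u f g i - s) * (param u f g i - m) := by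
      have h1 : param u f g i - s ≠ 0 := fun h2 => h0 (by rw [h2, mul_zero])
      have h3 := hno _ (mem_params.2 ⟨i, hip, hiq, rfl⟩)
      rcases hs with rfl | rfl
      · rcases h3 with h3 | h3
        · exact mul_pos_of_neg_of_neg (lt_of_le_of_ne (by linarith) h1) (by linarith)
        · exact mul_pos (by linarith) (by linarith)
      · rcases h3 with h3 | h3
        · exact mul_pos_of_neg_of_neg (by linarith) (by linarith)
        · exact mul_pos (lt_of_le_of_ne (by linarith) h1.symm) (by linarith)
    have : f (u i) * (param u f g i - s) * (f (u i) * (param u f g i - m))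
      = (f (u i) * f (u i)) * ((param u f g i - s) * (param u f g i - m)) := by ring
    rw [this]
    exact mul_pos hf key
  have conf : ∀ s, (s = t ∨ s = t') → Conf u (g - s • f) (g - m • f) := by
    intro s hs i hi
    by_cases hip : i = p
    · subst hip; simp [h.fp, h.gp] at hi
    by_cases hiq : i = q
    · subst hiq; simp [h.fq, h.gq] at hi
    exact hne i hip hiq s hs hi
  have shift : ∀ (s s' : ℝ) (z : Fin 4 → ℝ), (g - s' • f) z = (g - s • f) z - (s' - s) * f z := by
    intro s s' z
    simp only [LinearMap.sub_apply, LinearMap.smul_apply, smul_eq_mul]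
    ring
  -- The condition `f A < 0` orients the frame: `A` becomes positive as the parameter grows.
  have eA : 0 < (g - m • f) A := by
    rw [shift t m, (F.ha.zero_iff _).2 F.za]
    nlinarith
  have vz : ∀ s : ℝ, (g - s • f) (u p) = 0 ∧ (g - s • f) (u q) = 0 := fun s => by
    simp [h.fp, h.gp, h.fq, h.gq]
  have wne : ∀ i, i ≠ p → i ≠ q → (g - t • f) (u i) = 0 → (g - t' • f) (u i) ≠ 0 := by
    intro i hip hiq h1 h2
    rw [shift t t', h1] at h2
    have := h.f0 i hip hiq
    simp [this] at h2
    linarith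
  obtain ⟨x, y, X, Y, α, β, E, hα⟩ := F.edge_to hG (conf t (Or.inl rfl))
    ((F.hp.zero_iff _).2 (vz m).1) ((F.hq.zero_iff _).2 (vz m).2) eA (conf t' (Or.inr rfl))
    (h.ind t') (vz t').1 (vz t').2 (wne a F.pa.symm F.qa.symm F.za)
    (wne b F.pb.symm F.qb.symm F.zb) hw.1.1
  have hβ := E.straight hG hv hw.1 hα
  -- The last two walls are exchanged because `Y` is the one negative on the edge just traversed,
  -- hence positive beyond it.
  refine ⟨y, x, _, _, Y, X, E.fw.swap34, ?_, fun φ hφ => E.van hG hβ hv hw hφ⟩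
  have h1 := E.eY
  rw [shift t' m, (E.fw.hb.zero_iff _).2 E.fw.zb] at h1
  nlinarith

theorem Chart.exists_frame (hG : General u) (h : Chart u p q f g) {t : ℝ}
    (hv : Exc u (g - t • f)) :
    ∃ a b P Q A B, Frame u (g - t • f) p q a b P Q A B ∧ f A < 0 := by
  set w := g - t • f with hw
  have wp : w (u p) = 0 := by simp [hw, h.fp, h.gp]
  have wq : w (u q) = 0 := by simp [hw, h.fq, h.gq]
  have hc2 : (((zeros u w).erase p).erase q).card = 2 := by
    rw [Finset.card_erase_of_mem (by simp [h.pq.symm, wq]), Finset.card_erase_of_mem (by simpa),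
      hv.1.1]
  obtain ⟨x, y, hxy, hset⟩ := Finset.card_eq_two.1 hc2
  have hmem : ∀ i, (i ≠ q ∧ i ≠ p ∧ w (u i) = 0) ↔ i = x ∨ i = y := by
    intro i
    have := Finset.ext_iff.1 hset i
    simpa using this
  have hx := (hmem x).2 (by simp)
  have hy := (hmem y).2 (by simp)
  have hz : ∀ i, w (u i) = 0 ↔ i = p ∨ i = q ∨ i = x ∨ i = y := by
    intro i
    rw [← hmem]
    constructor
    · intro hi; tauto
    · rintro (rfl | rfl | hi)
      · exact wp
      · exact wq
      · exact hi.2.2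
  obtain ⟨P, Q, A, B, F⟩ := hG.exists_frame (h.ind t) h.pq hx.2.1.symm hy.2.1.symm hx.1.symm
    hy.1.symm hxy hz
  have hs := F.map_sum f
  rw [(F.hp.zero_iff f).2 h.fp, (F.hq.zero_iff f).2 h.fq] at hs
  have fA : f A ≠ 0 := by
    rw [ne_eq, F.ha.zero_iff]; exact h.f0 x hx.2.1 hx.1
  rcases lt_or_gt_of_ne fA with h1 | h1
  · exact ⟨x, y, P, Q, A, B, F, h1⟩
  · exact ⟨y, x, P, Q, B, A, F.swap34, by linarith⟩

/-- The eight points attached to an excellent vertex lie on a pencil of quadrics. -/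
theorem Frame.exists_van (hG : General u) {v : D4} {a b : ι} {P Q A B : Fin 4 → ℝ}
    (F : Frame u v p q a b P Q A B) (hv : Exc u v) :
    ∃ Q₁ Q₂ : QuadraticForm ℝ (Fin 4 → ℝ), LinearIndependent ℝ ![Q₁, Q₂] ∧
      Van u Q₁ v p q a b P Q A B ∧ Van u Q₂ v p q a b P Q A B := by
  have F₁ : Frame u v q a b p Q A B P := F.swap12.swap23.swap34
  have F₂ : Frame u v p a b q P A B Q := F.swap23.swap34
  obtain ⟨pp, hpp⟩ := F₁.exists_closes hG hv
  obtain ⟨pm, hpm⟩ := F₁.neg.exists_closes hG hv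
  obtain ⟨qm, hqm⟩ := F₂.neg.exists_closes hG hv
  obtain ⟨ap, hap⟩ := F.swap34.exists_closes hG hv
  obtain ⟨Q₁, Q₂, hli, hz⟩ := exists_pencil ![u p, u q, u a, u b, u pp, u pm, u qm, u ap]
  have key : ∀ φ : QuadraticForm ℝ (Fin 4 → ℝ),
      (∀ k, φ (![u p, u q, u a, u b, u pp, u pm, u qm, u ap] k) = 0) →
      Van u φ v p q a b P Q A B := by
    intro φ hφ
    refine ⟨hφ 0, hφ 1, hφ 2, hφ 3, fun c hc => ?_, fun c hc => ?_, fun c hc => ?_, fun c hc => ?_⟩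
    · rw [F₁.closes_unique hG hv.1 hc hpp]; exact hφ 4
    · rw [F₁.closes_unique_neg hG hv.1 hc hpm.of_neg]; exact hφ 5
    · rw [F₂.closes_unique_neg hG hv.1 hc hqm.of_neg]; exact hφ 6
    · rw [F.swap34.closes_unique hG hv.1 hc hap]; exact hφ 7
  exact ⟨Q₁, Q₂, hli, key Q₁ fun k => (hz k).1, key Q₂ fun k => (hz k).2⟩

open Classical in
/-- The parameters of the vertices on the line `p, q` that are not excellent. -/
noncomputable def badParams (u : ι → Fin 4 → ℝ) (p q : ι) (f g : D4) : Finset ℝ :=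
  (params u p q f g).filter fun t => ¬ Exc u (g - t • f)

/-- The number of vertices below `t` that are not excellent. -/
noncomputable def badRank (u : ι → Fin 4 → ℝ) (p q : ι) (f g : D4) (t : ℝ) : ℕ :=
  ((badParams u p q f g).filter (· < t)).card

/-- The points on the vertices of a run lie on an intersection of two quadrics. -/
theorem Chart.onPencil_run (hG : General u) (h : Chart u p q f g) (k : ℕ) :
    OnPencil u {i | i = p ∨ i = q ∨ (i ≠ p ∧ i ≠ q ∧ Exc u (g - param u f g i • f) ∧
      badRank u p q f g (param u f g i) = k)} := by
  classical
  set G := (params u p q f g).filter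
    (fun t => Exc u (g - t • f) ∧ badRank u p q f g t = k) with hGdef
  by_cases hne : G.Nonempty
  · have ht₀ := G.min'_mem hne
    set t₀ := G.min' hne with ht₀def
    have ht₀' := (Finset.mem_filter.1 ht₀).2
    obtain ⟨a, b, P, Q, A, B, F, fA⟩ := h.exists_frame hG ht₀'.1
    obtain ⟨Q₁, Q₂, hli, hQ₁, hQ₂⟩ := F.exists_van hG ht₀'.1
    -- Induction along the vertices of the run, starting from its first vertex `t₀`. The predecessor
    -- `s` of `t` is in the run too: a vertex that is not excellent in between would raise the rank
    -- above `k`.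
    have main : ∀ n : ℕ, ∀ t ∈ G, ((params u p q f g).filter (· < t)).card = n →
        ∃ a b P Q A B, Frame u (g - t • f) p q a b P Q A B ∧ f A < 0 ∧
          Van u Q₁ (g - t • f) p q a b P Q A B ∧ Van u Q₂ (g - t • f) p q a b P Q A B := by
      intro n
      induction n using Nat.strong_induction_on with
      | _ n ih =>
        intro t ht hn
        by_cases h0 : t = t₀
        · rw [h0]
          exact ⟨a, b, P, Q, A, B, F, fA, hQ₁, hQ₂⟩
        have hlt : t₀ < t := lt_of_le_of_ne (G.min'_le t ht) (Ne.symm h0)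
        have hne' : ((params u p q f g).filter (· < t)).Nonempty :=
          ⟨t₀, Finset.mem_filter.2 ⟨(Finset.mem_filter.1 ht₀).1, hlt⟩⟩
        have hs := Finset.max'_mem _ hne'
        have hsmax := fun r hr => Finset.le_max' ((params u p q f g).filter (· < t)) r hr
        set s := ((params u p q f g).filter (· < t)).max' hne'
        obtain ⟨hsp, hst⟩ := Finset.mem_filter.1 hs
        obtain ⟨htp, htE, htk⟩ := Finset.mem_filter.1 ht
        have ht₀s : t₀ ≤ s := hsmax t₀ (Finset.mem_filter.2 ⟨(Finset.mem_filter.1 ht₀).1, hlt⟩)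
        have mono : ∀ {x y : ℝ}, x ≤ y → badRank u p q f g x ≤ badRank u p q f g y := by
          intro x y hxy
          refine Finset.card_le_card fun z hz => ?_
          rw [Finset.mem_filter] at hz ⊢
          exact ⟨hz.1, hz.2.trans_le hxy⟩
        have hsE : Exc u (g - s • f) := by
          by_contra hbad
          have hsb : s ∈ badParams u p q f g := Finset.mem_filter.2 ⟨hsp, hbad⟩
          have : badRank u p q f g s < badRank u p q f g t := by
            refine Finset.card_lt_card ⟨fun z hz => ?_, fun hsub => ?_⟩
            · rw [Finset.mem_filter] at hz ⊢
              exact ⟨hz.1, hz.2.trans hst⟩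
            · have := hsub (Finset.mem_filter.2 ⟨hsb, hst⟩)
              exact lt_irrefl _ (Finset.mem_filter.1 this).2
          have h1 := mono ht₀s
          rw [ht₀'.2] at h1
          omega
        have hsk : badRank u p q f g s = k := by
          have h1 := mono ht₀s
          have h2 := mono hst.le
          rw [ht₀'.2] at h1
          omega
        have hsG : s ∈ G := Finset.mem_filter.2 ⟨hsp, hsE, hsk⟩
        obtain ⟨a, b, P, Q, A, B, F, fA, v1, v2⟩ := ih _ (by
          rw [← hn]
          refine Finset.card_lt_card ⟨fun z hz => ?_, fun hsub => ?_⟩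
          · rw [Finset.mem_filter] at hz ⊢
            exact ⟨hz.1, hz.2.trans hst⟩
          · have := hsub hs
            exact lt_irrefl _ (Finset.mem_filter.1 this).2) s hsG rfl
        obtain ⟨a', b', P', Q', A', B', F', fA', hstep⟩ := h.step hG hst (fun r hr => by
          by_contra! hc
          exact absurd (hsmax r (Finset.mem_filter.2 ⟨hr, hc.2⟩)) (not_le.2 hc.1)) hsE htE F fA
        exact ⟨a', b', P', Q', A', B', F', fA', hstep Q₁ v1, hstep Q₂ v2⟩
    refine ⟨Q₁, Q₂, hli, ?_⟩
    rintro i (rfl | rfl | ⟨hip, hiq, hE, hk⟩)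
    · exact ⟨hQ₁.1, hQ₂.1⟩
    · exact ⟨hQ₁.2.1, hQ₂.2.1⟩
    · obtain ⟨a, b, P, Q, A, B, F, _, v1, v2⟩ := main _ (param u f g i)
        (Finset.mem_filter.2 ⟨mem_params.2 ⟨i, hip, hiq, rfl⟩, hE, hk⟩) rfl
      have hz : (g - param u f g i • f) (u i) = 0 :=
        (h.zero_iff _ i).2 (Or.inr (Or.inr ⟨hip, hiq, rfl⟩))
      rcases (F.zero i).1 hz with rfl | rfl | rfl | rfl
      · exact absurd rfl hip
      · exact absurd rfl hiq
      · exact ⟨v1.2.2.1, v2.2.2.1⟩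
      · exact ⟨v1.2.2.2.1, v2.2.2.2.1⟩
  · obtain ⟨w, hw, hp, hq, -⟩ := exists_plane (u := u) p q q
    refine OnPencil.of_plane hw ?_
    rintro i (rfl | rfl | ⟨hip, hiq, hE, hk⟩)
    · exact hp
    · exact hq
    · exact absurd ⟨param u f g i, Finset.mem_filter.2
        ⟨mem_params.2 ⟨i, hip, hiq, rfl⟩, hE, hk⟩⟩ hne

/-- A line with `B` vertices that are not excellent yields a cover by `2B + 1` intersections of two
quadrics. -/
theorem Chart.exists_coloring (hG : General u) (h : Chart u p q f g) :
    ∃ c : ι → Fin (2 * (badParams u p q f g).card + 1), ∀ k, OnPencil u {i | c i = k} := by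
  classical
  set B := (badParams u p q f g).card with hB
  have rank_le : ∀ t, badRank u p q f g t ≤ B := fun t => Finset.card_filter_le _ _
  have rank_lt : ∀ t ∈ badParams u p q f g, badRank u p q f g t < B := by
    intro t ht
    refine Finset.card_lt_card ⟨Finset.filter_subset _ _, fun hsub => ?_⟩
    exact lt_irrefl _ (Finset.mem_filter.1 (hsub ht)).2
  have rank_inj : ∀ t ∈ badParams u p q f g, ∀ s ∈ badParams u p q f g,
      badRank u p q f g t = badRank u p q f g s → t = s := by
    have : ∀ t ∈ badParams u p q f g, ∀ s ∈ badParams u p q f g, t < s →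
        badRank u p q f g t < badRank u p q f g s := by
      intro t ht s hs hts
      refine Finset.card_lt_card ⟨fun z hz => ?_, fun hsub => ?_⟩
      · rw [Finset.mem_filter] at hz ⊢
        exact ⟨hz.1, hz.2.trans hts⟩
      · exact lt_irrefl _ (Finset.mem_filter.1 (hsub (Finset.mem_filter.2 ⟨ht, hts⟩))).2
    intro t ht s hs heq
    rcases lt_trichotomy t s with h1 | h1 | h1
    · have := this t ht s hs h1; omega
    · exact h1
    · have := this s hs t ht h1; omega
  have hbad : ∀ i, i ≠ p → i ≠ q → ¬ Exc u (g - param u f g i • f) →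
      param u f g i ∈ badParams u p q f g := fun i hip hiq hE =>
    Finset.mem_filter.2 ⟨mem_params.2 ⟨i, hip, hiq, rfl⟩, hE⟩
  -- Even colours are runs, with ranks from `0` to `B`; odd colours are the vertices that are not
  -- excellent, with ranks below `B`. This makes `2B + 1` colours. The points `p, q` may take any
  -- even colour, as they lie on the pencil of every run.
  let c : ι → ℕ := fun i => if i = p ∨ i = q then 0 else
    if Exc u (g - param u f g i • f) then 2 * badRank u p q f g (param u f g i)
    else 2 * badRank u p q f g (param u f g i) + 1
  have hc : ∀ i, c i < 2 * B + 1 := by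
    intro i
    simp only [c]
    split_ifs with h1 h2
    · omega
    · have := rank_le (param u f g i); omega
    · push Not at h1
      have := rank_lt _ (hbad i h1.1 h1.2 h2); omega
  refine ⟨fun i => ⟨c i, hc i⟩, fun k => ?_⟩
  obtain ⟨r, hr | hr⟩ := Nat.even_or_odd' k.1
  · obtain ⟨Q₁, Q₂, hli, hQ⟩ := h.onPencil_run hG r
    refine ⟨Q₁, Q₂, hli, fun i hi => hQ i ?_⟩
    have hi' : c i = k.1 := congrArg Fin.val hi
    simp only [c] at hi'
    split_ifs at hi' with h1 h2
    · rcases h1 with h1 | h1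
      · exact Or.inl h1
      · exact Or.inr (Or.inl h1)
    · push Not at h1
      exact Or.inr (Or.inr ⟨h1.1, h1.2, h2, by omega⟩)
    · omega
  · by_cases hex : ∃ t ∈ badParams u p q f g, badRank u p q f g t = r
    · obtain ⟨t, ht, htr⟩ := hex
      refine OnPencil.of_plane (h.ind t) fun i hi => ?_
      have hi' : c i = k.1 := congrArg Fin.val hi
      simp only [c] at hi'
      split_ifs at hi' with h1 h2
      · omega
      · omega
      · push Not at h1
        exact (h.zero_iff t i).2 (Or.inr (Or.inr ⟨h1.1, h1.2,
          rank_inj _ (hbad i h1.1 h1.2 h2) t ht (by omega)⟩))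
    · obtain ⟨w, hw, -⟩ := exists_plane (u := u) p q q
      refine OnPencil.of_plane hw fun i hi => ?_
      have hi' : c i = k.1 := congrArg Fin.val hi
      simp only [c] at hi'
      split_ifs at hi' with h1 h2
      · omega
      · omega
      · push Not at h1
        exact absurd ⟨_, hbad i h1.1 h1.2 h2, by omega⟩ hex

end chart

/-! ### Counting regions by deletion and restriction -/

theorem sign_eq_of_mul_pos {a b : ℝ} (h : 0 < a * b) : SignType.sign a = SignType.sign b := by
  rcases pos_and_pos_or_neg_and_neg_of_mul_pos h with ⟨ha, hb⟩ | ⟨ha, hb⟩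
  · rw [sign_pos ha, sign_pos hb]
  · rw [sign_neg ha, sign_neg hb]

theorem mul_pos_of_sign_eq {a b : ℝ} (h : SignType.sign a = SignType.sign b) (ha : a ≠ 0) :
    0 < a * b := by
  rcases lt_trichotomy a 0 with h1 | h1 | h1
  · rw [sign_neg h1] at h
    exact mul_pos_of_neg_of_neg h1 (sign_eq_neg_one_iff.1 h.symm)
  · exact absurd h1 ha
  · rw [sign_pos h1] at h
    exact mul_pos h1 (sign_eq_one_iff.1 h.symm)

/-- The signs of `x` on `A`. -/
noncomputable def pattern (u : ι → Fin 4 → ℝ) (A : Finset ι) (x : D4) : ι → SignType :=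
  fun i => if i ∈ A then SignType.sign (x (u i)) else 0

theorem pattern_eq_iff {A : Finset ι} {x y : D4} :
    pattern u A x = pattern u A y ↔ ∀ i ∈ A, SignType.sign (x (u i)) = SignType.sign (y (u i)) := by
  constructor
  · intro h i hi
    have := congrFun h i
    simpa [pattern, hi] using this
  · intro h
    funext i
    by_cases hi : i ∈ A
    · simpa [pattern, hi] using h i hi
    · simp [pattern, hi]

open Classical in
/-- The sign patterns on `A` of functionals that vanish on `Z` and nowhere on `A`. -/
noncomputable def topes (u : ι → Fin 4 → ℝ) (Z A : Finset ι) : Finset (ι → SignType) :=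
  Finset.univ.filter fun σ => ∃ x : D4, (∀ i ∈ Z, x (u i) = 0) ∧ (∀ i ∈ A, x (u i) ≠ 0) ∧
    pattern u A x = σ

theorem mem_topes {Z A : Finset ι} {σ : ι → SignType} : σ ∈ topes u Z A ↔
    ∃ x : D4, (∀ i ∈ Z, x (u i) = 0) ∧ (∀ i ∈ A, x (u i) ≠ 0) ∧ pattern u A x = σ := by
  simp [topes]

open Classical in
/-- The patterns of `topes u Z A` that are realized on a given side of the wall `y`. -/
noncomputable def sideTopes (u : ι → Fin 4 → ℝ) (Z A : Finset ι) (y : ι) (s : SignType) :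
    Finset (ι → SignType) :=
  Finset.univ.filter fun σ => ∃ x : D4, (∀ i ∈ Z, x (u i) = 0) ∧ (∀ i ∈ A, x (u i) ≠ 0) ∧
    SignType.sign (x (u y)) = s ∧ pattern u A x = σ

theorem mem_sideTopes {Z A : Finset ι} {y : ι} {s : SignType} {σ : ι → SignType} :
    σ ∈ sideTopes u Z A y s ↔ ∃ x : D4, (∀ i ∈ Z, x (u i) = 0) ∧ (∀ i ∈ A, x (u i) ≠ 0) ∧
      SignType.sign (x (u y)) = s ∧ pattern u A x = σ := by
  simp [sideTopes]

theorem exists_side {Z A : Finset ι} {y : ι} {x h : D4} (hx : ∀ i ∈ Z, x (u i) = 0)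
    (hA : ∀ i ∈ A, x (u i) ≠ 0) (hh : ∀ i ∈ Z, h (u i) = 0) (xy : x (u y) = 0) :
    ∃ z : D4, (∀ i ∈ Z, z (u i) = 0) ∧ (∀ i ∈ A, z (u i) ≠ 0) ∧ z (u y) = h (u y) ∧
      pattern u A z = pattern u A x := by
  obtain ⟨t, _, ht⟩ := exists_conf (u := u) x h
  refine ⟨t • x + h, fun i hi => by simp [hx i hi, hh i hi], fun i hi h0 => ?_, by simp [xy],
    pattern_eq_iff.2 fun i hi => (sign_eq_of_mul_pos (ht i (hA i hi))).symm⟩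
  have := ht i (hA i hi)
  rw [h0] at this
  simp at this

/-- Deletion and restriction. -/
theorem card_topes_insert {Z A : Finset ι} {y : ι} (hyA : y ∉ A)
    (hy : ∃ h : D4, (∀ i ∈ Z, h (u i) = 0) ∧ h (u y) ≠ 0) :
    (topes u Z (insert y A)).card = (topes u Z A).card + (topes u (insert y Z) A).card := by
  obtain ⟨h, hZ, hy0⟩ := hy
  obtain ⟨h, hZ, hy0⟩ : ∃ h : D4, (∀ i ∈ Z, h (u i) = 0) ∧ 0 < h (u y) := by
    rcases lt_or_gt_of_ne hy0 with h1 | h1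
    · exact ⟨-h, fun i hi => by simp [hZ i hi], by simpa using h1⟩
    · exact ⟨h, hZ, h1⟩
  -- `Rp` and `Rm` are the old regions reaching either side of the new wall. Their union is all old
  -- regions, their intersection the regions cut by the wall, and the new regions are the disjoint
  -- union of a copy of each.
  set Rp := sideTopes u Z A y 1 with hRp
  set Rm := sideTopes u Z A y (-1) with hRm
  have e1 : topes u Z A = Rp ∪ Rm := by
    ext σ
    rw [Finset.mem_union, mem_topes, mem_sideTopes, mem_sideTopes]
    constructor
    · rintro ⟨x, hx, hA, hσ⟩
      rcases lt_trichotomy (x (u y)) 0 with h1 | h1 | h1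
      · exact Or.inr ⟨x, hx, hA, sign_neg h1, hσ⟩
      · obtain ⟨z, z1, z2, z3, z4⟩ := exists_side hx hA hZ h1
        exact Or.inl ⟨z, z1, z2, by rw [z3, sign_pos hy0], z4.trans hσ⟩
      · exact Or.inl ⟨x, hx, hA, sign_pos h1, hσ⟩
    · rintro (⟨x, hx, hA, _, hσ⟩ | ⟨x, hx, hA, _, hσ⟩) <;> exact ⟨x, hx, hA, hσ⟩
  have e2 : topes u (insert y Z) A = Rp ∩ Rm := by
    ext σ
    rw [Finset.mem_inter, mem_topes, mem_sideTopes, mem_sideTopes]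
    constructor
    · rintro ⟨x, hx, hA, hσ⟩
      have hx' : ∀ i ∈ Z, x (u i) = 0 := fun i hi => hx i (Finset.mem_insert_of_mem hi)
      have xy := hx y (Finset.mem_insert_self _ _)
      obtain ⟨z, z1, z2, z3, z4⟩ := exists_side hx' hA hZ xy
      obtain ⟨w, w1, w2, w3, w4⟩ := exists_side (h := -h) hx' hA (fun i hi => by simp [hZ i hi]) xy
      exact ⟨⟨z, z1, z2, by rw [z3, sign_pos hy0], z4.trans hσ⟩,
        ⟨w, w1, w2, by rw [w3, sign_neg (by simpa using hy0)], w4.trans hσ⟩⟩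
    · rintro ⟨⟨x, x1, x2, x3, x4⟩, ⟨z, z1, z2, z3, z4⟩⟩
      have xy := sign_eq_one_iff.1 x3
      have zy := sign_eq_neg_one_iff.1 z3
      -- By convexity the segment between points of one region on opposite sides crosses the wall;
      -- this positive combination is the crossing point.
      have hmul : ∀ i ∈ A, 0 < x (u i) * (-(z (u y)) • x + x (u y) • z) (u i) := by
        intro i hi
        have h1 := pattern_eq_iff.1 (x4.trans z4.symm) i hi
        have h2 := mul_pos_of_sign_eq h1 (x2 i hi)
        have h3 : 0 < x (u i) * x (u i) := mul_self_pos.2 (x2 i hi)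
        simp only [LinearMap.add_apply, LinearMap.smul_apply, smul_eq_mul]
        nlinarith [mul_pos (neg_pos.2 zy) h3, mul_pos xy h2]
      refine ⟨-(z (u y)) • x + x (u y) • z, ?_, fun i hi h0 => ?_, ?_⟩
      · intro i hi
        rcases Finset.mem_insert.1 hi with rfl | hi
        · simp; ring
        · simp [x1 i hi, z1 i hi]
      · have := hmul i hi
        rw [h0] at this
        simp at this
      · rw [← x4]
        exact pattern_eq_iff.2 fun i hi => (sign_eq_of_mul_pos (hmul i hi)).symm
  have e3 : topes u Z (insert y A) = Rp.image (fun σ => Function.update σ y 1) ∪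
      Rm.image (fun σ => Function.update σ y (-1)) := by
    ext σ
    simp only [Finset.mem_union, Finset.mem_image, mem_topes, hRp, hRm, mem_sideTopes]
    have hup : ∀ (x : D4) (s : SignType), SignType.sign (x (u y)) = s →
        Function.update (pattern u A x) y s = pattern u (insert y A) x := by
      intro x s hs
      funext i
      by_cases hi : i = y
      · subst hi; simp [pattern, hs]
      · simp [pattern, hi]
    constructor
    · rintro ⟨x, hx, hA, hσ⟩
      have hA' : ∀ i ∈ A, x (u i) ≠ 0 := fun i hi => hA i (Finset.mem_insert_of_mem hi)
      have hxy := hA y (Finset.mem_insert_self _ _)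
      rcases lt_or_gt_of_ne hxy with h1 | h1
      · exact Or.inr ⟨_, ⟨x, hx, hA', sign_neg h1, rfl⟩, by rw [hup x _ (sign_neg h1), hσ]⟩
      · exact Or.inl ⟨_, ⟨x, hx, hA', sign_pos h1, rfl⟩, by rw [hup x _ (sign_pos h1), hσ]⟩
    · rintro (⟨_, ⟨x, hx, hA, hs, rfl⟩, rfl⟩ | ⟨_, ⟨x, hx, hA, hs, rfl⟩, rfl⟩)
      · refine ⟨x, hx, fun i hi => ?_, (hup x _ hs).symm⟩
        rcases Finset.mem_insert.1 hi with rfl | hi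
        · exact (sign_eq_one_iff.1 hs).ne'
        · exact hA i hi
      · refine ⟨x, hx, fun i hi => ?_, (hup x _ hs).symm⟩
        rcases Finset.mem_insert.1 hi with rfl | hi
        · exact (sign_eq_neg_one_iff.1 hs).ne
        · exact hA i hi
  have zero : ∀ s, ∀ σ ∈ sideTopes u Z A y s, σ y = 0 := by
    intro s σ hσ
    obtain ⟨x, _, _, _, rfl⟩ := mem_sideTopes.1 hσ
    simp [pattern, hyA]
  have inj : ∀ s t, Set.InjOn (fun σ : ι → SignType => Function.update σ y s)
      (sideTopes u Z A y t : Set (ι → SignType)) := by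
    intro s t σ hσ τ hτ heq
    funext i
    by_cases hi : i = y
    · subst hi; rw [zero t σ hσ, zero t τ hτ]
    · have := congrFun heq i
      simpa [hi] using this
  rw [e3, Finset.card_union_of_disjoint, Finset.card_image_of_injOn (inj _ _),
    Finset.card_image_of_injOn (inj _ _), e1, e2, Finset.card_union_add_card_inter]
  rw [Finset.disjoint_left]
  rintro σ h1 h2
  obtain ⟨a, _, rfl⟩ := Finset.mem_image.1 h1
  obtain ⟨b, _, hb⟩ := Finset.mem_image.1 h2
  have := congrFun hb y
  simp at this

theorem card_topes_empty (Z : Finset ι) : (topes u Z ∅).card = 1 := by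
  rw [Finset.card_eq_one]
  refine ⟨fun _ => 0, ?_⟩
  ext σ
  rw [mem_topes, Finset.mem_singleton]
  constructor
  · rintro ⟨x, _, _, rfl⟩
    funext i
    simp [pattern]
  · rintro rfl
    exact ⟨0, fun _ _ => rfl, fun i hi => absurd hi (by simp), by funext i; simp [pattern]⟩

/-- The plane through three points, as a set of indices. -/
noncomputable def planeThrough (u : ι → Fin 4 → ℝ) (i j k : ι) : Finset ι :=
  zeros u (Classical.choose (exists_plane (u := u) i j k))

theorem General.zeros_eq_of_three (hG : General u) {i j k : ι} (hij : i ≠ j) (hik : i ≠ k)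
    (hjk : j ≠ k) {x y : D4} (hx : x ≠ 0) (hy : y ≠ 0) (xi : x (u i) = 0) (xj : x (u j) = 0)
    (xk : x (u k) = 0) (yi : y (u i) = 0) (yj : y (u j) = 0) (yk : y (u k) = 0) :
    zeros u x = zeros u y := by
  ext l
  rw [mem_zeros, mem_zeros]
  exact ⟨hG.zeros_of_three hij hik hjk hx xi xj xk yi yj yk,
    hG.zeros_of_three hij hik hjk hy yi yj yk xi xj xk⟩

theorem General.planeThrough_eq (hG : General u) {i j k : ι} (hij : i ≠ j) (hik : i ≠ k)
    (hjk : j ≠ k) {x : D4} (hx : x ≠ 0) (xi : x (u i) = 0) (xj : x (u j) = 0)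
    (xk : x (u k) = 0) : planeThrough u i j k = zeros u x := by
  obtain ⟨h1, h2, h3, h4⟩ := Classical.choose_spec (exists_plane (u := u) i j k)
  exact hG.zeros_eq_of_three hij hik hjk h1 hx h2 h3 h4 xi xj xk

theorem exists_planeThrough (u : ι → Fin 4 → ℝ) (i j k : ι) : ∃ w : D4, w ≠ 0 ∧
    planeThrough u i j k = zeros u w ∧ w (u i) = 0 ∧ w (u j) = 0 ∧ w (u k) = 0 := by
  obtain ⟨h1, h2, h3, h4⟩ := Classical.choose_spec (exists_plane (u := u) i j k)
  exact ⟨_, h1, rfl, h2, h3, h4⟩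

/-- An arrangement of planes through a common line. -/
theorem General.card_topes_line (hG : General u) {p q : ι} (hpq : p ≠ q) {A : Finset ι}
    (hpA : p ∉ A) (hqA : q ∉ A) (hA : A.Nonempty) :
    (topes u {p, q} A).card = 2 * (A.image (planeThrough u p q)).card := by
  induction A using Finset.induction_on with
  | empty => simp at hA
  | insert i A hi ih =>
    simp only [Finset.mem_insert, not_or] at hpA hqA
    obtain ⟨h, h1, h2, h3⟩ := hG.prescribe hpq hpA.1 hqA.1 0 0 1
    rw [card_topes_insert hi ⟨h, by simp [h1, h2], by rw [h3]; exact one_ne_zero⟩]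
    obtain ⟨w, w0, wz, wp, wq, wi⟩ := exists_planeThrough u p q i
    rcases A.eq_empty_or_nonempty with rfl | hne
    · rw [card_topes_empty, card_topes_empty]; simp
    · rw [ih hpA.2 hqA.2 hne, Finset.image_insert]
      have hiff : ∀ j ∈ A, (w (u j) = 0 ↔ planeThrough u p q j = planeThrough u p q i) := by
        intro j hj
        have hpj : p ≠ j := fun h => hpA.2 (h ▸ hj)
        have hqj : q ≠ j := fun h => hqA.2 (h ▸ hj)
        constructor
        · intro hwj
          rw [wz, hG.planeThrough_eq hpq hpj hqj w0 wp wq hwj]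
        · intro heq
          obtain ⟨w', _, wz', _, _, wj'⟩ := exists_planeThrough u p q j
          have : j ∈ planeThrough u p q i := by rw [← heq, wz', mem_zeros]; exact wj'
          rwa [wz, mem_zeros] at this
      -- A plane already present adds no region, a new one adds two opposite regions.
      by_cases hex : ∃ j ∈ A, w (u j) = 0
      · obtain ⟨j, hj, hwj⟩ := hex
        have hempty : topes u (insert i {p, q}) A = ∅ := by
          rw [Finset.eq_empty_iff_forall_notMem]
          intro σ hσ
          obtain ⟨x, hx, hxA, _⟩ := mem_topes.1 hσ
          obtain ⟨c, rfl⟩ := hG.proportional hpq hpA.1 hqA.1 w0 wp wq wi (hx p (by simp))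
            (hx q (by simp)) (hx i (by simp))
          exact hxA j hj (by simp [hwj])
        rw [hempty, Finset.insert_eq_of_mem (Finset.mem_image.2 ⟨j, hj, (hiff j hj).1 hwj⟩)]
        simp
      · push Not at hex
        have hnot : planeThrough u p q i ∉ A.image (planeThrough u p q) := by
          intro hmem
          obtain ⟨j, hj, heq⟩ := Finset.mem_image.1 hmem
          exact hex j hj ((hiff j hj).2 heq)
        have htwo : topes u (insert i {p, q}) A = {pattern u A w, pattern u A (-w)} := by
          ext σ
          rw [mem_topes, Finset.mem_insert, Finset.mem_singleton]
          constructor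
          · rintro ⟨x, hx, hxA, rfl⟩
            obtain ⟨c, rfl⟩ := hG.proportional hpq hpA.1 hqA.1 w0 wp wq wi (hx p (by simp))
              (hx q (by simp)) (hx i (by simp))
            obtain ⟨j, hj⟩ := hne
            have hc : c ≠ 0 := by rintro rfl; exact hxA j hj (by simp)
            rcases lt_or_gt_of_ne hc with h1 | h1
            · right
              refine pattern_eq_iff.2 fun k hk => sign_eq_of_mul_pos ?_
              have : 0 < w (u k) * w (u k) := mul_self_pos.2 (hex k hk)
              simp; nlinarith
            · left
              refine pattern_eq_iff.2 fun k hk => sign_eq_of_mul_pos ?_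
              have : 0 < w (u k) * w (u k) := mul_self_pos.2 (hex k hk)
              simp; nlinarith
          · rintro (rfl | rfl)
            · exact ⟨w, by simp [wp, wq, wi], hex, rfl⟩
            · exact ⟨-w, by simp [wp, wq, wi], fun j hj => by simpa using hex j hj, rfl⟩
        rw [htwo, Finset.card_insert_of_notMem hnot, Finset.card_pair]
        · ring
        · intro heq
          obtain ⟨j, hj⟩ := hne
          have h1 := mul_pos_of_sign_eq (pattern_eq_iff.1 heq j hj) (hex j hj)
          simp at h1
          nlinarith [mul_self_nonneg (w (u j))]

open Classical in
/-- The planes spanned by the points, as sets of indices. -/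
noncomputable def flats (u : ι → Fin 4 → ℝ) : Finset (Finset ι) :=
  Finset.univ.filter fun Z => 3 ≤ Z.card ∧ ∃ w : D4, w ≠ 0 ∧ zeros u w = Z

theorem mem_flats {Z : Finset ι} :
    Z ∈ flats u ↔ 3 ≤ Z.card ∧ ∃ w : D4, w ≠ 0 ∧ zeros u w = Z := by
  simp [flats]

theorem three_le_card {Z : Finset ι} {i j k : ι} (hij : i ≠ j) (hik : i ≠ k) (hjk : j ≠ k)
    (hi : i ∈ Z) (hj : j ∈ Z) (hk : k ∈ Z) : 3 ≤ Z.card := by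
  have : ({i, j, k} : Finset ι) ⊆ Z := by
    intro l hl
    simp only [Finset.mem_insert, Finset.mem_singleton] at hl
    rcases hl with rfl | rfl | rfl <;> assumption
  have h := Finset.card_le_card this
  rwa [Finset.card_eq_three.2 ⟨i, j, k, hij, hik, hjk, rfl⟩] at h

theorem General.flats_filter_eq (hG : General u) {p q : ι} (hpq : p ≠ q) {A : Finset ι}
    (hpA : p ∉ A) (hqA : q ∉ A) :
    (flats u).filter (fun Z => p ∈ Z ∧ q ∈ Z ∧ (Z ∩ A).Nonempty) =
      A.image (planeThrough u p q) := by
  ext Z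
  rw [Finset.mem_filter, mem_flats, Finset.mem_image]
  constructor
  · rintro ⟨⟨_, w, w0, rfl⟩, hp, hq, ⟨i, hi⟩⟩
    rw [Finset.mem_inter] at hi
    rw [mem_zeros] at hp hq hi
    exact ⟨i, hi.2, hG.planeThrough_eq hpq (fun h => hpA (h ▸ hi.2)) (fun h => hqA (h ▸ hi.2))
      w0 hp hq hi.1⟩
  · rintro ⟨i, hi, rfl⟩
    obtain ⟨w, w0, wz, wp, wq, wi⟩ := exists_planeThrough u p q i
    have hpi : p ≠ i := fun h => hpA (h ▸ hi)
    have hqi : q ≠ i := fun h => hqA (h ▸ hi)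
    rw [wz]
    have mp : p ∈ zeros u w := mem_zeros.2 wp
    have mq : q ∈ zeros u w := mem_zeros.2 wq
    have mi : i ∈ zeros u w := mem_zeros.2 wi
    exact ⟨⟨three_le_card hpq hpi hqi mp mq mi, w, w0, rfl⟩, mp, mq, i, Finset.mem_inter.2 ⟨mi, hi⟩⟩

/-- The number of regions of an arrangement of projective lines. -/
theorem General.card_topes_point (hG : General u) {p : ι} {A : Finset ι} (hpA : p ∉ A)
    (hA : A.Nonempty) : (topes u {p} A).card =
      2 + 2 * ∑ Z ∈ (flats u).filter (fun Z => p ∈ Z), ((Z ∩ A).card - 1) := by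
  induction A using Finset.induction_on with
  | empty => simp at hA
  | insert y A hy ih =>
    simp only [Finset.mem_insert, not_or] at hpA
    obtain ⟨_, l, lp, ly, -, hl⟩ := hG.exists_off_plane p y y
    have hlp : p ≠ l := by rintro rfl; exact hl lp
    have hly : y ≠ l := by rintro rfl; exact hl ly
    obtain ⟨h, h1, h2, h3⟩ := hG.prescribe hpA.1 hlp hly 0 1 0
    rw [card_topes_insert hy ⟨h, by simp [h1], by rw [h2]; exact one_ne_zero⟩,
      show (insert y {p} : Finset ι) = {p, y} from Finset.pair_comm y p]
    rcases A.eq_empty_or_nonempty with rfl | hne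
    · suffices h : ∀ Z : Finset ι, (Z ∩ insert y ∅).card - 1 = 0 by
        rw [card_topes_empty, card_topes_empty, Finset.sum_eq_zero fun Z _ => h Z]
        rfl
      intro Z
      have := Finset.card_le_card (Finset.inter_subset_right : Z ∩ insert y ∅ ⊆ _)
      simp only [insert_empty_eq, Finset.card_singleton] at this ⊢
      omega
    · rw [ih hpA.2 hne, hG.card_topes_line hpA.1 hpA.2 hy hne,
        ← hG.flats_filter_eq hpA.1 hpA.2 hy]
      -- The subtraction is truncated, so a flat gains one exactly if it contains `y` and already
      -- meets `A`. These flats are the vertices on the new line.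
      have hstep : ∀ Z : Finset ι, (Z ∩ insert y A).card - 1 =
          ((Z ∩ A).card - 1) + if y ∈ Z ∧ (Z ∩ A).Nonempty then 1 else 0 := by
        intro Z
        by_cases hyZ : y ∈ Z
        · rw [Finset.inter_insert_of_mem hyZ, Finset.card_insert_of_notMem (by simp [hy])]
          by_cases hn : (Z ∩ A).Nonempty
          · have := hn.card_pos
            rw [if_pos ⟨hyZ, hn⟩]; omega
          · rw [Finset.not_nonempty_iff_eq_empty] at hn
            simp [hn]
        · rw [Finset.inter_insert_of_notMem hyZ]; simp [hyZ]
      simp only [hstep, Finset.sum_add_distrib, Finset.sum_boole]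
      rw [Finset.filter_filter]
      simp only [Nat.cast_id]
      ring

/-! ### Faces, facets and Melchior's inequality -/

/-- The sign vector of a functional. -/
noncomputable def signs (u : ι → Fin 4 → ℝ) (x : D4) : ι → SignType :=
  fun i => SignType.sign (x (u i))

/-- The sign vectors of the faces in the wall `p`. -/
noncomputable def faces (u : ι → Fin 4 → ℝ) (p : ι) : Finset (ι → SignType) :=
  topes u {p} (Finset.univ.erase p)

theorem mem_faces {p : ι} {σ : ι → SignType} :
    σ ∈ faces u p ↔ ∃ x : D4, (∀ i, x (u i) = 0 ↔ i = p) ∧ signs u x = σ := by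
  unfold faces
  rw [mem_topes]
  have key : ∀ x : D4, x (u p) = 0 → pattern u (Finset.univ.erase p) x = signs u x := by
    intro x hx
    funext i
    by_cases hi : i = p
    · subst hi; simp [pattern, signs, hx]
    · simp [pattern, signs, hi]
  constructor
  · rintro ⟨x, h1, h2, rfl⟩
    have hp : x (u p) = 0 := h1 p (by simp)
    refine ⟨x, fun i => ⟨fun h => ?_, fun h => h ▸ hp⟩, (key x hp).symm⟩
    by_contra hi
    exact h2 i (by simp [hi]) h
  · rintro ⟨x, h1, rfl⟩
    have hp : x (u p) = 0 := (h1 p).2 rfl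
    refine ⟨x, by simpa using hp, fun i hi h => ?_, key x hp⟩
    exact (Finset.mem_erase.1 hi).1 ((h1 i).1 h)

/-- The wall `j` is a facet of the cell with sign vector `σ`. -/
def SignFacet (u : ι → Fin 4 → ℝ) (σ : ι → SignType) (j : ι) : Prop :=
  σ j ≠ 0 ∧ ∃ y : D4, y (u j) = 0 ∧ ∀ i, i ≠ j → SignType.sign (y (u i)) = σ i

theorem facet_iff {x : D4} {j : ι} : Facet u x j ↔ SignFacet u (signs u x) j := by
  unfold Facet SignFacet signs
  rw [ne_eq, ne_eq, sign_eq_zero_iff]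
  refine and_congr_right fun _ => exists_congr fun y => and_congr_right fun _ =>
    forall_congr' fun i => forall_congr' fun _ => ?_
  constructor
  · rintro (⟨h1, h2⟩ | h)
    · rw [h1, h2]
    · exact (sign_eq_of_mul_pos h).symm
  · intro h
    by_cases hx : x (u i) = 0
    · rw [hx, sign_zero, sign_eq_zero_iff] at h
      exact Or.inl ⟨hx, h⟩
    · exact Or.inr (mul_pos_of_sign_eq h.symm hx)

open Classical in
/-- The facets of the cell with sign vector `σ`. -/
noncomputable def facets (u : ι → Fin 4 → ℝ) (σ : ι → SignType) : Finset ι :=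
  Finset.univ.filter (SignFacet u σ)

theorem mem_facets {x : D4} {j : ι} : j ∈ facets u (signs u x) ↔ Facet u x j := by
  simp [facets, facet_iff]

theorem tri_iff {x : D4} : Tri u x ↔ (facets u (signs u x)).card = 3 := by
  unfold Tri
  rw [← Set.ncard_coe_finset]
  have : {j | Facet u x j} = (facets u (signs u x) : Set ι) := by
    ext j; simp [mem_facets]
  rw [this]

/-- Leave the face along a functional vanishing at `r, j, k`, with the sign that crosses some wall;
the facet crossed is neither `j` nor `k`. -/
theorem General.exists_facet_ne (hG : General u) {x : D4} {r : ι}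
    (hx : ∀ i, x (u i) = 0 ↔ i = r) (j k : ι) : ∃ l, Facet u x l ∧ l ≠ j ∧ l ≠ k := by
  obtain ⟨g, l, h1, h2, h3, h4⟩ := hG.exists_off_plane r j k
  have hxl : x (u l) ≠ 0 := fun h => h4 (by rw [(hx l).1 h, h1])
  have aux : ∀ g : D4, g (u r) = 0 → g (u j) = 0 → g (u k) = 0 → x (u l) * g (u l) < 0 →
      ∃ l, Facet u x l ∧ l ≠ j ∧ l ≠ k := by
    intro g h1 h2 h3 h
    obtain ⟨m, hm, hneg⟩ := hG.exists_facet hx h1 ⟨l, h⟩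
    refine ⟨m, hm, ?_, ?_⟩ <;> rintro rfl
    · simp [h2] at hneg
    · simp [h3] at hneg
  rcases lt_or_gt_of_ne (mul_ne_zero hxl h4) with h | h
  · exact aux g h1 h2 h3 h
  · exact aux (-g) (by simp [h1]) (by simp [h2]) (by simp [h3]) (by simpa using h)

theorem General.three_le_facets (hG : General u) {p : ι} {σ : ι → SignType}
    (hσ : σ ∈ faces u p) : 3 ≤ (facets u σ).card := by
  obtain ⟨x, hx, rfl⟩ := mem_faces.1 hσ
  obtain ⟨a, ha, _, _⟩ := hG.exists_facet_ne hx p p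
  obtain ⟨b, hb, hba, _⟩ := hG.exists_facet_ne hx a a
  obtain ⟨c, hc, hca, hcb⟩ := hG.exists_facet_ne hx a b
  exact three_le_card hba.symm hca.symm hcb.symm (mem_facets.2 ha) (mem_facets.2 hb)
    (mem_facets.2 hc)

/-- Count by facets. In the wall `p`, the wall `j` cuts out a circle of rays, divided into twice as
many arcs as there are flats through `p` and `j`; each arc bounds at most one face on either side,
whence the factor four. -/
theorem General.sum_facets_le (hG : General u) (p : ι) :
    ∑ σ ∈ faces u p, (facets u σ).card ≤
      4 * ∑ Z ∈ (flats u).filter (fun Z => p ∈ Z), (Z.card - 1) := by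
  classical
  have h1 : ∑ σ ∈ faces u p, (facets u σ).card =
      ∑ j ∈ Finset.univ, ((faces u p).filter fun σ => SignFacet u σ j).card :=
    Finset.sum_card_bipartiteAbove_eq_sum_card_bipartiteBelow (SignFacet u)
  have h2 : ∀ j ∈ Finset.univ, ((faces u p).filter fun σ => SignFacet u σ j).card ≤
      4 * ((flats u).filter fun Z => p ∈ Z ∧ j ∈ Z ∧ j ≠ p).card := by
    intro j _
    by_cases hj : j = p
    · subst hj
      rw [Finset.card_eq_zero.2]
      · exact Nat.zero_le _
      · rw [Finset.filter_eq_empty_iff]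
        rintro σ hσ ⟨h, _⟩
        obtain ⟨x, hx, rfl⟩ := mem_faces.1 hσ
        exact h (by simp [signs, (hx j).2 rfl])
    · set A := (Finset.univ.erase p).erase j with hA
      have hne : A.Nonempty := by
        obtain ⟨w, l, hp, hj', _, hl⟩ := hG.exists_off_plane p j j
        refine ⟨l, ?_⟩
        simp only [hA, Finset.mem_erase, Finset.mem_univ, and_true]
        constructor <;> rintro rfl <;> contradiction
      have h3 := hG.card_topes_line (Ne.symm hj) (A := A) (by simp [hA]) (by simp [hA]) hne
      rw [← hG.flats_filter_eq (Ne.symm hj) (by simp [hA]) (by simp [hA])] at h3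
      have h4 : ((faces u p).filter fun σ => SignFacet u σ j).card ≤
          (topes u {p, j} A ×ˢ ({1, -1} : Finset SignType)).card := by
        -- A face is recovered from its arc on `j` and its side of `j`.
        refine Finset.card_le_card_of_injOn (fun σ => (Function.update σ j 0, σ j)) ?_ ?_
        · intro σ hσ
          obtain ⟨hσ, hs, y, yj, hy⟩ := Finset.mem_filter.1 hσ
          obtain ⟨x, hx, rfl⟩ := mem_faces.1 hσ
          rw [Finset.mem_coe, Finset.mem_product]
          constructor
          · rw [mem_topes]
            have yp : y (u p) = 0 := by
              have := hy p (Ne.symm hj)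
              rwa [signs, (hx p).2 rfl, sign_zero, sign_eq_zero_iff] at this
            refine ⟨y, by simp [yj, yp], ?_, ?_⟩
            · intro i hi h0
              simp only [hA, Finset.mem_erase, Finset.mem_univ, and_true] at hi
              have := hy i hi.1
              rw [h0, sign_zero, signs, eq_comm, sign_eq_zero_iff] at this
              exact hi.2 ((hx i).1 this)
            · funext i
              by_cases hij : i = j
              · subst hij; simp [pattern, hA]
              · by_cases hip : i = p
                · subst hip; simp [pattern, hA, hij, signs, (hx i).2 rfl]
                · simp [pattern, hA, hij, hip, hy i hij]
          · simp only [Finset.mem_insert, Finset.mem_singleton]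
            revert hs
            generalize signs u x j = s
            cases s <;> decide
        · intro σ _ τ _ h
          rw [Prod.mk.injEq] at h
          funext i
          by_cases hij : i = j
          · rw [hij]; exact h.2
          · simpa [hij] using congrFun h.1 i
      rw [Finset.card_product, h3, Finset.card_pair (by decide)] at h4
      refine h4.trans ?_
      have h5 : ((flats u).filter fun Z => p ∈ Z ∧ j ∈ Z ∧ (Z ∩ A).Nonempty).card ≤
          ((flats u).filter fun Z => p ∈ Z ∧ j ∈ Z ∧ j ≠ p).card :=
        Finset.card_le_card fun Z hZ => by
          rw [Finset.mem_filter] at hZ ⊢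
          exact ⟨hZ.1, hZ.2.1, hZ.2.2.1, hj⟩
      omega
  rw [h1]
  refine (Finset.sum_le_sum h2).trans_eq ?_
  rw [← Finset.mul_sum]
  congr 1
  have h6 := Finset.sum_card_bipartiteAbove_eq_sum_card_bipartiteBelow
    (s := (Finset.univ : Finset ι)) (t := (flats u).filter fun Z => p ∈ Z)
    (fun j Z => j ∈ Z ∧ j ≠ p)
  simp only [Finset.bipartiteAbove, Finset.bipartiteBelow, Finset.filter_filter] at h6
  rw [h6]
  refine Finset.sum_congr rfl fun Z hZ => ?_
  have hp : p ∈ Z := (Finset.mem_filter.1 hZ).2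
  rw [← Finset.card_erase_of_mem hp]
  congr 1
  ext i
  simp [and_comm]

/-- Melchior's inequality in the wall `p`. -/
theorem General.melchior_point (hG : General u) (p : ι) :
    ∑ σ ∈ faces u p, (((facets u σ).card : ℤ) - 3) ≤
      ∑ Z ∈ (flats u).filter (fun Z => p ∈ Z), (8 - 2 * (Z.card : ℤ)) := by
  obtain ⟨w, l, hp, _, _, hl⟩ := hG.exists_off_plane p p p
  have h1 := hG.card_topes_point (p := p) (A := Finset.univ.erase p) (by simp)
    ⟨l, by simp; rintro rfl; exact hl hp⟩
  have h2 := hG.sum_facets_le p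
  have e1 : ∀ Z ∈ (flats u).filter (fun Z => p ∈ Z),
      (((Z ∩ Finset.univ.erase p).card - 1 : ℕ) : ℤ) = (Z.card : ℤ) - 2 := by
    intro Z hZ
    obtain ⟨hZ, hpZ⟩ := Finset.mem_filter.1 hZ
    have := (mem_flats.1 hZ).1
    rw [Finset.inter_erase, Finset.inter_univ, Finset.card_erase_of_mem hpZ]
    omega
  have e2 : ∀ Z ∈ (flats u).filter (fun Z => p ∈ Z),
      ((Z.card - 1 : ℕ) : ℤ) = (Z.card : ℤ) - 1 := by
    intro Z hZ
    have := (mem_flats.1 (Finset.mem_filter.1 hZ).1).1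
    omega
  change (faces u p).card = _ at h1
  zify at h1 h2
  rw [Finset.sum_congr rfl e1] at h1
  rw [Finset.sum_congr rfl e2] at h2
  -- For a flat with `k` points, `4 (k - 1) - 6 (k - 2) = 8 - 2k`; the constant `-6` from the region
  -- count is dropped.
  simp only [Finset.sum_sub_distrib, Finset.sum_const, nsmul_eq_mul, ← Finset.mul_sum] at h1 h2 ⊢
  linarith

/-- Total excess of the faces over triangles. -/
noncomputable def excess (u : ι → Fin 4 → ℝ) : ℤ :=
  ∑ p, ∑ σ ∈ faces u p, (((facets u σ).card : ℤ) - 3)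

/-- A flat with `k` points is a vertex in each of its `k` walls. It contributes `6` for `k = 3`,
nothing for `k = 4`, and a negative amount otherwise. -/
theorem General.excess_le (hG : General u) :
    excess u ≤ ∑ Z ∈ flats u, (Z.card : ℤ) * (8 - 2 * (Z.card : ℤ)) := by
  refine (Finset.sum_le_sum fun p _ => hG.melchior_point p).trans_eq ?_
  simp only [Finset.sum_filter]
  rw [Finset.sum_comm]
  refine Finset.sum_congr rfl fun Z _ => ?_
  rw [Finset.sum_ite_mem, Finset.univ_inter, Finset.sum_const, nsmul_eq_mul]

/-! ### Ends of edges and vertices of faces -/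

theorem Conf.neg {v x : D4} (h : Conf u v x) : Conf u (-v) (-x) := fun i hi => by
  have := h i (by simpa using hi)
  simpa using this

theorem Conf.zero {v x : D4} (h : Conf u v x) {i : ι} (hx : x (u i) = 0) : v (u i) = 0 := by
  by_contra hv
  exact h.ne hv hx

/-- `Z` is a vertex of the cell with sign vector `σ`. -/
def Incid (u : ι → Fin 4 → ℝ) (σ : ι → SignType) (Z : Finset ι) : Prop :=
  ∃ w : D4, w ≠ 0 ∧ zeros u w = Z ∧ ∀ i, w (u i) ≠ 0 → SignType.sign (w (u i)) = σ i

theorem incid_iff {x : D4} {Z : Finset ι} :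
    Incid u (signs u x) Z ↔ ∃ w : D4, w ≠ 0 ∧ zeros u w = Z ∧ Conf u w x := by
  refine exists_congr fun w => and_congr_right fun _ => and_congr_right fun _ =>
    forall_congr' fun i => forall_congr' fun hi => ?_
  exact ⟨fun h => mul_pos_of_sign_eq h hi, fun h => sign_eq_of_mul_pos h⟩

theorem exists_third {Z : Finset ι} (h : 3 ≤ Z.card) (p q : ι) : ∃ k ∈ Z, k ≠ p ∧ k ≠ q := by
  by_contra! hc
  have : Z ⊆ {p, q} := fun k hk => by
    by_cases hkp : k = p
    · simp [hkp]
    · simp [hc k hk hkp]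
  have := (Finset.card_le_card this).trans Finset.card_le_two
  omega

theorem zeros_smul {x : D4} {c : ℝ} (hc : c ≠ 0) : zeros u (c • x) = zeros u x := by
  ext i; simp [hc]

section edge
variable {e w₀ w₁ w₂ : D4} {p q : ι}

/-- The functionals vanishing at `p` and `q` form a space with basis `w₀, e`. The coefficient of `e`
is read off at a third wall through `w₀`, where `w₁` and `e` have the same sign. -/
theorem General.edge_decomp (hG : General u) (hpq : p ≠ q) (he : zeros u e = {p, q})
    (h₀ : w₀ ≠ 0) (c₀ : 3 ≤ (zeros u w₀).card) (d₀ : Conf u w₀ e) (h₁ : w₁ ≠ 0)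
    (d₁ : Conf u w₁ e) (n₁ : zeros u w₁ ≠ zeros u w₀) :
    ∃ α β : ℝ, 0 < β ∧ w₁ = α • w₀ + β • e := by
  have ep : e (u p) = 0 := mem_zeros.1 (he ▸ by simp)
  have eq : e (u q) = 0 := mem_zeros.1 (he ▸ by simp)
  obtain ⟨k, hk, hkp, hkq⟩ := exists_third c₀ p q
  rw [mem_zeros] at hk
  have ek : e (u k) ≠ 0 := fun h => by
    have : k ∈ zeros u e := mem_zeros.2 h
    simp [he, hkp, hkq] at this
  have wk : w₁ (u k) ≠ 0 := fun h => n₁ (hG.zeros_eq_of_three hpq hkp.symm hkq.symm h₁ h₀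
    (d₁.zero ep) (d₁.zero eq) h (d₀.zero ep) (d₀.zero eq) hk)
  obtain ⟨α, hα⟩ := hG.proportional (y := w₁ - (w₁ (u k) / e (u k)) • e) hpq hkp.symm hkq.symm h₀
    (d₀.zero ep) (d₀.zero eq) hk (by simp [d₁.zero ep, ep]) (by simp [d₁.zero eq, eq])
    (by simp [ek])
  refine ⟨α, w₁ (u k) / e (u k), ?_, by rw [← hα]; abel⟩
  have := d₁ k wk
  rw [show w₁ (u k) / e (u k) = w₁ (u k) * e (u k) / (e (u k)) ^ 2 by field_simp]
  positivity

/-- The determinant tells on which side of `w₁` the point `w₂` lies. Its sign is read off at a third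
wall through `w₁`, which `w₂` cannot have crossed. Applied both ways, this makes two ends other than
`w₀` proportional. -/
theorem General.edge_compare (hG : General u) (hpq : p ≠ q) (he : zeros u e = {p, q})
    (h₀ : w₀ ≠ 0) (d₀ : Conf u w₀ e) (h₁ : w₁ ≠ 0) (c₁ : 3 ≤ (zeros u w₁).card)
    (d₁ : Conf u w₁ e) (n₁ : zeros u w₁ ≠ zeros u w₀) (d₂ : Conf u w₂ e)
    {α₁ β₁ α₂ β₂ : ℝ} (hβ : 0 < β₁) (e₁ : w₁ = α₁ • w₀ + β₁ • e) (e₂ : w₂ = α₂ • w₀ + β₂ • e) :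
    0 ≤ β₁ * α₂ - β₂ * α₁ := by
  have ep : e (u p) = 0 := mem_zeros.1 (he ▸ by simp)
  have eq : e (u q) = 0 := mem_zeros.1 (he ▸ by simp)
  obtain ⟨l, hl, hlp, hlq⟩ := exists_third c₁ p q
  rw [mem_zeros] at hl
  have w0l : w₀ (u l) ≠ 0 := fun h => n₁ (hG.zeros_eq_of_three hpq hlp.symm hlq.symm h₁ h₀
    (d₁.zero ep) (d₁.zero eq) hl (d₀.zero ep) (d₀.zero eq) h)
  have h1 := d₀ l w0l
  have h2 : 0 ≤ w₂ (u l) * e (u l) := by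
    by_cases h : w₂ (u l) = 0
    · simp [h]
    · exact (d₂ l h).le
  rw [e₁] at hl
  rw [e₂] at h2
  simp only [LinearMap.add_apply, LinearMap.smul_apply, smul_eq_mul] at hl h2
  have h3 : 0 ≤ (β₁ * α₂ - β₂ * α₁) * (w₀ (u l) * e (u l)) := by
    have : (β₁ * α₂ - β₂ * α₁) * (w₀ (u l) * e (u l)) =
        β₁ * ((α₂ * w₀ (u l) + β₂ * e (u l)) * e (u l)) -
          β₂ * e (u l) * (α₁ * w₀ (u l) + β₁ * e (u l)) := by ring
    rw [this, hl, mul_zero, sub_zero]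
    exact mul_nonneg hβ.le h2
  exact nonneg_of_mul_nonneg_left h3 h1

/-- An edge has at most two ends. -/
theorem General.edge_end_unique (hG : General u) (hpq : p ≠ q) (he : zeros u e = {p, q})
    (h₀ : w₀ ≠ 0) (c₀ : 3 ≤ (zeros u w₀).card) (d₀ : Conf u w₀ e)
    (h₁ : w₁ ≠ 0) (c₁ : 3 ≤ (zeros u w₁).card) (d₁ : Conf u w₁ e)
    (h₂ : w₂ ≠ 0) (c₂ : 3 ≤ (zeros u w₂).card) (d₂ : Conf u w₂ e)
    (n₁ : zeros u w₁ ≠ zeros u w₀) (n₂ : zeros u w₂ ≠ zeros u w₀) :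
    zeros u w₁ = zeros u w₂ := by
  obtain ⟨α₁, β₁, hβ₁, e₁⟩ := hG.edge_decomp hpq he h₀ c₀ d₀ h₁ d₁ n₁
  obtain ⟨α₂, β₂, hβ₂, e₂⟩ := hG.edge_decomp hpq he h₀ c₀ d₀ h₂ d₂ n₂
  have i1 := hG.edge_compare hpq he h₀ d₀ h₁ c₁ d₁ n₁ d₂ hβ₁ e₁ e₂
  have i2 := hG.edge_compare hpq he h₀ d₀ h₂ c₂ d₂ n₂ d₁ hβ₂ e₂ e₁
  have h : β₁ • w₂ = β₂ • w₁ := by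
    rw [e₁, e₂, smul_add, smul_add, smul_smul, smul_smul, smul_smul, smul_smul, mul_comm β₂ β₁,
      show β₁ * α₂ = β₂ * α₁ by linarith]
  rw [← zeros_smul hβ₁.ne' (x := w₂), h, zeros_smul hβ₂.ne']

/-- Two functionals on one line and on the same side of `w₀` belong to one edge: a combination of
them is a multiple of `w₀`, so their signs agree where `w₀` vanishes, and elsewhere both follow
`w₀`. -/
theorem General.edge_end_unique' (hG : General u) {e₁ e₂ : D4} {k : ι} (hpq : p ≠ q)
    (he₁ : zeros u e₁ = {p, q}) (he₂ : zeros u e₂ = {p, q})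
    (h₀ : w₀ ≠ 0) (c₀ : 3 ≤ (zeros u w₀).card) (d₀ : Conf u w₀ e₁) (d₀' : Conf u w₀ e₂)
    (hk : w₀ (u k) = 0) (hee : 0 < e₁ (u k) * e₂ (u k))
    (h₁ : w₁ ≠ 0) (c₁ : 3 ≤ (zeros u w₁).card) (d₁ : Conf u w₁ e₁)
    (h₂ : w₂ ≠ 0) (c₂ : 3 ≤ (zeros u w₂).card) (d₂ : Conf u w₂ e₂)
    (n₁ : zeros u w₁ ≠ zeros u w₀) (n₂ : zeros u w₂ ≠ zeros u w₀) :
    zeros u w₁ = zeros u w₂ := by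
  refine hG.edge_end_unique hpq he₁ h₀ c₀ d₀ h₁ c₁ d₁ h₂ c₂ (fun i hi => ?_) n₁ n₂
  have ep : e₁ (u p) = 0 := mem_zeros.1 (he₁ ▸ by simp)
  have eq : e₁ (u q) = 0 := mem_zeros.1 (he₁ ▸ by simp)
  have ep' : e₂ (u p) = 0 := mem_zeros.1 (he₂ ▸ by simp)
  have eq' : e₂ (u q) = 0 := mem_zeros.1 (he₂ ▸ by simp)
  have hkp : p ≠ k := by rintro rfl; simp [ep] at hee
  have hkq : q ≠ k := by rintro rfl; simp [eq] at hee
  have h2k : e₂ (u k) ≠ 0 := by intro h; simp [h] at hee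
  refine mul_pos_trans (d₂ i hi) ?_
  by_cases hwi : w₀ (u i) = 0
  · obtain ⟨α, hα⟩ := hG.proportional (y := e₂ (u k) • e₁ - e₁ (u k) • e₂) hpq hkp hkq h₀
      (d₀.zero ep) (d₀.zero eq) hk (by simp [ep, ep']) (by simp [eq, eq'])
      (by simp; ring)
    have h3 := LinearMap.congr_fun hα (u i)
    simp only [LinearMap.sub_apply, LinearMap.smul_apply, smul_eq_mul, hwi, mul_zero,
      sub_eq_zero] at h3
    have h4 : e₂ (u i) ≠ 0 := d₂.ne hi
    have h5 : 0 < e₂ (u k) ^ 2 * (e₂ (u i) * e₁ (u i)) := by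
      have : e₂ (u k) ^ 2 * (e₂ (u i) * e₁ (u i)) =
          (e₁ (u k) * e₂ (u k)) * e₂ (u i) ^ 2 := by linear_combination e₂ (u k) * e₂ (u i) * h3
      rw [this]; positivity
    exact pos_of_mul_pos_right h5 (by positivity)
  · exact mul_pos_trans (mul_pos_symm (d₀' i hwi)) (d₀ i hwi)

end edge

/-- A vertex on exactly four walls lies on two facets of each face around it. -/
theorem General.two_le_facets_at (hG : General u) {x w : D4} {p : ι}
    (hx : ∀ i, x (u i) = 0 ↔ i = p) (hw : w ≠ 0) (h4 : (zeros u w).card = 4)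
    (hc : Conf u w x) : ∃ j k, j ≠ k ∧ j ∈ zeros u w ∧ k ∈ zeros u w ∧ Facet u x j ∧
      Facet u x k := by
  have hp : p ∈ zeros u w := mem_zeros.2 (hc.zero ((hx p).2 rfl))
  obtain ⟨q, a, b, hqa, hqb, hab, hZ⟩ := Finset.card_eq_three.1
    (show ((zeros u w).erase p).card = 3 by rw [Finset.card_erase_of_mem hp, h4])
  have hmem : ∀ i, (i ≠ p ∧ w (u i) = 0) ↔ i = q ∨ i = a ∨ i = b := by
    intro i
    have := Finset.ext_iff.1 hZ i
    simpa using this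
  have hq := (hmem q).2 (by simp)
  have ha := (hmem a).2 (by simp)
  have hb := (hmem b).2 (by simp)
  have hz : ∀ i, w (u i) = 0 ↔ i = p ∨ i = q ∨ i = a ∨ i = b := by
    intro i
    by_cases hi : i = p
    · subst hi; simpa using mem_zeros.1 hp
    · simpa [hi] using hmem i
  obtain ⟨P, Q, A, B, F⟩ := hG.exists_frame hw hq.1.symm ha.1.symm hb.1.symm hqa hqb hab hz
  have key : ∀ {q a b : ι} {P Q A B : Fin 4 → ℝ}, Frame u w p q a b P Q A B →
      0 < x Q * x A → ∃ j k, j ≠ k ∧ j ∈ zeros u w ∧ k ∈ zeros u w ∧ Facet u x j ∧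
      Facet u x k := by
    intro q a b P Q A B F hQA
    have hP : x P = 0 := (F.hp.zero_iff x).2 ((hx p).2 rfl)
    refine ⟨q, a, F.qa, mem_zeros.2 F.zq, mem_zeros.2 F.za, ?_⟩
    rcases pos_and_pos_or_neg_and_neg_of_mul_pos hQA with ⟨h1, h2⟩ | ⟨h1, h2⟩
    · exact ⟨F.facet hG hc hP h1 h2, F.facet' hG hc hP h1 h2⟩
    · have h1' : 0 < x (-Q) := by simpa using h1
      have h2' : 0 < x (-A) := by simpa using h2
      have hP' : x (-P) = 0 := by simp [hP]
      exact ⟨F.neg.facet hG hc hP' h1' h2', F.neg.facet' hG hc hP' h1' h2'⟩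
  have nQ : x Q ≠ 0 := fun h => hq.1 ((hx q).1 ((F.hq.zero_iff x).1 h))
  have nA : x A ≠ 0 := fun h => ha.1 ((hx a).1 ((F.ha.zero_iff x).1 h))
  have nB : x B ≠ 0 := fun h => hb.1 ((hx b).1 ((F.hb.zero_iff x).1 h))
  -- Of the three nonzero values at `x`, two have the same sign; these belong to the two facets.
  rcases lt_or_gt_of_ne (mul_ne_zero nQ nA) with h1 | h1
  · rcases lt_or_gt_of_ne (mul_ne_zero nQ nB) with h2 | h2
    · refine key F.swap23.swap34 (Q := A) (A := B) ?_
      by_contra h3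
      rcases lt_or_gt_of_ne nQ with h | h
      · have hA := pos_of_mul_neg_right h1 h.le
        have hB := pos_of_mul_neg_right h2 h.le
        exact h3 (mul_pos hA hB)
      · have hA := neg_of_mul_neg_right h1 h.le
        have hB := neg_of_mul_neg_right h2 h.le
        exact h3 (mul_pos_of_neg_of_neg hA hB)
    · exact key F.swap34 h2
  · exact key F h1

open Classical in
/-- A face has at most as many vertices on exactly four walls as it has facets. -/
theorem General.card_incid_le (hG : General u) {p : ι} {σ : ι → SignType} (hσ : σ ∈ faces u p) :
    ((flats u).filter fun Z => Z.card = 4 ∧ Incid u σ Z).card ≤ (facets u σ).card := by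
  obtain ⟨x, hx, rfl⟩ := mem_faces.1 hσ
  -- Each vertex counted is on at least two facets, and each facet is an edge with at most two ends.
  have h := Finset.card_mul_le_card_mul (fun (Z : Finset ι) (j : ι) => j ∈ Z) (m := 2) (n := 2)
    (s := (flats u).filter fun Z => Z.card = 4 ∧ Incid u (signs u x) Z)
    (t := facets u (signs u x)) ?_ ?_
  · omega
  · intro Z hZ
    obtain ⟨_, h4, hI⟩ := Finset.mem_filter.1 hZ
    obtain ⟨w, hw, rfl, hc⟩ := incid_iff.1 hI
    obtain ⟨j, k, hjk, hj, hk, fj, fk⟩ := hG.two_le_facets_at hx hw h4 hc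
    rw [← Finset.card_pair hjk]
    refine Finset.card_le_card fun l hl => ?_
    rw [Finset.mem_bipartiteAbove]
    rcases Finset.mem_insert.1 hl with rfl | hl
    · exact ⟨mem_facets.2 fj, hj⟩
    · rw [Finset.mem_singleton.1 hl]
      exact ⟨mem_facets.2 fk, hk⟩
  · intro j hj
    obtain ⟨xj, y, yj, hy⟩ := mem_facets.1 hj
    have hpj : p ≠ j := by rintro rfl; exact xj ((hx p).2 rfl)
    have hyz : zeros u y = {p, j} := by
      ext i
      rw [mem_zeros, Finset.mem_insert, Finset.mem_singleton]
      by_cases hi : i = j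
      · simp [hi, yj]
      · rcases hy i hi with ⟨h1, h2⟩ | h
        · simp [h2, ← (hx i).1 h1]
        · have h1 : y (u i) ≠ 0 := by intro h0; simp [h0] at h
          have h2 : i ≠ p := by intro h0; simp [(hx i).2 h0] at h
          simp [h1, h2, hi]
    by_contra hlt
    push Not at hlt
    obtain ⟨Z₀, m₀, Z₁, m₁, Z₂, m₂, n₀₁, n₀₂, n₁₂⟩ := Finset.two_lt_card.1 hlt
    have get : ∀ Z ∈ ((flats u).filter fun Z => Z.card = 4 ∧ Incid u (signs u x) Z).bipartiteBelow
        (fun (Z : Finset ι) (j : ι) => j ∈ Z) j,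
        ∃ w : D4, w ≠ 0 ∧ zeros u w = Z ∧ 3 ≤ (zeros u w).card ∧ Conf u w y := by
      intro Z hZ
      rw [Finset.mem_bipartiteBelow, Finset.mem_filter] at hZ
      obtain ⟨⟨_, h4, hI⟩, hjZ⟩ := hZ
      obtain ⟨w, hw, rfl, hc⟩ := incid_iff.1 hI
      refine ⟨w, hw, rfl, by omega, fun i hi => ?_⟩
      have hij : i ≠ j := by rintro rfl; exact hi (mem_zeros.1 hjZ)
      rcases hy i hij with ⟨h1, _⟩ | h
      · exact absurd (hc.zero h1) hi
      · exact mul_pos_trans (hc i hi) h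
    obtain ⟨w₀, a₀, rfl, b₀, c₀⟩ := get Z₀ m₀
    obtain ⟨w₁, a₁, rfl, b₁, c₁⟩ := get Z₁ m₁
    obtain ⟨w₂, a₂, rfl, b₂, c₂⟩ := get Z₂ m₂
    exact n₁₂ (hG.edge_end_unique hpj hyz a₀ b₀ c₀ a₁ b₁ c₁ a₂ b₂ c₂ n₀₁.symm n₀₂.symm)

/-! ### Counting the vertices that are not excellent -/

open Classical in
/-- The vertices on exactly four walls that are on a face which is not a triangle. -/
noncomputable def skewFlats (u : ι → Fin 4 → ℝ) : Finset (Finset ι) :=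
  (flats u).filter fun Z => Z.card = 4 ∧ ∃ w : D4, w ≠ 0 ∧ zeros u w = Z ∧ ¬ GoodV u w

/-- The vertices not on exactly four walls. -/
noncomputable def oddFlats (u : ι → Fin 4 → ℝ) : Finset (Finset ι) :=
  (flats u).filter fun Z => Z.card ≠ 4

open Classical in
/-- The vertices that are not excellent. -/
noncomputable def badFlats (u : ι → Fin 4 → ℝ) : Finset (Finset ι) :=
  (flats u).filter fun Z => ∃ w : D4, w ≠ 0 ∧ zeros u w = Z ∧ ¬ Exc u w

/-- Two vertices joined by an edge. -/
def Joined (u : ι → Fin 4 → ℝ) (Z Z' : Finset ι) : Prop :=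
  ∃ e w w' : D4, (zeros u e).card = 2 ∧ w ≠ 0 ∧ w' ≠ 0 ∧ zeros u w = Z ∧ zeros u w' = Z' ∧
    Conf u w e ∧ Conf u w' e

theorem faces_disjoint : ((Finset.univ : Finset ι) : Set ι).PairwiseDisjoint (faces u) := by
  intro p _ q _ hpq
  refine Finset.disjoint_left.2 fun σ hp hq => hpq ?_
  obtain ⟨x, hx, rfl⟩ := mem_faces.1 hp
  obtain ⟨y, hy, hxy⟩ := mem_faces.1 hq
  have h := congrFun hxy p
  simp only [signs, (hx p).2 rfl, sign_zero, sign_eq_zero_iff] at h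
  exact (hy p).1 h

/-- The sign vectors of all faces. -/
noncomputable def allFaces (u : ι → Fin 4 → ℝ) : Finset (ι → SignType) :=
  Finset.univ.biUnion (faces u)

theorem excess_eq : excess u = ∑ σ ∈ allFaces u, (((facets u σ).card : ℤ) - 3) :=
  (Finset.sum_biUnion faces_disjoint).symm

theorem mem_allFaces {σ : ι → SignType} :
    σ ∈ allFaces u ↔ ∃ x : D4, (zeros u x).card = 1 ∧ signs u x = σ := by
  unfold allFaces
  simp only [Finset.mem_biUnion, Finset.mem_univ, true_and, mem_faces]
  constructor
  · rintro ⟨p, x, hx, rfl⟩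
    refine ⟨x, Finset.card_eq_one.2 ⟨p, ?_⟩, rfl⟩
    ext i
    simp [hx]
  · rintro ⟨x, h, rfl⟩
    obtain ⟨p, hp⟩ := Finset.card_eq_one.1 h
    refine ⟨p, x, fun i => ?_, rfl⟩
    rw [← mem_zeros, hp, Finset.mem_singleton]

theorem Facet.neg {x : D4} {j : ι} (h : Facet u x j) : Facet u (-x) j := by
  obtain ⟨h1, y, h2, h3⟩ := h
  refine ⟨by simpa using h1, -y, by simpa using h2, fun i hi => ?_⟩
  simpa using h3 i hi

theorem tri_neg_iff {x : D4} : Tri u (-x) ↔ Tri u x := by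
  unfold Tri
  have : {j | Facet u (-x) j} = {j | Facet u x j} := by
    ext j
    exact ⟨fun h => by simpa using h.neg, fun h => h.neg⟩
  rw [this]

theorem signs_neg_ne {x : D4} {i : ι} (hi : x (u i) ≠ 0) : signs u (-x) ≠ signs u x := by
  intro h
  have := mul_pos_of_sign_eq (congrFun h i).symm hi
  simp only [LinearMap.neg_apply] at this
  nlinarith [mul_self_nonneg (x (u i))]

theorem zeros_neg {x : D4} : zeros u (-x) = zeros u x := by
  ext i; simp

/-- Double counting of skew vertices on faces that are not triangles. Each such vertex is on at
least two, a face and its negative; a face with `k ≥ 4` facets carries at most `k` of them, and `k ≤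
4 (k - 3)`. -/
theorem General.card_skewFlats_le (hG : General u) :
    ((skewFlats u).card : ℤ) ≤ 2 * excess u := by
  classical
  set N := (allFaces u).filter fun σ => (facets u σ).card ≠ 3 with hN
  have h3 : ∀ σ ∈ allFaces u, 3 ≤ (facets u σ).card := fun σ hσ => by
    obtain ⟨p, _, hp⟩ := Finset.mem_biUnion.1 hσ
    exact hG.three_le_facets hp
  have h1 : ∀ Z ∈ skewFlats u, 2 ≤ (N.filter fun σ => Incid u σ Z).card := by
    intro Z hZ
    obtain ⟨_, h4, w, hw, rfl, hng⟩ := Finset.mem_filter.1 hZ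
    have : ∃ x, (zeros u x).card = 1 ∧ Conf u w x ∧ ¬ Tri u x := by
      by_contra! hc
      exact hng ⟨h4, hc⟩
    obtain ⟨x, x1, xc, xt⟩ := this
    have hx : ∃ i, x (u i) ≠ 0 := by
      by_contra! hc
      rw [hG.span x hc] at xt
      have h2 : (zeros u (0 : D4)) = Finset.univ := by ext i; simp
      have h3 := Finset.card_le_univ (zeros u w)
      rw [hG.span x hc, h2, Finset.card_univ] at x1
      omega
    obtain ⟨i, hi⟩ := hx
    rw [← Finset.card_pair (signs_neg_ne hi)]
    refine Finset.card_le_card fun σ hσ => ?_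
    rw [Finset.mem_filter, hN, Finset.mem_filter, mem_allFaces]
    rcases Finset.mem_insert.1 hσ with rfl | hσ
    · exact ⟨⟨⟨-x, by rwa [zeros_neg], rfl⟩, by rwa [ne_eq, ← tri_iff, tri_neg_iff]⟩,
        incid_iff.2 ⟨-w, by simpa using hw, zeros_neg, xc.neg⟩⟩
    · rw [Finset.mem_singleton.1 hσ]
      exact ⟨⟨⟨x, x1, rfl⟩, by rwa [ne_eq, ← tri_iff]⟩, incid_iff.2 ⟨w, hw, rfl, xc⟩⟩
  have h2 : ∀ σ ∈ N, ((skewFlats u).filter fun Z => Incid u σ Z).card ≤ (facets u σ).card := by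
    intro σ hσ
    obtain ⟨p, _, hp⟩ := Finset.mem_biUnion.1 (Finset.mem_filter.1 hσ).1
    refine (Finset.card_le_card fun Z hZ => ?_).trans (hG.card_incid_le hp)
    obtain ⟨hZ, hI⟩ := Finset.mem_filter.1 hZ
    obtain ⟨hZ, h4, _⟩ := Finset.mem_filter.1 hZ
    exact Finset.mem_filter.2 ⟨hZ, h4, hI⟩
  have h4 : (skewFlats u).card * 2 ≤ ∑ σ ∈ N, (facets u σ).card := by
    calc (skewFlats u).card * 2 = ∑ Z ∈ skewFlats u, 2 := by rw [Finset.sum_const, smul_eq_mul]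
      _ ≤ ∑ Z ∈ skewFlats u, (N.filter fun σ => Incid u σ Z).card := Finset.sum_le_sum h1
      _ = ∑ σ ∈ N, ((skewFlats u).filter fun Z => Incid u σ Z).card :=
        (Finset.sum_card_bipartiteAbove_eq_sum_card_bipartiteBelow (Incid u)).symm
      _ ≤ _ := Finset.sum_le_sum h2
  have h5 : ∑ σ ∈ N, ((facets u σ).card : ℤ) ≤ 4 * excess u := by
    rw [excess_eq, Finset.mul_sum]
    calc ∑ σ ∈ N, ((facets u σ).card : ℤ) ≤ ∑ σ ∈ N, 4 * (((facets u σ).card : ℤ) - 3) := by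
          refine Finset.sum_le_sum fun σ hσ => ?_
          obtain ⟨hσ, hne⟩ := Finset.mem_filter.1 hσ
          have := h3 σ hσ
          omega
      _ ≤ _ := by
          refine Finset.sum_le_sum_of_subset_of_nonneg (Finset.filter_subset _ _)
            fun σ hσ _ => ?_
          have := h3 σ hσ
          omega
  zify at h4
  linarith

-- Each pair of walls through the vertex spans a line, along which there is at most one neighbour in
-- each of the two directions. Of three edges at the vertex on one line, two would be on the same
-- side.
open Classical in
theorem General.card_joined_le (hG : General u) {Z : Finset ι} (hZ : Z ∈ flats u) :
    ((flats u).filter fun Z' => Z' ≠ Z ∧ Joined u Z Z').card ≤ Z.card * (Z.card - 1) := by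
  obtain ⟨hZ3, w₀, h₀, hw₀⟩ := mem_flats.1 hZ
  have c₀ : 3 ≤ (zeros u w₀).card := by rw [hw₀]; exact hZ3
  set nb : Finset ι → Finset (Finset ι) := fun s => (flats u).filter fun Z' => Z' ≠ Z ∧
    ∃ e w' : D4, zeros u e = s ∧ w' ≠ 0 ∧ zeros u w' = Z' ∧ Conf u w₀ e ∧ Conf u w' e with hnb
  have hsub : ((flats u).filter fun Z' => Z' ≠ Z ∧ Joined u Z Z') ⊆
      (Z.powersetCard 2).biUnion nb := by
    intro Z' hZ'
    obtain ⟨hf, hne, e, w, w', he, hw, hw', rfl, rfl, hc, hc'⟩ := Finset.mem_filter.1 hZ'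
    obtain ⟨i, j, k, hi, hj, hk, hij, hik, hjk⟩ := Finset.two_lt_card_iff.1 hZ3
    rw [mem_zeros] at hi hj hk
    have hww := fun l => hw₀ ▸ (mem_zeros (u := u) (x := w₀) (i := l))
    obtain ⟨c, hcw⟩ := hG.proportional hij hik hjk hw hi hj hk ((hww i).1 (mem_zeros.2 hi))
      ((hww j).1 (mem_zeros.2 hj)) ((hww k).1 (mem_zeros.2 hk))
    have hc0 : c ≠ 0 := by rintro rfl; exact h₀ (by simpa using hcw)
    rw [Finset.mem_biUnion]
    refine ⟨zeros u e, Finset.mem_powersetCard.2 ⟨fun l hl => ?_, he⟩, ?_⟩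
    · exact mem_zeros.2 (hc.zero (mem_zeros.1 hl))
    · rw [hnb, Finset.mem_filter]
      refine ⟨hf, hne, ?_⟩
      rcases lt_or_gt_of_ne hc0 with h | h
      · refine ⟨-e, -w', zeros_neg, by simpa using hw', zeros_neg, ?_, hc'.neg⟩
        intro l hl
        rw [hcw] at hl ⊢
        have h1 : w (u l) ≠ 0 := by intro h2; simp [h2] at hl
        have := hc l h1
        simp only [LinearMap.smul_apply, smul_eq_mul, LinearMap.neg_apply]
        nlinarith
      · refine ⟨e, w', rfl, hw', rfl, ?_, hc'⟩
        intro l hl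
        rw [hcw] at hl ⊢
        have h1 : w (u l) ≠ 0 := by intro h2; simp [h2] at hl
        have := hc l h1
        simp only [LinearMap.smul_apply, smul_eq_mul]
        nlinarith
  refine (Finset.card_le_card hsub).trans ((Finset.card_biUnion_le_card_mul _ _ 2 ?_).trans_eq ?_)
  · intro s hs
    obtain ⟨_, hs2⟩ := Finset.mem_powersetCard.1 hs
    obtain ⟨p, q, hpq, rfl⟩ := Finset.card_eq_two.1 hs2
    obtain ⟨k, hk, hkp, hkq⟩ := exists_third c₀ p q
    by_contra hlt
    push Not at hlt
    obtain ⟨Z₁, m₁, Z₂, m₂, Z₃, m₃, n₁₂, n₁₃, n₂₃⟩ := Finset.two_lt_card.1 hlt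
    have get : ∀ Z' ∈ nb {p, q}, Z' ≠ Z ∧ ∃ e w' : D4, zeros u e = {p, q} ∧ w' ≠ 0 ∧
        3 ≤ (zeros u w').card ∧ zeros u w' = Z' ∧ Conf u w₀ e ∧ Conf u w' e ∧ e (u k) ≠ 0 := by
      intro Z' h
      obtain ⟨hf, hne, e, w', he, h1, rfl, h2⟩ := Finset.mem_filter.1 h
      refine ⟨hne, e, w', he, h1, (mem_flats.1 hf).1, rfl, h2.1, h2.2, fun h0 => ?_⟩
      have : k ∈ zeros u e := mem_zeros.2 h0
      simp [he, hkp, hkq] at this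
    obtain ⟨a₁, e₁, w₁, b₁, d₁, f₁, rfl, g₁, i₁, k₁⟩ := get Z₁ m₁
    obtain ⟨a₂, e₂, w₂, b₂, d₂, f₂, rfl, g₂, i₂, k₂⟩ := get Z₂ m₂
    obtain ⟨a₃, e₃, w₃, b₃, d₃, f₃, rfl, g₃, i₃, k₃⟩ := get Z₃ m₃
    rw [← hw₀] at a₁ a₂ a₃
    have hk' := mem_zeros.1 hk
    have H₁₂ : e₁ (u k) * e₂ (u k) < 0 := (lt_or_gt_of_ne (mul_ne_zero k₁ k₂)).resolve_right
      fun h => n₁₂ (hG.edge_end_unique' hpq b₁ b₂ h₀ c₀ g₁ g₂ hk' h d₁ f₁ i₁ d₂ f₂ i₂ a₁ a₂)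
    have H₁₃ : e₁ (u k) * e₃ (u k) < 0 := (lt_or_gt_of_ne (mul_ne_zero k₁ k₃)).resolve_right
      fun h => n₁₃ (hG.edge_end_unique' hpq b₁ b₃ h₀ c₀ g₁ g₃ hk' h d₁ f₁ i₁ d₃ f₃ i₃ a₁ a₃)
    have H₂₃ : e₂ (u k) * e₃ (u k) < 0 := (lt_or_gt_of_ne (mul_ne_zero k₂ k₃)).resolve_right
      fun h => n₂₃ (hG.edge_end_unique' hpq b₂ b₃ h₀ c₀ g₂ g₃ hk' h d₂ f₂ i₂ d₃ f₃ i₃ a₂ a₃)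
    have h1 := mul_pos_of_neg_of_neg H₁₂ H₁₃
    have h2 : 0 < e₁ (u k) ^ 2 * (e₂ (u k) * e₃ (u k)) := by
      have : e₁ (u k) ^ 2 * (e₂ (u k) * e₃ (u k)) =
        e₁ (u k) * e₂ (u k) * (e₁ (u k) * e₃ (u k)) := by ring
      rwa [this]
    exact lt_asymm H₂₃ (pos_of_mul_pos_right h2 (by positivity))
  · rw [Finset.card_powersetCard, Nat.choose_two_right,
      Nat.div_mul_cancel (Nat.even_mul_pred_self _).two_dvd]

theorem GoodV.pos_smul {w : D4} (h : GoodV u w) {c : ℝ} (hc : 0 < c) : GoodV u (c • w) := by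
  refine ⟨by rw [zeros_smul hc.ne']; exact h.1, fun x hx hcf => h.2 x hx fun i hi => ?_⟩
  have := hcf i (by simp [hi, hc.ne'])
  rw [LinearMap.smul_apply, smul_eq_mul, mul_assoc] at this
  exact pos_of_mul_pos_right this hc.le

/-- A flat determines its functional only up to a nonzero factor; a common edge makes that factor
positive. -/
theorem General.goodV_of_zeros_eq (hG : General u) {w w' e : D4} (hw : GoodV u w) (h0 : w ≠ 0)
    (h0' : w' ≠ 0) (hz : zeros u w' = zeros u w) (hc : Conf u w e) (hc' : Conf u w' e) :
    GoodV u w' := by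
  obtain ⟨i, j, k, hi, hj, hk, hij, hik, hjk⟩ :=
    Finset.two_lt_card_iff.1 (show 2 < (zeros u w).card by rw [hw.1]; norm_num)
  have hww := fun l => hz ▸ (mem_zeros (u := u) (x := w') (i := l))
  obtain ⟨c, rfl⟩ := hG.proportional hij hik hjk h0 (mem_zeros.1 hi) (mem_zeros.1 hj)
    (mem_zeros.1 hk) ((hww i).1 hi) ((hww j).1 hj) ((hww k).1 hk)
  refine hw.pos_smul ?_
  have hl : ∃ l, w (u l) ≠ 0 := by
    by_contra! h
    exact h0 (hG.span w h)
  obtain ⟨l, hl⟩ := hl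
  have hc0 : c ≠ 0 := by rintro rfl; simp at h0'
  have h1 := hc l hl
  have h2 := hc' l (by simp [hl, hc0])
  rw [LinearMap.smul_apply, smul_eq_mul, mul_assoc] at h2
  exact pos_of_mul_pos_left h2 h1.le

open Classical in
theorem General.badFlats_subset (hG : General u) : badFlats u ⊆ (oddFlats u ∪ skewFlats u) ∪
    (oddFlats u ∪ skewFlats u).biUnion fun Z' =>
      (flats u).filter fun Z => Z.card = 4 ∧ Z ≠ Z' ∧ Joined u Z' Z := by
  intro Z hZ
  obtain ⟨hf, w, hw, rfl, hE⟩ := Finset.mem_filter.1 hZ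
  have hmem : ∀ w : D4, zeros u w ∈ flats u → w ≠ 0 → ¬ GoodV u w →
      zeros u w ∈ oddFlats u ∪ skewFlats u := by
    intro w hf hw hg
    rw [Finset.mem_union, oddFlats, skewFlats, Finset.mem_filter, Finset.mem_filter]
    by_cases h4 : (zeros u w).card = 4
    · exact Or.inr ⟨hf, h4, w, hw, rfl, hg⟩
    · exact Or.inl ⟨hf, h4⟩
  rw [Finset.mem_union]
  by_cases hg : GoodV u w
  · right
    have : ∃ e w', (zeros u e).card = 2 ∧ 3 ≤ (zeros u w').card ∧ w' ≠ 0 ∧ Conf u w e ∧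
        Conf u w' e ∧ ¬ GoodV u w' := by
      by_contra! h
      exact hE ⟨hg, h⟩
    obtain ⟨e, w', he, h3, hw', hc, hc', hg'⟩ := this
    have hf' : zeros u w' ∈ flats u := mem_flats.2 ⟨h3, w', hw', rfl⟩
    rw [Finset.mem_biUnion]
    refine ⟨zeros u w', hmem w' hf' hw' hg', Finset.mem_filter.2 ⟨hf, hg.1, fun heq => ?_,
      e, w', w, he, hw', hw, rfl, rfl, hc', hc⟩⟩
    exact hg' (hG.goodV_of_zeros_eq hg hw hw' heq.symm hc hc')
  · exact Or.inl (hmem w hf hw hg)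

/-- The number of ordered pairs of points in a plane. -/
def pairCount (Z : Finset ι) : ℕ := Z.card * (Z.card - 1)

/-- A bad flat is odd or skew, or it has four points, hence `12` ordered pairs, and neighbours an
odd or skew flat `Z`. As `Z` has at most `pairCount Z` neighbours, the total is at most `1 + 12 =
13` times that over odd and skew flats. -/
theorem General.sum_badFlats_le (hG : General u) :
    ∑ Z ∈ badFlats u, pairCount Z ≤ 1950 * ((flats u).filter fun Z => Z.card = 3).card := by
  classical
  set R := oddFlats u ∪ skewFlats u with hR
  have hRf : ∀ Z ∈ R, Z ∈ flats u := fun Z hZ => by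
    rcases Finset.mem_union.1 hZ with h | h <;> exact (Finset.mem_filter.1 h).1
  have h1 : ∑ Z ∈ R.biUnion (fun Z' =>
      (flats u).filter fun Z => Z.card = 4 ∧ Z ≠ Z' ∧ Joined u Z' Z), pairCount Z ≤
      ∑ Z' ∈ R, 12 * pairCount Z' := by
    rw [Finset.sum_congr rfl fun Z hZ => show pairCount Z = 12 by
        obtain ⟨_, _, hZ⟩ := Finset.mem_biUnion.1 hZ
        rw [pairCount, (Finset.mem_filter.1 hZ).2.1],
      Finset.sum_const, smul_eq_mul, mul_comm, ← Finset.mul_sum]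
    refine Nat.mul_le_mul_left _ (Finset.card_biUnion_le.trans (Finset.sum_le_sum fun Z' hZ' =>
      le_trans (Finset.card_le_card fun Z hZ => ?_) (hG.card_joined_le (hRf Z' hZ'))))
    obtain ⟨a, _, b, c⟩ := Finset.mem_filter.1 hZ
    exact Finset.mem_filter.2 ⟨a, b, c⟩
  have h2 : ∑ Z ∈ badFlats u, pairCount Z ≤ 13 * ∑ Z ∈ R, pairCount Z := by
    have h4 := Finset.sum_le_sum_of_subset (f := fun Z : Finset ι => pairCount Z)
      hG.badFlats_subset
    rw [← hR] at h4
    have h3 := Finset.sum_union_inter (s₁ := R) (s₂ := R.biUnion fun Z' =>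
      (flats u).filter fun Z => Z.card = 4 ∧ Z ≠ Z' ∧ Joined u Z' Z)
      (f := fun Z : Finset ι => pairCount Z)
    rw [← Finset.mul_sum] at h1
    omega
  have h3 : ∑ Z ∈ R, pairCount Z ≤ ∑ Z ∈ oddFlats u, pairCount Z + 12 * (skewFlats u).card := by
    have h4 := Finset.sum_union_inter (s₁ := oddFlats u) (s₂ := skewFlats u)
      (f := fun Z : Finset ι => pairCount Z)
    rw [← hR] at h4
    have h5 : ∑ Z ∈ skewFlats u, pairCount Z = 12 * (skewFlats u).card := by
      rw [Finset.sum_congr rfl fun Z hZ =>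
        show pairCount Z = 12 by rw [pairCount, (Finset.mem_filter.1 hZ).2.1],
        Finset.sum_const, smul_eq_mul, mul_comm]
    omega
  have h6 := hG.card_skewFlats_le
  have h7 := hG.excess_le
  -- Each skew flat weighs `13 * 12` and there are at most twice the excess, whence `312`. A flat
  -- with three points contributes `13 * 6 + 312 * 6 = 1950`, one with four nothing, and a larger
  -- one is never positive.
  have h8 : 13 * (∑ Z ∈ oddFlats u, (pairCount Z : ℤ)) +
      312 * ∑ Z ∈ flats u, (Z.card : ℤ) * (8 - 2 * (Z.card : ℤ)) ≤
      1950 * (((flats u).filter fun Z => Z.card = 3).card : ℤ) := by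
    rw [oddFlats, Finset.sum_filter, Finset.card_filter, Nat.cast_sum, Finset.mul_sum,
      Finset.mul_sum, Finset.mul_sum, ← Finset.sum_add_distrib]
    refine Finset.sum_le_sum fun Z hZ => ?_
    have h3 := (mem_flats.1 hZ).1
    generalize hk : Z.card = k at h3
    have hp : (pairCount Z : ℤ) = k * ((k : ℤ) - 1) := by
      rw [pairCount, hk]; push_cast [show 1 ≤ k by omega]; ring
    rw [hp]
    rcases eq_or_ne k 3 with rfl | h3'
    · norm_num
    rcases eq_or_ne k 4 with rfl | h4'
    · norm_num
    · have h5 : (5 : ℤ) ≤ k := by omega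
      rw [if_pos h4', if_neg h3']
      push_cast
      nlinarith
  have h9 : (∑ Z ∈ badFlats u, pairCount Z) ≤
      13 * (∑ Z ∈ oddFlats u, pairCount Z + 12 * (skewFlats u).card) :=
    h2.trans (Nat.mul_le_mul_left _ h3)
  rw [← Nat.cast_le (α := ℤ)] at h9 ⊢
  push_cast at h9 ⊢
  linarith

/-! ### Choosing the line -/

/-- Some line is on few vertices that are not excellent. -/
theorem General.exists_line (hG : General u) : ∃ p q : ι, p ≠ q ∧
    ((badFlats u).filter fun Z => p ∈ Z ∧ q ∈ Z).card *
      (Fintype.card ι * (Fintype.card ι - 1)) ≤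
      1950 * ((flats u).filter fun Z => Z.card = 3).card := by
  classical
  have hne : ((Finset.univ : Finset ι).offDiag).Nonempty := by
    obtain ⟨i, _⟩ : ∃ i : ι, True := by
      by_contra! h
      have : IsEmpty ι := ⟨h⟩
      obtain ⟨x, hx⟩ := exists_ne (0 : D4)
      exact hx (hG.span x fun i => isEmptyElim i)
    obtain ⟨w, l, hi, _, _, hl⟩ := hG.exists_off_plane i i i
    refine ⟨(i, l), Finset.mem_offDiag.2 ⟨Finset.mem_univ _, Finset.mem_univ _, ?_⟩⟩
    exact fun h : i = l => hl (h ▸ hi)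
  obtain ⟨⟨p, q⟩, hpq, hmin⟩ := Finset.exists_min_image _
    (fun a : ι × ι => ((badFlats u).filter fun Z => a.1 ∈ Z ∧ a.2 ∈ Z).card) hne
  refine ⟨p, q, (Finset.mem_offDiag.1 hpq).2.2, le_trans ?_ hG.sum_badFlats_le⟩
  -- The minimum over ordered pairs is at most the average, and each bad flat is counted once for
  -- each of its ordered pairs.
  have h1 := Finset.card_nsmul_le_sum _ _ _ hmin
  have h2 := Finset.sum_card_bipartiteAbove_eq_sum_card_bipartiteBelow
    (s := (Finset.univ : Finset ι).offDiag) (t := badFlats u)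
    (fun (a : ι × ι) (Z : Finset ι) => a.1 ∈ Z ∧ a.2 ∈ Z)
  unfold Finset.bipartiteAbove at h2
  rw [h2, smul_eq_mul, Finset.offDiag_card, Finset.card_univ, ← Nat.mul_sub_one, mul_comm] at h1
  refine h1.trans_eq (Finset.sum_congr rfl fun Z _ => ?_)
  rw [pairCount, Nat.mul_sub_one, ← Finset.offDiag_card]
  congr 1
  ext a
  simp [Finset.bipartiteBelow]
  tauto

open Classical in
theorem Chart.card_badParams_le {p q : ι} {f g : D4} (h : Chart u p q f g) :
    (badParams u p q f g).card ≤ ((badFlats u).filter fun Z => p ∈ Z ∧ q ∈ Z).card := by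
  refine Finset.card_le_card_of_injOn (fun t => zeros u (g - t • f)) ?_ ?_
  · intro t ht
    obtain ⟨hp, hE⟩ := Finset.mem_filter.1 ht
    obtain ⟨i, hip, hiq, hi⟩ := mem_params.1 hp
    have mp : p ∈ zeros u (g - t • f) := mem_zeros.2 ((h.zero_iff t p).2 (by simp))
    have mq : q ∈ zeros u (g - t • f) := mem_zeros.2 ((h.zero_iff t q).2 (by simp))
    have mi : i ∈ zeros u (g - t • f) := mem_zeros.2 ((h.zero_iff t i).2 (by simp [*]))
    rw [Finset.mem_coe, Finset.mem_filter, badFlats, Finset.mem_filter, mem_flats]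
    exact ⟨⟨⟨three_le_card h.pq hip.symm hiq.symm mp mq mi, _, h.ind t, rfl⟩, _, h.ind t, rfl,
      hE⟩, mp, mq⟩
  · intro t ht s hs hts
    obtain ⟨hp, hE⟩ := Finset.mem_filter.1 ht
    obtain ⟨i, hip, hiq, hi⟩ := mem_params.1 hp
    have mi : i ∈ zeros u (g - t • f) := mem_zeros.2 ((h.zero_iff t i).2 (by simp [*]))
    have hts' : zeros u (g - t • f) = zeros u (g - s • f) := hts
    rw [hts', mem_zeros, h.zero_iff] at mi
    rcases mi with h1 | h1 | ⟨_, _, h1⟩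
    · exact absurd h1 hip
    · exact absurd h1 hiq
    · rw [← hi, h1]

/-! ### Back to projective space -/

section projective
open RealSpace

theorem incident_iff {p : PG3} {W : Submodule ℝ (Fin 4 → ℝ)} : Incident p W ↔ p.rep ∈ W := by
  rw [Incident, Projectivization.submodule_eq, Submodule.span_singleton_le_iff_mem]

theorem mem_zeroLocus {p : PG3} {Q : QuadraticForm ℝ (Fin 4 → ℝ)} (h : Q p.rep = 0) :
    p ∈ zeroLocus Q := by
  intro v hv
  rw [Projectivization.submodule_eq, Submodule.mem_span_singleton] at hv
  obtain ⟨a, rfl⟩ := hv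
  rw [QuadraticMap.map_smul, h, smul_zero]

theorem finrank_ker {w : D4} (hw : w ≠ 0) : Module.finrank ℝ (LinearMap.ker w) = 3 := by
  have h := LinearMap.finrank_range_add_finrank_ker w
  rw [LinearMap.range_eq_top.2 (LinearMap.surjective hw), finrank_top] at h
  simp at h
  omega

theorem general_rep {S : Finset PG3} (hcol : NoThreeCollinear S) (hcop : ¬ Coplanar S) :
    General (fun i : S => i.val.rep) := by
  refine ⟨fun i j k hij hik hjk => ?_, fun x hx => ?_⟩
  · by_contra hli
    refine hcol i i.2 j j.2 k k.2 (Subtype.val_injective.ne hij) (Subtype.val_injective.ne hik)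
      (Subtype.val_injective.ne hjk)
      ⟨Submodule.span ℝ (Set.range ![i.val.rep, j.val.rep, k.val.rep]), ?_, ?_, ?_, ?_⟩
    · have h1 : Module.finrank ℝ
          (Submodule.span ℝ (Set.range ![i.val.rep, j.val.rep, k.val.rep])) ≤ 3 := by
        have := finrank_range_le_card (R := ℝ) ![i.val.rep, j.val.rep, k.val.rep]
        simpa [Set.finrank] using this
      have h2 : Module.finrank ℝ
          (Submodule.span ℝ (Set.range ![i.val.rep, j.val.rep, k.val.rep])) ≠ 3 := by
        intro h
        refine hli (linearIndependent_iff_card_eq_finrank_span.2 ?_)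
        rw [Set.finrank, h, Fintype.card_fin]
      have h3 : LinearIndependent ℝ ![i.val.rep, j.val.rep] := by
        have h := Projectivization.independent_iff.1 ((Projectivization.independent_pair_iff_ne
          i.val j.val).2 (Subtype.val_injective.ne hij))
        have e : Projectivization.rep ∘ ![i.val, j.val] = ![i.val.rep, j.val.rep] := by
          funext m
          fin_cases m <;> rfl
        rwa [e] at h
      have h4 : Module.finrank ℝ (Submodule.span ℝ (Set.range ![i.val.rep, j.val.rep])) = 2 := by
        rw [finrank_span_eq_card h3, Fintype.card_fin]
      have h5 := Submodule.finrank_mono (R := ℝ) (Submodule.span_mono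
        (show Set.range ![i.val.rep, j.val.rep] ⊆
          Set.range ![i.val.rep, j.val.rep, k.val.rep] from ?_))
      · unfold IsLine
        omega
      · rintro _ ⟨m, rfl⟩
        fin_cases m
        · exact ⟨0, rfl⟩
        · exact ⟨1, rfl⟩
    · exact incident_iff.2 (Submodule.subset_span ⟨0, rfl⟩)
    · exact incident_iff.2 (Submodule.subset_span ⟨1, rfl⟩)
    · exact incident_iff.2 (Submodule.subset_span ⟨2, rfl⟩)
  · by_contra h0
    exact hcop ⟨LinearMap.ker x, finrank_ker h0, fun p hp =>
      incident_iff.2 (LinearMap.mem_ker.2 (hx ⟨p, hp⟩))⟩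

theorem card_flats_le_ordinaryPlanes {S : Finset PG3} [DecidableEq S] (hcol : NoThreeCollinear S) :
    ((flats (fun i : S => i.val.rep)).filter fun Z => Z.card = 3).card ≤
      (ordinaryPlanes S).ncard := by
  have key : ∀ Z ∈ (flats (fun i : S => i.val.rep)).filter (fun Z => Z.card = 3),
      ∃ H ∈ ordinaryPlanes S, ∀ i : S, i ∈ Z ↔ Incident i.val H := by
    intro Z hZ
    obtain ⟨hf, h3⟩ := Finset.mem_filter.1 hZ
    obtain ⟨_, w, hw, rfl⟩ := mem_flats.1 hf
    have hiff : ∀ i : S, i ∈ zeros (fun i : S => i.val.rep) w ↔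
        Incident i.val (LinearMap.ker w) := fun i => by
      rw [mem_zeros, incident_iff, LinearMap.mem_ker]
    refine ⟨LinearMap.ker w, ⟨finrank_ker hw, ?_⟩, hiff⟩
    rw [← h3, ← Set.ncard_coe_finset, ← Set.ncard_image_of_injective _ Subtype.val_injective]
    congr 1
    ext p
    constructor
    · rintro ⟨hp, hi⟩
      exact ⟨⟨p, hp⟩, (hiff _).2 hi, rfl⟩
    · rintro ⟨i, hi, rfl⟩
      exact ⟨i.2, (hiff i).1 hi⟩
  choose! H hH hHi using key
  rw [Set.ncard_eq_toFinset_card _ (ordinaryPlanes_finite hcol)]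
  refine Finset.card_le_card_of_injOn H (fun Z hZ => by simpa using hH Z hZ) ?_
  intro Z hZ Z' hZ' h
  ext i
  rw [hHi Z hZ, hHi Z' hZ', h]

theorem exists_cover {S : Finset PG3} {N : ℕ} (c : S → Fin N)
    (hc : ∀ k, OnPencil (fun i : S => i.val.rep) {i | c i = k}) :
    ∃ X : Fin N → Set PG3, (∀ i, IsIntersectionOfTwoQuadrics (X i)) ∧
      (S : Set PG3) ⊆ ⋃ i, X i := by
  choose Q₁ Q₂ hli hQ using hc
  refine ⟨fun k => zeroLocus (Q₁ k) ∩ zeroLocus (Q₂ k), fun k => ⟨Q₁ k, Q₂ k, hli k, rfl⟩, ?_⟩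
  intro p hp
  have h := hQ (c ⟨p, hp⟩) ⟨p, hp⟩ rfl
  exact Set.mem_iUnion.2 ⟨_, mem_zeroLocus h.1, mem_zeroLocus h.2⟩

theorem onPencil_of_subsingleton {ι : Type*} [Fintype ι] [DecidableEq ι] {u : ι → Fin 4 → ℝ} {I : Set ι}
    (hI : I.Subsingleton) : OnPencil u I := by
  rcases I.eq_empty_or_nonempty with rfl | ⟨i, hi⟩
  · obtain ⟨w, hw⟩ := exists_ne (0 : D4)
    exact OnPencil.of_plane hw (by simp)
  · obtain ⟨w, hw, h, _⟩ := exists_plane (u := u) i i i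
    exact OnPencil.of_plane hw fun j hj => by rw [hI hj hi, h]

theorem exists_coloring_card {ι : Type*} [Fintype ι] [DecidableEq ι] {u : ι → Fin 4 → ℝ}
    (hG : General u) : ∃ (B : ℕ) (c : ι → Fin (2 * B + 1)),
      (∀ k, OnPencil u {i | c i = k}) ∧ B * (Fintype.card ι * (Fintype.card ι - 1)) ≤
        1950 * ((flats u).filter fun Z => Z.card = 3).card := by
  classical
  obtain ⟨p, q, hpq, hB⟩ := hG.exists_line
  obtain ⟨f, g, hfg⟩ := hG.exists_chart hpq
  obtain ⟨c, hc⟩ := hfg.exists_coloring hG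
  exact ⟨_, c, hc, (Nat.mul_le_mul_right _ (by convert hfg.card_badParams_le)).trans hB⟩

end projective

end DualArrangement

theorem mainTheorem4 (S : Finset RealSpace.PG3) (n : ℕ) (hn : S.card = n)
    (hcol : RealSpace.NoThreeCollinear S) (hcop : ¬ RealSpace.Coplanar S)
    (K : ℝ) (hK : 1 ≤ K)
    (hord : ((RealSpace.ordinaryPlanes S).ncard : ℝ) < K * (n : ℝ) ^ 2) :
    ∃ (N : ℕ) (X : Fin N → Set RealSpace.PG3),
      (N : ℝ) ≤ 4143 * K ∧
      (∀ i, RealSpace.IsIntersectionOfTwoQuadrics (X i)) ∧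
      (S : Set RealSpace.PG3) ⊆ ⋃ i, X i := by
  classical
  -- For fewer than `18` points each gets a variety of its own. From `18` on, `n / (n - 1) ≤ 18 /
  -- 17`, and `1950 * 18 ≤ 2070 * 17`.
  rcases lt_or_ge n 18 with h18 | h18
  · obtain ⟨X, h1, h2⟩ := DualArrangement.exists_cover (fun i : S => (S.equivFin i)) fun k =>
      DualArrangement.onPencil_of_subsingleton fun i hi j hj => S.equivFin.injective (hi.trans hj.symm)
    refine ⟨_, X, ?_, h1, h2⟩
    rw [hn]
    have : (n : ℝ) < 18 := by exact_mod_cast h18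
    linarith
  · obtain ⟨B, c, hc, hB⟩ := DualArrangement.exists_coloring_card (DualArrangement.general_rep hcol hcop)
    obtain ⟨X, h1, h2⟩ := DualArrangement.exists_cover c hc
    refine ⟨_, X, ?_, h1, h2⟩
    have h3 := hB.trans (Nat.mul_le_mul_left 1950
      (by convert DualArrangement.card_flats_le_ordinaryPlanes hcol))
    rw [Fintype.card_coe, hn] at h3
    have h4 : ((B * (n * (n - 1)) : ℕ) : ℝ) ≤
        ((1950 * (RealSpace.ordinaryPlanes S).ncard : ℕ) : ℝ) := by exact_mod_cast h3
    push_cast [show 1 ≤ n by omega] at h4 ⊢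
    have h5 : (18 : ℝ) ≤ n := by exact_mod_cast h18
    have h6 : (n : ℝ) * (B * (n - 1)) ≤ n * (1950 * K * n) := by nlinarith
    have h7 : (B : ℝ) * (n - 1) ≤ 1950 * K * n := le_of_mul_le_mul_left h6 (by linarith)
    have h8 : (1950 * K * n : ℝ) ≤ 2070 * K * (n - 1) := by nlinarith
    have h9 : (B : ℝ) ≤ 2070 * K := le_of_mul_le_mul_right (h7.trans h8) (by linarith)
    -- With `B ≤ 2070 K` and `1 ≤ K`, the number `2B + 1` of colours is at most `4140 K + 1 ≤ 4143
    -- K`.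
    linarith
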